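/- **Setting.** Let $R=\mathbb C[u_1,\dots,u_p\,|\,\upsilon_1,\dots,\upsilon_q]$ be a free supercommutative algebra ($u_i$ even, $\upsilon_i$ odd). All odd quantities anticommute, including odd coordinates and the odd symbols $[d\theta]$, $[d\phi]$. Consider one formal superdisk with Ramond coordinates $\mathbf z=(z|\theta)$, $[dz]=[d\theta]\theta z$, $D^*_\theta=\partial_\theta+\theta z\partial_z$, the map $\mathbf x=(x|\phi)=(z^2|\sqrt2\,z\theta)$ (so $[d\phi]=\sqrt2\,z[d\theta]$), and the involution $\sigma\colon\mathbf z\mapsto-\mathbf z$, $[d\theta]\mapsto-[d\theta]$. For $\omega(\mathbf z_1,\mathbf z_2)=[d\theta_1][d\theta_2]\,g(\mathbf z_1,\mathbf z_2)$ the twisted super quadratic Casimir is $$\mathcal C^\sigma(\omega)(\mathbf z)=\tfrac12[d\theta]^3\Big(D^*_{\theta_1}g\big|_{\mathbf z_1=\mathbf z,\ \mathbf z_2=-\mathbf z}-D^*_{\theta_1}g\big|_{\mathbf z_1=-\mathbf z,\ \mathbf z_2=\mathbf z}\Big).$$ A local super spectral curve with one ramification point is given by a form $\omega_{0,1}=\sum_{k\in\mathbb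 Z}[dz]t_kz^{k-1}+[d\theta]\tau_kz^k$ and a symmetric bidifferential $$\begin{aligned}\mathbf B(\mathbf z_1,\mathbf z_2)={}&\mathbf B^{\mathrm R}(\mathbf z_1,\mathbf z_2)+\sum_{k,l\ge0}\Big([dz_1][dz_2]B_{kl}z_1^{k-1}z_2^{l-1}+[dz_1][d\theta_2]\big(1-\tfrac{\delta_{l0}}2\big)\phi_{kl}z_1^{k-1}z_2^l\\&+[d\theta_1][dz_2]\big(1-\tfrac{\delta_{k0}}2\big)\phi_{lk}z_1^kz_2^{l-1}+[d\theta_1][d\theta_2]\big(1-\tfrac{\delta_{k0}}2-\tfrac{\delta_{l0}}2\big)V_{kl}z_1^kz_2^l\Big),\\ \mathbf B^{\mathrm R}={}&[d\theta_1][d\theta_2]\Big(-\frac{\theta_1\theta_2z_1z_2}{(z_1-z_2)^2}-\frac{z_1+z_2}{2(z_1-z_2)}\Big),\end{aligned}$$ where $t_k,B_{kl},V_{kl}\in R$ are even and $\tau_k,\phi_{kl}\in R$ are odd; $t_k=\tau_k=0$ for $k\ll0$; $t_0=B_{k0}=\phi_{0k}=V_{00}=0$, $B_{kl}=B_{lk}$,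 $V_{kl}=-V_{lk}$; $s:=\min\{k\text{ odd}: t_k\text{ invertible}\}\in\{1,3\}$; and $\omega_{0,1}(\mathbf z)+\omega_{0,1}(-\mathbf z)=[d\theta]\,\mathcal O(z)$, $\mathcal C^\sigma(\omega_{0,1}\boxtimes\omega_{0,1})=[d\theta]^3\mathcal O(z^s)$. **Modes and partition function.** In even variables $x^k$ ($k\ge1$) and odd variables $\theta^k$ ($k\ge0$), with $A$ the set of indices of all these variables, let $J_k=\hbar\partial_{x^k}$, $J_0=0$, $J_{-k}=k\hbar x^k$, $\Gamma_k=\hbar\partial_{\theta^k}$, $\Gamma_0=\hbar(\tfrac12\theta^0+\partial_{\theta^0})$, $\Gamma_{-k}=\hbar\theta^k$ for $k>0$, and $$L_{2n}=\tfrac12\sum_{j\in\mathbb Z}(-1)^{j-1}{:}J_{-j}J_{2n+j}{:}+\tfrac12\sum_{j\in\mathbb Z}(-1)^j(j+n){:}\Gamma_{-j}\Gamma_{2n+j}{:}+\tfrac{\hbar^2}4\delta_{n,0},\qquad G_{2n+1}=\sum_{j\in\mathbb Z}(-1)^{j-1}J_{-j}\Gamma_{2n+1+j},$$ where ${:}XY{:}=XY-\langle0|XY|0\rangle$.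 Write $\tilde X=\Phi TXT^{-1}\Phi^{-1}$, with (terms containing $J_0$ omitted) $$T=\exp\Big(\hbar^{-2}\sum_{k\in\mathbb Z}\big(J_k\tfrac{t_k}k-\Gamma_k\tau_k\big)\Big),\qquad\Phi=\exp\Big(\tfrac1{2\hbar^2}\sum_{k,l\ge0}\big(\tfrac{J_kJ_l}{kl}B_{kl}-2\tfrac{J_k\Gamma_l}k\phi_{kl}+\Gamma_k\Gamma_lV_{kl}\big)\Big).$$ Let $Z=\exp\Big(\sum_{g\ge0,\,n\ge1,\,2g-2+n\ge0}\frac{\hbar^{2g-2+n}}{n!}\sum_{i_1,\dots,i_n\in A}x^{i_1}\cdots x^{i_n}F_{g,n}[i_1,\dots,i_n]\Big)$, with $x^i$ the variable of index $i$ and integer $g$, be any partition function: the $F_{g,n}[i_1,\dots,i_n]\in R$ are supersymmetric in their indices, have the parity of $x^{i_1}\cdots x^{i_n}$, only finitely many are non-zero for each $(g,n)$, and $Z$ is annihilated by $J_{2j},\Gamma_{2j-1},\tilde L_{2j-s-1},\tilde G_{2j-s}$ for all $j\ge1$. **Correlators.** For $k\ge1$ let $$\begin{aligned}d\xi_{-k}&=\frac{[dz]}{z^{k+1}}+\sum_{l\ge0}\Big([dz]\tfrac{2B_{kl}+\phi_{l0}\phi_{k0}}{2k}z^{l-1}+[d\theta]\tfrac{2\phi_{kl}+V_{0l}\phi_{k0}}{2k}z^l\Big),\qquad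 d\eta_0=[d\theta]+\sum_{l>0}\big([dz]\phi_{l0}z^{l-1}+[d\theta]V_{0l}z^l\big),\\ d\eta_{-k}&=\frac{[d\theta]}{z^k}+\sum_{l\ge0}\Big([dz]\tfrac{2\phi_{lk}+V_{k0}\phi_{l0}}2z^{l-1}+[d\theta]\tfrac{2V_{kl}+V_{k0}V_{0l}}2z^l\Big),\end{aligned}$$ and write $\zeta_i=d\xi_{-k}$ if $x^i=x^k$, and $\zeta_i=d\eta_{-k}$ if $x^i=\theta^k$ ($k\ge0$). Besides the given $\omega_{0,1}$, put $\omega_{g,n}(\mathbf z_1,\dots,\mathbf z_n)=\sum_{i_1,\dots,i_n\in A}\zeta_{i_1}(\mathbf z_1)\cdots\zeta_{i_n}(\mathbf z_n)F_{g,n}[i_1,\dots,i_n]$ for $2g-2+n\ge0$, with $\mathbf B$ added for $(g,n)=(0,2)$; $\omega_{-1,n}=0$. **The differentials $\mathcal E^i_{g,n}$.** Let $$\mathbf H^1(\mathbf x)=[d\phi]\sum_{j\in\mathbb Z}\frac{\phi\tilde J_{2j}+\sqrt2\,\tilde\Gamma_{2j+1}}{x^{j+1}},\qquad\mathbf H^2(\mathbf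 x)=-[d\phi]^3\sum_{j\in\mathbb Z}\frac1{x^{j+2}}\Big(\frac{\phi\tilde L_{2j}}2+\frac{\tilde G_{2j+1}}{2\sqrt2}\Big),$$ let $Z^{-1}\mathbf H^iZ=\sum_{g,n\ge0}\hbar^{2g+n}G^i_{g,n}(\mathbf x)$ (as functions), where $G^i_{g,n}$ is the part of degree $n$ in the variables $x^k,\theta^k$ of the coefficient of $\hbar^{2g+n}$, and for $[n]=\{1,\dots,n\}$ let $$\mathcal E^i_{g,n}(\mathbf x;\mathbf z_{[n]})=\prod_{j=1}^n\Big(\sum_{i'\in A}\zeta_{i'}(\mathbf z_j)\frac{\partial}{\partial x^{i'}}\Big)G^i_{g,n}(\mathbf x)=\prod_{j=1}^n\mathrm{ad}_{\hbar^{-1}\mathcal J(\mathbf z_j)}\,G^i_{g,n}(\mathbf x).$$ Here $\mathcal J=\sum_{k\in\mathbb Z}d\xi_{-k}J_k+d\eta_{-k}\Gamma_k$ with $d\xi_k=[dz]z^{k-1}$, $d\eta_k=[d\theta]z^k$ for $k>0$. **Proposition.** For all $g,n\ge0$, after pull back along $\mathbf x=(z^2|\sqrt2z\theta)$ and in the domain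 $|z|<|z_j|$, $$\mathcal E^1_{g,n}(\mathbf x;\mathbf z_{[n]})=\omega_{g,n+1}(\mathbf z,\mathbf z_{[n]})+\omega_{g,n+1}(-\mathbf z,\mathbf z_{[n]}),$$ $$\mathcal E^2_{g,n}(\mathbf x;\mathbf z_{[n]})=\mathcal C^\sigma(\omega_{g-1,n+2})(\mathbf z;\mathbf z_{[n]})+\mathcal C^\sigma\Big(\sum_{\substack{g_1+g_2=g\\I\sqcup J=[n]}}\omega_{g_1,|I|+1}(\cdot,\mathbf z_I)\otimes\omega_{g_2,|J|+1}(\cdot,\mathbf z_J)\Big)(\mathbf z),$$ and they satisfy the abstract loop equations $$\mathcal E^i_{g,n}(\mathbf x;\mathbf z_{[n]})=[d\phi]^{2i-1}\,\mathcal O\big(x^{(s-3)(i-1)/2}\big),\qquad i=1,2.$$ -/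

import Mathlib

noncomputable section

namespace SuperLoop

/-! ### Supercommutative algebras -/

/-- `ℂ[u₁, …, u_p]`, the even parameters. -/
abbrev EvenParams (p : ℕ) := MvPolynomial (Fin p) ℂ

/-- The base ring `R = ℂ[u₁, …, u_p | υ₁, …, υ_q]`, the free supercommutative algebra. -/
abbrev BaseRing (p q : ℕ) := ExteriorAlgebra (EvenParams p) (Fin q →₀ EvenParams p)

/-- `r` is homogeneous of parity `ε`. -/
def HasParity {p q : ℕ} (ε : ZMod 2) (r : BaseRing p q) : Prop :=
  r ∈ CliffordAlgebra.evenOdd (0 : QuadraticForm (EvenParams p) (Fin q →₀ EvenParams p)) ε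

/-- All odd generators that occur: the odd parameters `υ_i`, the odd coordinates `θ^k` on which the
partition function depends, and, for every argument `j` of a multidifferential, the odd coordinate
`θ_j` and the odd generator `[dθ_j]`. -/
inductive OddVar (q : ℕ) : Type
  | par (i : Fin q)
  | var (k : ℕ)
  | theta (j : ℕ)
  | dtheta (j : ℕ)

/-- The supercommutative algebra over `ℂ[u]` on all odd generators; they all anticommute. -/
abbrev Grass (p q : ℕ) := ExteriorAlgebra (EvenParams p) (OddVar q →₀ EvenParams p)

/-- `Grass[x¹, x², …]`: polynomials in the even `x^k` (`k ≥ 1`) and the odd `θ^k` (`k ≥ 0`). -/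
abbrev SuperPoly (p q : ℕ) := AddMonoidAlgebra (Grass p q) (ℕ+ →₀ ℕ)

/-- Power series in `ħ` whose coefficients are superpolynomials. -/
abbrev HSeries (p q : ℕ) := PowerSeries (SuperPoly p q)

variable {p q : ℕ}

/-- An odd generator as an element of the algebra. -/
def gen (v : OddVar q) : Grass p q := ExteriorAlgebra.ι (EvenParams p) (Finsupp.single v 1)

/-- The left derivative by an odd generator. -/
def dgen (v : OddVar q) : Grass p q →ₗ[EvenParams p] Grass p q :=
  CliffordAlgebra.contractLeft (Q := (0 : QuadraticForm (EvenParams p) (OddVar q →₀ EvenParams p)))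
    (Finsupp.lapply v)

/-- The odd coordinate `θ_j`. -/
def th (j : ℕ) : Grass p q := gen (.theta j)

/-- The odd generator `[dθ_j]`. In Ramond coordinates `[dz_j] = [dθ_j] θ_j z_j`. -/
def dth (j : ℕ) : Grass p q := gen (.dtheta j)

/-- The algebra endomorphism given by a linear substitution of the odd generators. -/
def substOdd (f : OddVar q → (OddVar q →₀ EvenParams p)) :
    Grass p q →ₐ[EvenParams p] Grass p q :=
  ExteriorAlgebra.map (Finsupp.linearCombination (EvenParams p) f)

/-- The inclusion of the base ring. -/
def ofBase : BaseRing p q →ₐ[EvenParams p] Grass p q :=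
  ExteriorAlgebra.map (Finsupp.lmapDomain (EvenParams p) (EvenParams p) OddVar.par)

/-- The inclusion of constants into superpolynomials. -/
def cst (c : Grass p q) : SuperPoly p q := AddMonoidAlgebra.single 0 c

/-- The index set `A = {B, F} × ℕ^* ∪ {(F, 0)}` of the coordinates. -/
inductive Idx : Type
  | bos (k : ℕ+)
  | fer (k : ℕ)

/-- The parity of a coordinate. -/
def Idx.parity : Idx → ℕ
  | .bos _ => 0
  | .fer _ => 1

/-- The coordinate `x^i`, that is, `x^k` or `θ^k`. -/
def coord : Idx → SuperPoly p q
  | .bos k => AddMonoidAlgebra.single (Finsupp.single k 1) 1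
  | .fer k => cst (gen (.var k))

/-- The left derivative `∂/∂x^i`. -/
def pd : Idx → SuperPoly p q → SuperPoly p q
  | .bos k, f => f.coeff.sum fun m c =>
      AddMonoidAlgebra.single (m - Finsupp.single k 1) ((m k) • c)
  | .fer k, f => f.coeff.sum fun m c => AddMonoidAlgebra.single m (dgen (.var k) c)

/-- Evaluation at `x^k = θ^k = 0`. -/
def augment (f : SuperPoly p q) : Grass p q :=
  substOdd (fun v => match v with
    | .var _ => 0
    | v => Finsupp.single v 1) (f.coeff 0)

/-! ### One-forms, bidifferentials and the twisted super quadratic Casimir -/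

/-- The formal one-form `∑_k [dz] u_k z^(k-1) + [dθ] v_k z^k` in Ramond coordinates. -/
structure OneForm (p q : ℕ) where
  u : ℤ → BaseRing p q
  v : ℤ → BaseRing p q

/-- The coefficient of `z_j^k` of the one-form in the coordinates `(z_j | θ_j)`; recall that
`[dz_j] z_j^(k-1) = [dθ_j] θ_j z_j^k`. -/
def OneForm.coeff (w : OneForm p q) (j : ℕ) (k : ℤ) : Grass p q :=
  dth j * th j * ofBase (w.u k) + dth j * ofBase (w.v k)

/-- The pull back of a form in `(z_0 | θ_0)`, given by its coefficients of the powers of `z_0`, by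
`σ : (z | θ) ↦ (-z | -θ)`. -/
def sigmaPull (f : ℤ → Grass p q) (N : ℤ) : Grass p q :=
  ((-1 : ℂ) ^ N) • substOdd (fun v => match v with
    | .theta 0 => -Finsupp.single (.theta 0) 1
    | .dtheta 0 => -Finsupp.single (.dtheta 0) 1
    | v => Finsupp.single v 1) (f N)

/-- A bidifferential in `(z_0 | θ_0)` and `(z_1 | θ_1)` with poles on `z_0 = 0`, `z_1 = 0` and the
diagonal, written as `(∑ num a b z_0^a z_1^b) / (z_0 - z_1)^ord`. -/
structure Bidiff (p q : ℕ) where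
  ord : ℕ
  num : ℤ → ℤ → Grass p q

/-- Multiplication of a double series by `z_0 - z_1`. -/
def mulDiag (f : ℤ → ℤ → Grass p q) (a b : ℤ) : Grass p q := f (a - 1) b - f a (b - 1)

/-- `D^*_{θ_0} = ∂/∂θ_0 + θ_0 z_0 ∂/∂z_0` on double series. -/
def dStar (f : ℤ → ℤ → Grass p q) (a b : ℤ) : Grass p q :=
  dgen (.theta 0) (f a b) + a • (th 0 * f a b)

/-- `g` in `ω = [dθ_0] [dθ_1] g`. -/
def stripForms (f : ℤ → ℤ → Grass p q) (a b : ℤ) : Grass p q :=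
  dgen (.dtheta 1) (dgen (.dtheta 0) (f a b))

/-- The numerator, over `(z_0 - z_1)^(m+1)`, of `D^*_{θ_0} (h / (z_0 - z_1)^m)`; note that
`D^*_{θ_0} (z_0 - z_1) = θ_0 z_0`. -/
def dStarFrac (m : ℕ) (h : ℤ → ℤ → Grass p q) (a b : ℤ) : Grass p q :=
  mulDiag (dStar h) a b - m • (th 0 * h (a - 1) b)

/-- The restriction to `(z_0 | θ_0) = (z | θ)`, `(z_1 | θ_1) = (-z | -θ)`; the coordinates `(z | θ)`
keep the label `0`. The sum is finite when the poles at `z_0 = 0`, `z_1 = 0` have bounded order. -/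
def restrictPos (f : ℤ → ℤ → Grass p q) (N : ℤ) : Grass p q :=
  ∑ᶠ a : ℤ, ((-1 : ℂ) ^ (N - a)) • substOdd (fun v => match v with
    | .theta 1 => -Finsupp.single (.theta 0) 1
    | v => Finsupp.single v 1) (f a (N - a))

/-- The restriction to `(z_0 | θ_0) = (-z | -θ)`, `(z_1 | θ_1) = (z | θ)`. -/
def restrictNeg (f : ℤ → ℤ → Grass p q) (N : ℤ) : Grass p q :=
  ∑ᶠ a : ℤ, ((-1 : ℂ) ^ a) • substOdd (fun v => match v with
    | .theta 0 => -Finsupp.single (.theta 0) 1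
    | .theta 1 => Finsupp.single (.theta 0) 1
    | v => Finsupp.single v 1) (f a (N - a))

/-- The twisted super quadratic Casimir. For `ω = [dθ_0] [dθ_1] g`, this is the coefficient of
`[dθ]³ z^N` in
`½ [dθ]³ (D^*_{θ_0} g |_{z_0 = z, z_1 = σ z} - D^*_{θ_0} g |_{z_0 = σ z, z_1 = z})`;
the denominator `(z_0 - z_1)^(ord+1)` of `D^*_{θ_0} g` restricts to `(± 2 z)^(ord+1)`. -/
def casimir (w : Bidiff p q) (N : ℤ) : Grass p q :=
  (2⁻¹ : ℂ) •
    (((2 : ℂ) ^ (w.ord + 1))⁻¹ •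
        restrictPos (dStarFrac w.ord (stripForms w.num)) (N + (w.ord + 1)) -
      ((-2 : ℂ) ^ (w.ord + 1))⁻¹ •
        restrictNeg (dStarFrac w.ord (stripForms w.num)) (N + (w.ord + 1)))

/-! ### Local super spectral curves with one ramification point -/

/-- The coefficients of `ω_{0,1}` and of `B` in Ramond coordinates `(z | θ)` for which
`x = (z² | √2 z θ)`. -/
structure CurveData (p q : ℕ) where
  t : ℤ → BaseRing p q
  τ : ℤ → BaseRing p q
  B : ℕ → ℕ → BaseRing p q
  φ : ℕ → ℕ → BaseRing p q
  V : ℕ → ℕ → BaseRing p q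

namespace CurveData

/-- `ω_{0,1} = ∑_k [dz] t_k z^(k-1) + [dθ] τ_k z^k`. -/
def omega01 (S : CurveData p q) : OneForm p q := ⟨S.t, S.τ⟩

/-- `ω_{0,1} ⊠ ω_{0,1}`. -/
def omega01Sq (S : CurveData p q) : Bidiff p q :=
  ⟨0, fun a b => S.omega01.coeff 0 a * S.omega01.coeff 1 b⟩

/-- The data define a local super spectral curve with one ramification point: the parities, the
symmetry of `B`, meromorphy and absence of residues of `ω_{0,1}`, the condition on `s`, and the two
local conditions
`ω_{0,1}(z) + ω_{0,1}(σ z) = [dθ] O(z)`, `C^σ(ω_{0,1} ⊠ ω_{0,1}) = [dθ]³ O(z^s)`. -/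
structure IsLocalSuperSpectralCurve (S : CurveData p q) (s : ℤ) : Prop where
  t_even : ∀ k, HasParity 0 (S.t k)
  tau_odd : ∀ k, HasParity 1 (S.τ k)
  B_even : ∀ k l, HasParity 0 (S.B k l)
  phi_odd : ∀ k l, HasParity 1 (S.φ k l)
  V_even : ∀ k l, HasParity 0 (S.V k l)
  meromorphic : ∃ M : ℤ, ∀ k < M, S.t k = 0 ∧ S.τ k = 0
  t_zero : S.t 0 = 0
  B_zero : ∀ k, S.B k 0 = 0
  phi_zero : ∀ k, S.φ 0 k = 0
  V_zero : S.V 0 0 = 0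
  B_symm : ∀ k l, S.B k l = S.B l k
  V_antisymm : ∀ k l, S.V k l = -S.V l k
  isLeast_s : IsLeast {k : ℤ | Odd k ∧ IsUnit (S.t k)} s
  s_mem : s = 1 ∨ s = 3
  linear : ∀ N : ℤ, N < 1 →
    S.omega01.coeff 0 N + sigmaPull (fun N => S.omega01.coeff 0 N) N = 0
  quadratic : ∀ N : ℤ, N < s → casimir S.omega01Sq N = 0

/-- The numerator over `(z_0 - z_1)²` of
`B^R = [dθ_0][dθ_1] (- θ_0 θ_1 z_0 z_1 / (z_0 - z_1)² - (z_0 + z_1) / (2 (z_0 - z_1)))`. -/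
def bRNum (a b : ℤ) : Grass p q :=
  if a = 1 ∧ b = 1 then -(dth 0 * dth 1 * th 0 * th 1)
  else if a = 2 ∧ b = 0 then -((2⁻¹ : ℂ) • (dth 0 * dth 1))
  else if a = 0 ∧ b = 2 then (2⁻¹ : ℂ) • (dth 0 * dth 1)
  else 0

/-- The expansion of `B^R` in the arguments `i`, `j` for `|z_i| < |z_j|`. -/
def bRExp (i j : ℕ) (a b : ℤ) : Grass p q :=
  if a + b = 0 then
    if 0 < a then -(a • (dth i * dth j * th i * th j)) + dth i * dth j
    else if a = 0 then (2⁻¹ : ℂ) • (dth i * dth j)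
    else 0
  else 0

/-- `bRExp` is the expansion of the rational function with numerator `bRNum`. -/
theorem mulDiag_mulDiag_bRExp :
    mulDiag (mulDiag (bRExp (p := p) (q := q) 0 1)) = bRNum := by
  funext a b
  by_cases hab : a + b = 2
  · obtain rfl : b = 2 - a := by omega
    have e1 : a - 1 - 1 + (2 - a) = 0 := by ring
    have e2 : a - 1 + (2 - a - 1) = 0 := by ring
    have e3 : a + (2 - a - 1 - 1) = 0 := by ring
    simp only [mulDiag, bRExp, bRNum, e1, e2, e3, if_true]
    rcases lt_trichotomy a 1 with h | h | h
    · rcases lt_or_eq_of_le (show a ≤ 0 by omega) with h0 | h0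
      · have : ¬ a = 2 := by omega
        have : ¬ a = 1 := by omega
        have : ¬ 0 < a := by omega
        have : ¬ a = 0 := by omega
        have : ¬ 1 < a := by omega
        have : ¬ 1 < a - 1 := by omega
        have : ¬ a - 1 = 0 := by omega
        have : ¬ a - 1 - 1 = 0 := by omega
        simp [*]
      · subst h0
        simp
    · subst h
      simp
      module
    · rcases eq_or_lt_of_le (show 2 ≤ a by omega) with h2 | h2
      · subst h2
        simp [two_mul]
        module
      · have g1 : 0 < a - 1 - 1 := by omega
        have g2 : 0 < a - 1 := by omega
        have g3 : 0 < a := by omega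
        have g4 : ¬ a = 1 := by omega
        have g5 : ¬ a = 2 := by omega
        have g6 : ¬ a = 0 := by omega
        simp only [g1, g2, g3, g4, g5, g6, if_true, if_false, false_and, sub_smul, one_smul]
        abel
  · have e1 : ¬ a - 1 - 1 + b = 0 := by omega
    have e2 : ¬ a - 1 + (b - 1) = 0 := by omega
    have e3 : ¬ a + (b - 1 - 1) = 0 := by omega
    have f1 : ¬ (a = 1 ∧ b = 1) := by omega
    have f2 : ¬ (a = 2 ∧ b = 0) := by omega
    have f3 : ¬ (a = 0 ∧ b = 2) := by omega
    simp [mulDiag, bRExp, bRNum, e1, e2, e3, f1, f2, f3]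

/-- The regular part `B - B^R` in the arguments `i`, `j`:
`∑ [dz_i][dz_j] B_{kl} z_i^(k-1) z_j^(l-1) + [dz_i][dθ_j] (1 - δ_{0l}/2) φ_{kl} z_i^(k-1) z_j^l
+ [dθ_i][dz_j] (1 - δ_{k0}/2) φ_{lk} z_i^k z_j^(l-1)
+ [dθ_i][dθ_j] (1 - δ_{k0}/2 - δ_{l0}/2) V_{kl} z_i^k z_j^l`. -/
def bReg (S : CurveData p q) (i j : ℕ) (a b : ℤ) : Grass p q :=
  if 0 ≤ a ∧ 0 ≤ b then
    let k := a.toNat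
    let l := b.toNat
    let δk : ℂ := if k = 0 then 2⁻¹ else 0
    let δl : ℂ := if l = 0 then 2⁻¹ else 0
    dth i * th i * (dth j * th j) * ofBase (S.B k l)
      + (1 - δl) • (dth i * th i * dth j * ofBase (S.φ k l))
      + (1 - δk) • (dth i * (dth j * th j) * ofBase (S.φ l k))
      + (1 - δk - δl) • (dth i * dth j * ofBase (S.V k l))
  else 0

/-- The singular basis forms: `xi (bos k) = dξ_{-k}`, `xi (fer k) = dη_{-k}`. -/
def xi (S : CurveData p q) : Idx → OneForm p q
  | .bos k =>
    { u := fun l => if l = -(k : ℤ) then 1 else if 0 ≤ l then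
        (2 * (k : ℂ))⁻¹ • (2 • S.B k l.toNat + S.φ l.toNat 0 * S.φ k 0) else 0
      v := fun l => if 0 ≤ l then
        (2 * (k : ℂ))⁻¹ • (2 • S.φ k l.toNat + S.V 0 l.toNat * S.φ k 0) else 0 }
  | .fer 0 =>
    { u := fun l => if 0 < l then S.φ l.toNat 0 else 0
      v := fun l => if l = 0 then 1 else if 0 < l then S.V 0 l.toNat else 0 }
  | .fer (k + 1) =>
    { u := fun l => if 0 ≤ l then
        (2⁻¹ : ℂ) • (2 • S.φ l.toNat (k + 1) + S.V (k + 1) 0 * S.φ l.toNat 0) else 0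
      v := fun l => if l = -((k : ℤ) + 1) then 1 else if 0 ≤ l then
        (2⁻¹ : ℂ) • (2 • S.V (k + 1) l.toNat + S.V (k + 1) 0 * S.V 0 l.toNat) else 0 }

end CurveData

/-! ### Heisenberg and Clifford modes, super Virasoro operators -/

/-- Coefficientwise action on power series in `ħ`. -/
def mapH (D : SuperPoly p q → SuperPoly p q) (f : HSeries p q) : HSeries p q :=
  PowerSeries.mk fun d => D (PowerSeries.coeff d f)

/-- `J_k = ħ ∂_{x^k}` for `k > 0`, `J_0 = 0`, `J_{-k} = k ħ x^k` for `k > 0`. -/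
def opJ : ℤ → HSeries p q → HSeries p q
  | .ofNat 0, _ => 0
  | .ofNat (k + 1), f => PowerSeries.X * mapH (pd (.bos k.succPNat)) f
  | .negSucc k, f => (k + 1) • (PowerSeries.X * mapH (fun c => coord (.bos k.succPNat) * c) f)

/-- `Γ_k = ħ ∂_{θ^k}` for `k > 0`, `Γ_0 = ħ (θ^0 / 2 + ∂_{θ^0})`, `Γ_{-k} = ħ θ^k` for `k > 0`. -/
def opG : ℤ → HSeries p q → HSeries p q
  | .ofNat 0, f => PowerSeries.X *
      mapH (fun c => (2⁻¹ : ℂ) • (coord (.fer 0) * c) + pd (.fer 0) c) f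
  | .ofNat (k + 1), f => PowerSeries.X * mapH (pd (.fer (k + 1))) f
  | .negSucc k, f => PowerSeries.X * mapH (fun c => coord (.fer (k + 1)) * c) f

/-- `(a, b, c)` stands for the linear field `∑_k a_k J_k + b_k Γ_k + c` with coefficients in the base
ring, where `a_k = b_k = 0` for `k ≪ 0`. -/
abbrev Mode (p q : ℕ) := (ℤ → BaseRing p q) × (ℤ → BaseRing p q) × BaseRing p q

def modeJ (k : ℤ) : Mode p q := (Pi.single k 1, 0, 0)

def modeG (k : ℤ) : Mode p q := (0, Pi.single k 1, 0)

/-- The action of a linear field; on each power of `ħ` the sum is finite. -/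
def Mode.act (X : Mode p q) (f : HSeries p q) : HSeries p q :=
  PowerSeries.mk fun d =>
    ∑ᶠ k : ℤ, (cst (ofBase (X.1 k)) * PowerSeries.coeff d (opJ k f)
        + cst (ofBase (X.2.1 k)) * PowerSeries.coeff d (opG k f))
      + cst (ofBase X.2.2) * PowerSeries.coeff d f

/-- `⟨J_k J_l⟩ = ħ² k δ_{k+l,0} 1_{k>0}`, the vacuum expectation value. -/
def vevJ (k l : ℤ) : HSeries p q :=
  if k + l = 0 ∧ 0 < k then k • PowerSeries.X ^ 2 else 0

/-- `⟨Γ_k Γ_l⟩ = ħ² δ_{k+l,0} (1_{k>0} + ½ δ_{k,0})`, the vacuum expectation value. -/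
def vevG (k l : ℤ) : HSeries p q :=
  if k + l = 0 then
    if 0 < k then PowerSeries.X ^ 2
    else if k = 0 then (2⁻¹ : ℂ) • PowerSeries.X ^ 2
    else 0
  else 0

/-- `L_{2n} = ½ ∑_j (-1)^(j-1) :J_{-j} J_{2n+j}: + ½ ∑_j (-1)^j (j+n) :Γ_{-j} Γ_{2n+j}: + ħ²/4 δ_{n,0}`,
with `:XY: = XY - ⟨XY⟩`, as an expression in modes `J`, `Γ`. Inserting the images of the modes under
an automorphism gives the image of `L_{2n}`. -/
def virL (J Γ : ℤ → HSeries p q → HSeries p q) (n : ℤ) (f : HSeries p q) : HSeries p q :=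
  PowerSeries.mk fun d =>
    (2⁻¹ : ℂ) • (∑ᶠ j : ℤ, ((-1 : ℂ) ^ (j - 1)) •
        PowerSeries.coeff d (J (-j) (J (2 * n + j) f) - vevJ (-j) (2 * n + j) * f))
    + (2⁻¹ : ℂ) • (∑ᶠ j : ℤ, ((-1 : ℂ) ^ j * ((j : ℂ) + n)) •
        PowerSeries.coeff d (Γ (-j) (Γ (2 * n + j) f) - vevG (-j) (2 * n + j) * f))
    + if n = 0 then (4⁻¹ : ℂ) • PowerSeries.coeff d (PowerSeries.X ^ 2 * f) else 0

/-- `G_{2n+1} = ∑_j (-1)^(j-1) J_{-j} Γ_{2n+1+j}`, as an expression in modes `J`, `Γ`. -/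
def virG (J Γ : ℤ → HSeries p q → HSeries p q) (n : ℤ) (f : HSeries p q) : HSeries p q :=
  PowerSeries.mk fun d =>
    ∑ᶠ j : ℤ, ((-1 : ℂ) ^ (j - 1)) • PowerSeries.coeff d (J (-j) (Γ (2 * n + 1 + j) f))

namespace CurveData

/-- The commutator with `log T = ħ⁻² ∑_k (J_k t_k / k - Γ_k τ_k)`: by
`[J_k, J_l] = ħ² k δ_{k+l}` and `[Γ_k, Γ_l] = ħ² δ_{k+l}` (supercommutators) it sends
`J_{-k}` to `t_k` and `Γ_{-k}` to `τ_k`. -/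
def adT (S : CurveData p q) (X : Mode p q) : Mode p q :=
  (0, 0, ∑ᶠ k : ℤ, (X.1 (-k) * S.t k + X.2.1 (-k) * S.τ k))

/-- The commutator with
`log Φ = (1/2ħ²) ∑_{k,l≥0} (J_k J_l B_{kl} / (k l) - 2 J_k Γ_l φ_{kl} / k + Γ_k Γ_l V_{kl})`, where
terms with `J_0` are absent: it sends, for `m ≥ 0`, `J_{-m}` to `∑_k B_{mk} J_k / k + φ_{mk} Γ_k`
and `Γ_{-m}` to `∑_k φ_{km} J_k / k + V_{km} Γ_k`. -/
def adPhi (S : CurveData p q) (X : Mode p q) : Mode p q :=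
  (fun k => if 0 < k then (k : ℂ)⁻¹ • ∑ᶠ m : ℕ,
      (X.1 (-m) * S.B m k.toNat + X.2.1 (-m) * S.φ k.toNat m) else 0,
   fun k => if 0 ≤ k then ∑ᶠ m : ℕ,
      (X.1 (-m) * S.φ m k.toNat + X.2.1 (-m) * S.V k.toNat m) else 0,
   0)

/-- Conjugation `X ↦ Φ T X T⁻¹ Φ⁻¹ = exp (ad log Φ) (exp (ad log T) X)` of linear fields. The
exponential series stop because `(ad log T)² = 0` and `(ad log Φ)³ = 0`. -/
def conj (S : CurveData p q) (X : Mode p q) : Mode p q :=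
  let Y := X + S.adT X
  Y + S.adPhi Y + (2⁻¹ : ℂ) • S.adPhi (S.adPhi Y)

theorem adT_adT (S : CurveData p q) (X : Mode p q) : S.adT (S.adT X) = 0 := by
  simp [adT]

theorem adPhi_adPhi_adPhi (S : CurveData p q) (hV : S.V 0 0 = 0) (X : Mode p q) :
    S.adPhi (S.adPhi (S.adPhi X)) = 0 := by
  have h1 : ∀ (Y : Mode p q) (m : ℕ), (S.adPhi Y).1 (-m) = 0 := fun Y m => by simp [adPhi]
  have h2 : ∀ (Y : Mode p q) (m : ℕ), m ≠ 0 → (S.adPhi Y).2.1 (-m) = 0 := fun Y m hm => by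
    simp [adPhi, hm]
  have h3 : ∀ (Y : Mode p q), (S.adPhi (S.adPhi Y)).2.1 0 = 0 := fun Y => by
    have : ∀ m : ℕ, (S.adPhi Y).1 (-m) * S.φ m (0 : ℤ).toNat
        + (S.adPhi Y).2.1 (-m) * S.V (0 : ℤ).toNat m = 0 := fun m => by
      by_cases hm : m = 0
      · subst hm; rw [h1]; simp [hV]
      · rw [h1, h2 _ _ hm]; simp
    rw [adPhi]
    simp only [le_refl, if_true, this, finsum_zero]
  have h4 : ∀ m : ℕ, (S.adPhi (S.adPhi X)).2.1 (-m) = 0 := fun m => by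
    by_cases hm : m = 0
    · subst hm; simpa using h3 X
    · exact h2 _ _ hm
  generalize hY : S.adPhi (S.adPhi X) = Y at *
  have h5 : ∀ m : ℕ, Y.1 (-m) = 0 := fun m => by rw [← hY]; exact h1 _ m
  simp [adPhi, h4, h5]
  rfl

end CurveData

/-! ### The partition function -/

/-- The coefficients `F_{g,n}[i₁, …, iₙ]`; for fixed `(g, n)` only finitely many are non-zero. -/
abbrev FCoeffs (p q : ℕ) := (g n : ℕ) → ((Fin n → Idx) →₀ BaseRing p q)

/-- `log Z = ∑_{g,n} ħ^(2g-2+n) / n! ∑_i x^{i₁} ⋯ x^{iₙ} F_{g,n}[i₁, …, iₙ]`, over `n ≥ 1` and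
`2g - 2 + n ≥ 0`. The coefficient of `ħ^d` collects the terms with `n = d + 2 - 2g`. -/
def logZ (F : FCoeffs p q) : HSeries p q :=
  PowerSeries.mk fun d => ∑ g ∈ Finset.range ((d + 1) / 2 + 1),
    (((d + 2 - 2 * g).factorial : ℂ)⁻¹) • (F g (d + 2 - 2 * g)).sum fun i r =>
      (List.ofFn fun k => coord (i k)).prod * cst (ofBase r)

/-- `Z⁻¹ X Z = X + [X, log Z]` for a linear field `X`, as an operator. The higher commutators vanish,
since `X` is of first order, and `log Z` is even. -/
def conjZ (F : FCoeffs p q) (X : Mode p q) (f : HSeries p q) : HSeries p q :=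
  X.act f + (X.act (logZ F * f) - logZ F * X.act f)

namespace CurveData

/-- `Z⁻¹ (Φ T J_k T⁻¹ Φ⁻¹) Z`. -/
def tJ (S : CurveData p q) (F : FCoeffs p q) (k : ℤ) : HSeries p q → HSeries p q :=
  conjZ F (S.conj (modeJ k))

/-- `Z⁻¹ (Φ T Γ_k T⁻¹ Φ⁻¹) Z`. -/
def tG (S : CurveData p q) (F : FCoeffs p q) (k : ℤ) : HSeries p q → HSeries p q :=
  conjZ F (S.conj (modeG k))

/-- `Z = exp (log Z)` is a partition function of the super Airy structure generated by
`J_{2j}`, `Γ_{2j-1}`, `Φ T L_{2j-s-1} T⁻¹ Φ⁻¹`, `Φ T G_{2j-s} T⁻¹ Φ⁻¹` for `j ≥ 1`: the coefficients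
`F_{g,n}` are supersymmetric tensors of the right parity, they vanish for `2g - 2 + n < 0` and for
`n = 0`, and each generator `H` satisfies `H Z = 0`, that is, `(Z⁻¹ H Z) 1 = 0`. -/
structure IsPartitionFunction (S : CurveData p q) (s : ℤ) (F : FCoeffs p q) : Prop where
  unstable : ∀ g n, n = 0 ∨ 2 * g + n < 2 → F g n = 0
  parity : ∀ g n (i : Fin n → Idx), HasParity ((∑ k, (i k).parity : ℕ) : ZMod 2) (F g n i)
  symm : ∀ g n (i : Fin n → Idx) (k l : Fin n), (k : ℕ) + 1 = l →
    F g n (i ∘ Equiv.swap k l) = (-1) ^ ((i k).parity * (i l).parity) * F g n i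
  ann_J : ∀ j : ℤ, 1 ≤ j → conjZ F (modeJ (2 * j)) 1 = 0
  ann_Gamma : ∀ j : ℤ, 1 ≤ j → conjZ F (modeG (2 * j - 1)) 1 = 0
  ann_L : ∀ j n : ℤ, 1 ≤ j → 2 * n = 2 * j - s - 1 → virL (S.tJ F) (S.tG F) n 1 = 0
  ann_G : ∀ j n : ℤ, 1 ≤ j → 2 * n + 1 = 2 * j - s → virG (S.tJ F) (S.tG F) n 1 = 0

/-! ### Correlators -/

/-- The part `∑_i ∏_k dξ_{-i_k}(z_k) F_{g,n}[i₁, …, iₙ]` of a correlator: the coefficient of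
`∏_k z_{j_k}^{e_k}`, where `j_k` is the label of the `k`-th argument. -/
def omegaF (S : CurveData p q) (F : FCoeffs p q) (g n : ℕ) (j : Fin n → ℕ) (e : Fin n → ℤ) :
    Grass p q :=
  (F g n).sum fun i r => (List.ofFn fun k => (S.xi (i k)).coeff (j k) (e k)).prod * ofBase r

/-- `ω_{0,1}`, and `B` expanded for `|z_{j_0}| < |z_{j_1}|`. -/
def omegaUnstable (S : CurveData p q) :
    (g n : ℕ) → (Fin n → ℕ) → (Fin n → ℤ) → Grass p q
  | 0, 1, j, e => S.omega01.coeff (j 0) (e 0)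
  | 0, 2, j, e => bRExp (j 0) (j 1) (e 0) (e 1) + S.bReg (j 0) (j 1) (e 0) (e 1)
  | _, _, _, _ => 0

/-- The correlator `ω_{g,n}` in the arguments `j₀, …, j_{n-1}`, with `|z_{j_0}| < |z_{j_1}|` when
`(g,n) = (0,2)`; the coefficient of `∏_k z_{j_k}^{e_k}`. -/
def omega (S : CurveData p q) (F : FCoeffs p q) (g n : ℕ) (j : Fin n → ℕ) (e : Fin n → ℤ) :
    Grass p q :=
  S.omegaUnstable g n j e + S.omegaF F g n j e

/-- The arguments `z_[n]` carry the labels `2, …, n + 1`; the labels `0` and `1` are kept for the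
arguments of the Casimir. -/
def spectator {n : ℕ} (k : Fin n) : ℕ := k + 2

/-- `ω_{g,n+1}(z, z_[n])` as a one-form in `z`; the coefficient of `∏_k z_k^{e_k}`. -/
def omegaOne (S : CurveData p q) (F : FCoeffs p q) (g n : ℕ) (e : Fin n → ℤ) (N : ℤ) :
    Grass p q :=
  S.omega F g (n + 1) (Fin.cons 0 spectator) (Fin.cons N e)

/-- `ω_{g,n+2}(z_0, z_1, z_[n])` as a bidifferential in the first two arguments, over
`(z_0 - z_1)²`. Only `ω_{0,2}` has a pole on the diagonal. -/
def omegaTwo (S : CurveData p q) (F : FCoeffs p q) (g n : ℕ) (e : Fin n → ℤ) : Bidiff p q where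
  ord := 2
  num := fun a b =>
    mulDiag (mulDiag fun a b =>
      S.omegaF F g (n + 2) (Fin.cons 0 (Fin.cons 1 spectator)) (Fin.cons a (Fin.cons b e))
        + if g = 0 ∧ n = 0 then S.bReg 0 1 a b else 0) a b
    + if g = 0 ∧ n = 0 then bRNum a b else 0

/-- `ω_{g-1,n+2}`, which is zero for `g = 0`. -/
def omegaTwoPred (S : CurveData p q) (F : FCoeffs p q) (g n : ℕ) (e : Fin n → ℤ) : Bidiff p q :=
  match g with
  | 0 => ⟨0, 0⟩
  | g + 1 => S.omegaTwo F g n e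

/-- `ω_{g,|I|+1}(z_j, z_I)`; the arguments `z_I` are in increasing order. -/
def omegaSub (S : CurveData p q) (F : FCoeffs p q) (g : ℕ) {n : ℕ} (e : Fin n → ℤ) (j : ℕ)
    (I : Finset (Fin n)) (N : ℤ) : Grass p q :=
  S.omega F g (I.card + 1) (Fin.cons j fun k => spectator (I.orderEmbOfFin rfl k))
    (Fin.cons N fun k => e (I.orderEmbOfFin rfl k))

/-- `∑_{g₁+g₂=g, I⊔J=[n]} ω_{g₁,|I|+1}(z_0, z_I) ⊗ ω_{g₂,|J|+1}(z_1, z_J)`. -/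
def omegaSplit (S : CurveData p q) (F : FCoeffs p q) (g n : ℕ) (e : Fin n → ℤ) : Bidiff p q :=
  ⟨0, fun a b => ∑ h ∈ Finset.HasAntidiagonal.antidiagonal g, ∑ I : Finset (Fin n),
    S.omegaSub F h.1 e 0 I a * S.omegaSub F h.2 e 1 Iᶜ b⟩

end CurveData

/-! ### Hamiltonians and the differentials `E^i_{g,n}` -/

/-- `[dφ]^w ∑_m x^m (bot m + φ top m)`, a differential on the target curve. -/
structure BaseForm (α : Type*) where
  bot : ℤ → α
  top : ℤ → α

/-- `[dφ]^w O(x^k)`. -/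
def BaseForm.IsBigO {α : Type*} [Zero α] (f : BaseForm α) (k : ℤ) : Prop :=
  ∀ m < k, f.bot m = 0 ∧ f.top m = 0

/-- The pull back by `(x | φ) = (z² | √2 z θ)` of `[dφ]^w f`, where `[dφ] = √2 z [dθ]`: the coefficient
of `[dθ]^w z^N`. -/
def BaseForm.pullback (w : ℕ) (f : BaseForm (Grass p q)) (N : ℤ) : Grass p q :=
  if Even (N - w) then ((Real.sqrt 2 : ℂ) ^ w) • f.bot ((N - w) / 2)
  else ((Real.sqrt 2 : ℂ) ^ (w + 1)) • (th 0 * f.top ((N - w - 1) / 2))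

namespace CurveData

/-- `G¹ = Z⁻¹ H¹ Z`, for `H¹ = [dφ] ∑_j (φ J̃_{2j} + √2 Γ̃_{2j+1}) x^(-j-1)`, where a tilde stands for
conjugation by `Φ T`. -/
def G1 (S : CurveData p q) (F : FCoeffs p q) : BaseForm (HSeries p q) where
  bot := fun m => (Real.sqrt 2 : ℂ) • S.tG F (2 * (-m - 1) + 1) 1
  top := fun m => S.tJ F (2 * (-m - 1)) 1

/-- `G² = Z⁻¹ H² Z`, for
`H² = - [dφ]³ ∑_j (½ φ L̃_{2j} + 1/(2√2) G̃_{2j+1}) x^(-j-2)`, where a tilde stands for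
conjugation by `Φ T`. -/
def G2 (S : CurveData p q) (F : FCoeffs p q) : BaseForm (HSeries p q) where
  bot := fun m => -((2 * Real.sqrt 2 : ℂ)⁻¹ • virG (S.tJ F) (S.tG F) (-m - 2) 1)
  top := fun m => -((2⁻¹ : ℂ) • virL (S.tJ F) (S.tG F) (-m - 2) 1)

/-- The commutator `ad_{ħ⁻¹ 𝒥(z_j)}` on functions, where
`𝒥(z) = ∑_{k ∈ ℤ} dξ_{-k}(z) J_k + dη_{-k}(z) Γ_k`: the creation operators commute with functions, so
it is `∑_{i ∈ A} dξ_{-i}(z_j) ∂/∂x^i`. This is its coefficient of `z_j^N`. -/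
def adJ (S : CurveData p q) (j : ℕ) (N : ℤ) (f : SuperPoly p q) : SuperPoly p q :=
  ∑ᶠ i : Idx, cst ((S.xi i).coeff j N) * pd i f

/-- `∏_k ad_{ħ⁻¹ 𝒥(z_k)}` applied to the part of degree `n` in the variables `x^i` of the coefficient
of `ħ^(2g+n)` of `f`; the coefficient of `∏_k z_k^{e_k}`. Evaluation at `x^i = 0` after `n`
derivatives selects the part of degree `n`. -/
def extract (S : CurveData p q) (g n : ℕ) (e : Fin n → ℤ) (f : HSeries p q) : Grass p q :=
  augment ((List.finRange n).foldr (fun k h => S.adJ (spectator k) (e k) h)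
    (PowerSeries.coeff (2 * g + n) f))

/-- `E¹_{g,n}(x; z_[n])`, the coefficient of `∏_k z_k^{e_k}`. -/
def E1 (S : CurveData p q) (F : FCoeffs p q) (g n : ℕ) (e : Fin n → ℤ) : BaseForm (Grass p q) where
  bot := fun m => S.extract g n e ((S.G1 F).bot m)
  top := fun m => S.extract g n e ((S.G1 F).top m)

/-- `E²_{g,n}(x; z_[n])`, the coefficient of `∏_k z_k^{e_k}`. -/
def E2 (S : CurveData p q) (F : FCoeffs p q) (g n : ℕ) (e : Fin n → ℤ) : BaseForm (Grass p q) where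
  bot := fun m => S.extract g n e ((S.G2 F).bot m)
  top := fun m => S.extract g n e ((S.G2 F).top m)

end CurveData

end SuperLoop

end

noncomputable section

namespace SuperLoop

variable {p q : ℕ}

/-! ### The algebra on the odd generators -/

/-! The statement is Wick's theorem for linear fields, combined with a transposition of
coefficients. The partition function enters only through `log Z`, which is even. For a linear field
`X = const + creation + annihilation`, conjugation by `Z` therefore adds just one term, the
derivative of `log Z` along the vector field formed by the annihilation part (`conjZ_eq`). Hence
`(Z⁻¹XZ)1` is the sum of a constant, a linear polynomial and a first derivative of `log Z`, while
`(Z⁻¹XYZ)1` is the product of two such expressions plus a second derivative of `log Z` plus the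
contraction of `X` with the creation part of `Y` (`conjZ_conjZ_one`).

The bridge to forms is `modeForm_field`: in the conjugate of `J_{-N}` or `Γ_{-N}`, the coefficient
of `∂/∂x^i` is the coefficient of `z^N` in the `[dz]z⁻¹`- or `[dθ]`-part of `ζ_i`. Summing over
modes thus evaluates the tensors `F_{g,n}` on the forms `ζ_i`. The constants produced by `T`
assemble to `ω_{0,1}`. The contractions, computed in `der_cre`, assemble to `B`: their vacuum part
is the expansion of `B^R` and their regular part is `B - B^R`. This gives `omega_eq`, the
identification of one-point values with `ω_{g,n+1}`.

The spectator operators are even derivations. They obey the Leibniz rule without signs, which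
distributes the spectators over `I ⊔ J` (`evalDer_mul`), and `n` of them evaluated at the origin
cancel the `1/n!` in `log Z` (`evalDer_coeff_logZ`). A count of powers of `ħ` then turns products of
one-point values into `ω_{g₁,|I|+1} ⊗ ω_{g₂,|J|+1}` (`omegaSplit_eq`), and the connected part into
`ω_{g-1,n+2}` without `B^R` (`sum_connPart`).

For `E¹`, pulling back keeps the even modes `J` and the odd modes `Γ`, exactly the part that `1 + σ`
doubles. For `E²`, the Casimir is written through alternating sums of components
(`casimir_components`), and these are the sums defining `L` and `G`. Two discrepancies must cancel.
The weight `j + n` in `L` differs from the weight `a` coming from `D^*` by a multiple of a sum that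
vanishes by antisymmetry (`finsum_twoPart_eq_zero`). Normal ordering removes the vacuum part, and
the Casimir of the rational form `B^R`, which is `-θ/2` (`casimir_bRNum`), is reproduced by the
central term `ħ²/4`. The loop equations finally say that the modes with too negative an exponent of
`x` are the generators annihilating `Z`. -/

theorem Grass.induction {C : Grass p q → Prop} (hadd : ∀ x y, C x → C y → C (x + y))
    (halg : ∀ r, C (algebraMap (EvenParams p) _ r))
    (hmul : ∀ m x, C x → C (ExteriorAlgebra.ι (EvenParams p) m * x)) (x : Grass p q) : C x :=
  CliffordAlgebra.left_induction _ halg hadd (fun x m hx => hmul m x hx) x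

/-- The grade involution. -/
def inv : Grass p q →ₐ[EvenParams p] Grass p q := CliffordAlgebra.involute

@[simp] theorem inv_ι (m : OddVar q →₀ EvenParams p) :
    inv (ExteriorAlgebra.ι (EvenParams p) m) = -ExteriorAlgebra.ι (EvenParams p) m :=
  CliffordAlgebra.involute_ι m

@[simp] theorem inv_inv (x : Grass p q) : inv (inv x) = x :=
  CliffordAlgebra.involute_involute x

/-- `x` has parity `ε`. -/
def IsPar (ε : ℕ) (x : Grass p q) : Prop := inv x = (-1) ^ ε * x

theorem IsPar.add {ε : ℕ} {x y : Grass p q} (hx : IsPar ε x) (hy : IsPar ε y) :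
    IsPar ε (x + y) := by
  rw [IsPar, map_add, hx, hy, mul_add]

theorem IsPar.one : IsPar 0 (1 : Grass p q) := by simp [IsPar]

theorem neg_one_pow_comm {A : Type*} [Ring A] (n : ℕ) (x : A) : x * (-1) ^ n = (-1) ^ n * x :=
  ((Commute.neg_one_left x).pow_left n).eq.symm

theorem IsPar.mul {ε δ : ℕ} {x y : Grass p q} (hx : IsPar ε x) (hy : IsPar δ y) :
    IsPar (ε + δ) (x * y) := by
  rw [IsPar, map_mul, hx, hy, pow_add, mul_assoc, ← mul_assoc x, neg_one_pow_comm]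
  simp only [mul_assoc]

theorem IsPar.congr {ε δ : ℕ} {x : Grass p q} (hx : IsPar ε x) (h : ε % 2 = δ % 2) : IsPar δ x := by
  rw [IsPar, hx, neg_one_pow_eq_pow_mod_two, h, ← neg_one_pow_eq_pow_mod_two]

theorem isPar_ι (m : OddVar q →₀ EvenParams p) :
    IsPar 1 (ExteriorAlgebra.ι (EvenParams p) m) := by simp [IsPar]

theorem isPar_gen (v : OddVar q) : IsPar 1 (gen v : Grass p q) := isPar_ι _

theorem inv_smul (a : ℂ) (x : Grass p q) : inv (a • x) = a • inv x := by
  rw [← algebraMap_smul (EvenParams p) a x, map_smul, algebraMap_smul]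

theorem inv_iterate (ε : ℕ) (x : Grass p q) :
    inv^[ε] x = if Even ε then x else inv x := by
  induction ε with
  | zero => simp
  | succ n ih =>
    rw [Function.iterate_succ_apply', ih]
    by_cases h : Even n <;> simp [h, Nat.even_add_one]

theorem ι_mul_comm (m : OddVar q →₀ EvenParams p) (x : Grass p q) :
    ExteriorAlgebra.ι (EvenParams p) m * x = inv x * ExteriorAlgebra.ι (EvenParams p) m := by
  induction x using Grass.induction with
  | hadd x y hx hy => rw [mul_add, hx, hy, map_add, add_mul]
  | halg r => rw [AlgHom.commutes, Algebra.commutes]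
  | hmul n x hx =>
    rw [map_mul, inv_ι, mul_assoc, ← hx, ← mul_assoc, ← mul_assoc,
      eq_neg_of_add_eq_zero_left (ExteriorAlgebra.ι_add_mul_swap m n), neg_mul, neg_mul,
      neg_mul]

/-- Even elements are central. -/
theorem IsPar.comm_even {x : Grass p q} (hx : IsPar 0 x) (y : Grass p q) : x * y = y * x := by
  induction y using Grass.induction with
  | hadd y z hy hz => rw [mul_add, hy, hz, add_mul]
  | halg r => rw [Algebra.commutes]
  | hmul n y hy =>
    have := ι_mul_comm n x
    rw [hx, pow_zero, one_mul] at this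
    rw [← mul_assoc, ← this, mul_assoc, hy, mul_assoc]

theorem IsPar.comm_odd {x : Grass p q} (hx : IsPar 1 x) (y : Grass p q) : x * y = inv y * x := by
  induction y using Grass.induction with
  | hadd y z hy hz => rw [mul_add, hy, hz, map_add, add_mul]
  | halg r => rw [AlgHom.commutes, Algebra.commutes]
  | hmul n y hy =>
    have := ι_mul_comm n x
    rw [hx, pow_one, neg_one_mul, neg_mul] at this
    rw [← mul_assoc, ← neg_eq_iff_eq_neg.2 this, neg_mul, mul_assoc, hy, map_mul, inv_ι, neg_mul,
      neg_mul, mul_assoc]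

/-- Only `x` has to be homogeneous: the Koszul sign is carried by the grade involution, applied `ε`
times to an arbitrary `y`. -/
theorem IsPar.comm {ε : ℕ} {x : Grass p q} (hx : IsPar ε x) (y : Grass p q) :
    x * y = inv^[ε] y * x := by
  rw [inv_iterate]
  split_ifs with h
  · exact (hx.congr (δ := 0) (by rw [Nat.even_iff.1 h])).comm_even y
  · exact (hx.congr (δ := 1) (by rw [Nat.not_even_iff.1 h])).comm_odd y

theorem IsPar.iterate {ε : ℕ} {x : Grass p q} (hx : IsPar ε x) (δ : ℕ) :
    inv^[δ] x = (-1) ^ (ε * δ) * x := by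
  rw [inv_iterate]
  split_ifs with h
  · rw [Even.neg_one_pow (h.mul_left ε), one_mul]
  · rw [hx, pow_mul]
    rcases Nat.even_or_odd ε with h' | h' <;>
      simp [h'.neg_one_pow, (Nat.not_even_iff_odd.1 h).neg_one_pow]

theorem IsPar.comm' {ε δ : ℕ} {x y : Grass p q} (hx : IsPar ε x) (hy : IsPar δ y) :
    x * y = (-1) ^ (ε * δ) * (y * x) := by
  rw [hx.comm, hy.iterate, mul_comm ε, mul_assoc]

/-! #### Left derivatives -/

theorem dgen_ι_mul (v : OddVar q) (m : OddVar q →₀ EvenParams p) (x : Grass p q) :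
    dgen v (ExteriorAlgebra.ι (EvenParams p) m * x)
      = m v • x - ExteriorAlgebra.ι (EvenParams p) m * dgen v x :=
  CliffordAlgebra.contractLeft_ι_mul _ _ _

@[simp] theorem dgen_algebraMap (v : OddVar q) (r : EvenParams p) :
    dgen v (algebraMap (EvenParams p) (Grass p q) r) = 0 :=
  CliffordAlgebra.contractLeft_algebraMap _ _ _

@[simp] theorem dgen_one (v : OddVar q) : dgen v (1 : Grass p q) = 0 :=
  CliffordAlgebra.contractLeft_one _ _

theorem dgen_comm (v w : OddVar q) (x : Grass p q) : dgen v (dgen w x) = -dgen w (dgen v x) :=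
  CliffordAlgebra.contractLeft_comm _ _ _

theorem dgen_mul (v : OddVar q) (x y : Grass p q) :
    dgen v (x * y) = dgen v x * y + inv x * dgen v y := by
  induction x using Grass.induction with
  | hadd x z hx hz => simp only [map_add, add_mul, hx, hz]; abel
  | halg r =>
    rw [dgen_algebraMap, zero_mul, zero_add, AlgHom.commutes, ← Algebra.smul_def, map_smul,
      ← Algebra.smul_def]
  | hmul m x hx =>
    rw [mul_assoc, dgen_ι_mul, hx, dgen_ι_mul, map_mul, inv_ι, sub_mul, mul_add, smul_mul_assoc]
    noncomm_ring

theorem dgen_inv (v : OddVar q) (x : Grass p q) : dgen v (inv x) = -inv (dgen v x) := by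
  induction x using Grass.induction with
  | hadd x z hx hz => simp only [map_add, hx, hz]; abel
  | halg r => simp
  | hmul m x hx =>
    rw [map_mul, inv_ι, neg_mul, map_neg, dgen_ι_mul, dgen_ι_mul, hx, map_sub, map_mul, inv_ι,
      map_smul]
    noncomm_ring

theorem dgen_smul (v : OddVar q) (a : ℂ) (x : Grass p q) : dgen v (a • x) = a • dgen v x := by
  rw [← algebraMap_smul (EvenParams p) a x, map_smul, algebraMap_smul]

theorem dgen_gen (v w : OddVar q) [Decidable (w = v)] :
    dgen v (gen w : Grass p q) = if w = v then 1 else 0 := by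
  have h : dgen v (gen w : Grass p q)
      = algebraMap _ _ ((Finsupp.single w (1 : EvenParams p)) v) :=
    CliffordAlgebra.contractLeft_ι _ _ _
  rw [h]
  by_cases hw : w = v <;> simp [hw]

/-- An element involves finitely many generators. This is what makes vector fields with infinitely
many components act through finite sums. -/
theorem finite_dgen (x : Grass p q) : {v : OddVar q | dgen v x ≠ 0}.Finite := by
  induction x using Grass.induction with
  | hadd x y hx hy =>
    refine (hx.union hy).subset fun v hv => ?_
    by_contra h
    simp only [Set.mem_union, Set.mem_ofPred_eq, not_or, not_not] at h
    exact hv (by rw [map_add, h.1, h.2, add_zero])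
  | halg r => simp
  | hmul m x hx =>
    refine (hx.union m.support.finite_toSet).subset fun v hv => ?_
    by_contra h
    simp only [Set.mem_union, Set.mem_ofPred_eq, not_or, not_not, SetLike.mem_coe,
      Finsupp.mem_support_iff] at h
    exact hv (by rw [dgen_ι_mul, h.1, h.2, zero_smul, mul_zero, sub_zero])

/-! #### Substitutions -/

theorem substOdd_ι (f : OddVar q → (OddVar q →₀ EvenParams p)) (m : OddVar q →₀ EvenParams p) :
    substOdd f (ExteriorAlgebra.ι (EvenParams p) m)
      = ExteriorAlgebra.ι (EvenParams p) (Finsupp.linearCombination (EvenParams p) f m) :=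
  ExteriorAlgebra.map_apply_ι _ _

theorem substOdd_gen (f : OddVar q → (OddVar q →₀ EvenParams p)) (v : OddVar q) :
    substOdd f (gen v) = ExteriorAlgebra.ι (EvenParams p) (f v) := by
  rw [gen, substOdd_ι, Finsupp.linearCombination_single, one_smul]

theorem substOdd_smul (f : OddVar q → (OddVar q →₀ EvenParams p)) (a : ℂ) (x : Grass p q) :
    substOdd f (a • x) = a • substOdd f x := by
  rw [← algebraMap_smul (EvenParams p) a x, map_smul, algebraMap_smul]

theorem substOdd_inv (f : OddVar q → (OddVar q →₀ EvenParams p)) (x : Grass p q) :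
    substOdd f (inv x) = inv (substOdd f x) := by
  induction x using Grass.induction with
  | hadd x z hx hz => simp only [map_add, hx, hz]
  | halg r => simp
  | hmul m x hx => simp only [map_mul, inv_ι, map_neg, substOdd_ι, hx]

theorem substOdd_substOdd (f g h : OddVar q → (OddVar q →₀ EvenParams p))
    (H : ∀ v, Finsupp.linearCombination (EvenParams p) f (g v) = h v) (x : Grass p q) :
    substOdd f (substOdd g x) = substOdd h x := by
  have : ∀ m, Finsupp.linearCombination (EvenParams p) f
      (Finsupp.linearCombination (EvenParams p) g m)
        = Finsupp.linearCombination (EvenParams p) h m := fun m => by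
    induction m using Finsupp.induction_linear with
    | zero => simp
    | add a b ha hb => simp only [map_add, ha, hb]
    | single v r => simp only [Finsupp.linearCombination_single, map_smul, H]
  induction x using Grass.induction with
  | hadd x z hx hz => simp only [map_add, hx, hz]
  | halg r => simp
  | hmul m x hx => simp only [map_mul, substOdd_ι, hx, this]

/-- Contraction with a functional commutes with a linear substitution that preserves this
functional; the hypothesis says that the substitution does not change the `v`-component. -/
theorem dgen_substOdd (f : OddVar q → (OddVar q →₀ EvenParams p)) (v : OddVar q)
    (H : ∀ w, f w v = Finsupp.single w 1 v) (x : Grass p q) :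
    dgen v (substOdd f x) = substOdd f (dgen v x) := by
  have : ∀ m, Finsupp.linearCombination (EvenParams p) f m v = m v := fun m => by
    induction m using Finsupp.induction_linear with
    | zero => simp
    | add a b ha hb => simp only [map_add, Finsupp.add_apply, ha, hb]
    | single w r =>
      rw [Finsupp.linearCombination_single, Finsupp.smul_apply, H, ← Finsupp.smul_apply,
        Finsupp.smul_single_one]
  induction x using Grass.induction with
  | hadd x z hx hz => simp only [map_add, hx, hz]
  | halg r => simp
  | hmul m x hx => simp only [map_mul, substOdd_ι, dgen_ι_mul, map_sub, map_smul, hx, this]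

theorem dgen_substOdd_eq_zero (f : OddVar q → (OddVar q →₀ EvenParams p)) (v : OddVar q)
    (H : ∀ w, f w v = 0) (x : Grass p q) : dgen v (substOdd f x) = 0 := by
  have : ∀ m, Finsupp.linearCombination (EvenParams p) f m v = 0 := fun m => by
    induction m using Finsupp.induction_linear with
    | zero => simp
    | add a b ha hb => simp only [map_add, Finsupp.add_apply, ha, hb, add_zero]
    | single w r => simp [Finsupp.linearCombination_single, H]
  induction x using Grass.induction with
  | hadd x z hx hz => simp only [map_add, hx, hz, add_zero]
  | halg r => simp
  | hmul m x hx => simp only [map_mul, substOdd_ι, dgen_ι_mul, hx, this, zero_smul, mul_zero, sub_zero]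

/-- The substitution of zero for the `θ^k`. -/
def killVar : OddVar q → (OddVar q →₀ EvenParams p) := fun v => match v with
    | .var _ => 0
    | v => Finsupp.single v 1

/-- The substitution of zero for the generators of the arguments `0`, `1` of a bidifferential. -/
def killArg : OddVar q → (OddVar q →₀ EvenParams p) := fun v => match v with
    | .theta 0 => 0
    | .theta 1 => 0
    | .dtheta 0 => 0
    | .dtheta 1 => 0
    | v => Finsupp.single v 1

/-- `x` does not contain the `θ^k`. -/
def VarFree (x : Grass p q) : Prop := substOdd killVar x = x

/-- `x` does not contain the generators of the arguments `0`, `1`. -/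
def ArgFree (x : Grass p q) : Prop := substOdd killArg x = x

theorem VarFree.dgen {x : Grass p q} (hx : VarFree x) (k : ℕ) : dgen (.var k) x = 0 := by
  rw [← hx]
  refine dgen_substOdd_eq_zero _ _ (fun w => ?_) x
  cases w <;> simp [killVar]

theorem VarFree.mul {x y : Grass p q} (hx : VarFree x) (hy : VarFree y) : VarFree (x * y) := by
  rw [VarFree, map_mul, hx, hy]

theorem VarFree.add {x y : Grass p q} (hx : VarFree x) (hy : VarFree y) : VarFree (x + y) := by
  rw [VarFree, map_add, hx, hy]

theorem VarFree.neg {x : Grass p q} (hx : VarFree x) : VarFree (-x) := by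
  rw [VarFree, map_neg, hx]

theorem VarFree.smul {x : Grass p q} (hx : VarFree x) (a : ℂ) : VarFree (a • x) := by
  rw [VarFree, substOdd_smul, hx]

theorem VarFree.zero : VarFree (0 : Grass p q) := map_zero _

theorem VarFree.one : VarFree (1 : Grass p q) := map_one _

theorem varFree_th (j : ℕ) : VarFree (th j : Grass p q) := by
  rw [VarFree, th, substOdd_gen]; rfl

theorem varFree_dth (j : ℕ) : VarFree (dth j : Grass p q) := by
  rw [VarFree, dth, substOdd_gen]; rfl

theorem substOdd_ofBase (f : OddVar q → (OddVar q →₀ EvenParams p))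
    (H : ∀ i, f (.par i) = Finsupp.single (.par i) 1) (r : BaseRing p q) :
    substOdd f (ofBase r) = ofBase r := by
  rw [substOdd, ofBase, ← AlgHom.comp_apply, ExteriorAlgebra.map_comp_map]
  congr 2
  ext i : 3
  simp [H]

theorem varFree_ofBase (r : BaseRing p q) : VarFree (ofBase r) :=
  substOdd_ofBase _ (fun _ => rfl) r

theorem argFree_ofBase (r : BaseRing p q) : ArgFree (ofBase r) :=
  substOdd_ofBase _ (fun _ => rfl) r

theorem inv_ofBase (r : BaseRing p q) : inv (ofBase r) = ofBase (CliffordAlgebra.involute r) := by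
  induction r using CliffordAlgebra.induction with
  | algebraMap r => simp
  | ι x =>
    rw [CliffordAlgebra.involute_ι, map_neg]
    change inv (ofBase (ExteriorAlgebra.ι (EvenParams p) x))
      = -ofBase (ExteriorAlgebra.ι (EvenParams p) x)
    rw [ofBase, ExteriorAlgebra.map_apply_ι, inv_ι]
  | mul a b ha hb => simp only [map_mul, ha, hb]
  | add a b ha hb => simp only [map_add, ha, hb]

theorem isPar_ofBase {r : BaseRing p q} (ε : ℕ) (hr : HasParity (ε : ZMod 2) r) :
    IsPar ε (ofBase r) := by
  rw [IsPar, inv_ofBase]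
  rcases Nat.even_or_odd ε with h | h
  · rw [(ZMod.natCast_eq_zero_iff_even).2 h] at hr
    rw [CliffordAlgebra.involute_eq_of_mem_even hr, h.neg_one_pow, one_mul]
  · rw [(ZMod.natCast_eq_one_iff_odd).2 h] at hr
    rw [CliffordAlgebra.involute_eq_of_mem_odd hr, h.neg_one_pow, map_neg, neg_one_mul]

theorem ofBase_smul (a : ℂ) (r : BaseRing p q) : ofBase (a • r) = a • ofBase r := by
  rw [← algebraMap_smul (EvenParams p) a r, map_smul, algebraMap_smul]

/-! ### Superpolynomials -/

theorem SuperPoly.induction {C : SuperPoly p q → Prop} (h0 : C 0)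
    (hadd : ∀ x y, C x → C y → C (x + y)) (hs : ∀ m c, C (AddMonoidAlgebra.single m c))
    (x : SuperPoly p q) : C x :=
  AddMonoidAlgebra.induction_linear x h0 hadd hs

theorem cst_mul (c d : Grass p q) : cst (c * d) = cst c * cst d := by
  simp [cst, AddMonoidAlgebra.single_mul_single]

theorem cst_add (c d : Grass p q) : cst (c + d) = cst c + cst d :=
  AddMonoidAlgebra.single_add _ _ _

theorem cst_zero : cst (0 : Grass p q) = 0 := AddMonoidAlgebra.single_zero _

theorem cst_one : cst (1 : Grass p q) = 1 := rfl

theorem cst_neg (c : Grass p q) : cst (-c) = -cst c := by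
  rw [eq_neg_iff_add_eq_zero, ← cst_add, neg_add_cancel, cst_zero]

theorem cst_smul (a : ℂ) (c : Grass p q) : cst (a • c) = a • cst c :=
  (AddMonoidAlgebra.smul_single _ _ _).symm

/-- The grade involution on superpolynomials. -/
def sinv : SuperPoly p q →+* SuperPoly p q := AddMonoidAlgebra.mapRingHom _ (inv : Grass p q →ₐ[EvenParams p] Grass p q).toRingHom

theorem sinv_single (m : ℕ+ →₀ ℕ) (c : Grass p q) :
    sinv (AddMonoidAlgebra.single m c) = AddMonoidAlgebra.single m (inv c) :=
  AddMonoidAlgebra.mapRingHom_single _ _ _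

theorem coeff_sinv (f : SuperPoly p q) (m : ℕ+ →₀ ℕ) : (sinv f).coeff m = inv (f.coeff m) :=
  AddMonoidAlgebra.coeff_mapRingHom _ _ _

theorem sinv_sinv (f : SuperPoly p q) : sinv (sinv f) = f := by
  ext m; rw [coeff_sinv, coeff_sinv, inv_inv]

theorem sinv_smul (a : ℂ) (f : SuperPoly p q) : sinv (a • f) = a • sinv f := by
  ext m; rw [coeff_sinv, AddMonoidAlgebra.coeff_smul_apply, inv_smul,
    AddMonoidAlgebra.coeff_smul_apply, coeff_sinv]

/-- `f` has parity `ε`. -/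
def SPar (ε : ℕ) (f : SuperPoly p q) : Prop := sinv f = (-1) ^ ε * f

theorem sinv_iterate (ε : ℕ) (f : SuperPoly p q) :
    sinv^[ε] f = if Even ε then f else sinv f := by
  induction ε with
  | zero => simp
  | succ n ih =>
    rw [Function.iterate_succ_apply', ih]
    by_cases h : Even n <;> simp [h, Nat.even_add_one, sinv_sinv]

theorem SPar.add {ε : ℕ} {x y : SuperPoly p q} (hx : SPar ε x) (hy : SPar ε y) :
    SPar ε (x + y) := by
  rw [SPar, map_add, hx, hy, mul_add]

theorem SPar.zero (ε : ℕ) : SPar ε (0 : SuperPoly p q) := by simp [SPar]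

theorem SPar.one : SPar 0 (1 : SuperPoly p q) := by simp [SPar]

theorem SPar.mul {ε δ : ℕ} {x y : SuperPoly p q} (hx : SPar ε x) (hy : SPar δ y) :
    SPar (ε + δ) (x * y) := by
  rw [SPar, map_mul, hx, hy, pow_add, mul_assoc, ← mul_assoc x, neg_one_pow_comm]
  simp only [mul_assoc]

theorem SPar.congr {ε δ : ℕ} {x : SuperPoly p q} (hx : SPar ε x) (h : ε % 2 = δ % 2) :
    SPar δ x := by
  rw [SPar, hx, neg_one_pow_eq_pow_mod_two, h, ← neg_one_pow_eq_pow_mod_two]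

theorem SPar.smul {ε : ℕ} {x : SuperPoly p q} (hx : SPar ε x) (a : ℂ) : SPar ε (a • x) := by
  rw [SPar, sinv_smul, hx, mul_smul_comm]

theorem SPar.nsmul {ε : ℕ} {x : SuperPoly p q} (hx : SPar ε x) (a : ℕ) : SPar ε (a • x) := by
  rw [SPar, map_nsmul, hx, mul_smul_comm]

theorem SPar.sum {ι : Type*} {ε : ℕ} {x : ι → SuperPoly p q} (s : Finset ι)
    (hx : ∀ i ∈ s, SPar ε (x i)) : SPar ε (∑ i ∈ s, x i) := by
  rw [SPar, map_sum, Finset.mul_sum]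
  exact Finset.sum_congr rfl hx

theorem neg_one_pow_single (ε : ℕ) (m : ℕ+ →₀ ℕ) (c : Grass p q) :
    (-1) ^ ε * (AddMonoidAlgebra.single m c : SuperPoly p q)
      = AddMonoidAlgebra.single m ((-1) ^ ε * c) := by
  rcases Nat.even_or_odd ε with h | h <;> simp [h.neg_one_pow]

theorem spar_single {ε : ℕ} {c : Grass p q} (hc : IsPar ε c) (m : ℕ+ →₀ ℕ) :
    SPar ε (AddMonoidAlgebra.single m c) := by
  rw [SPar, sinv_single, hc, neg_one_pow_single]

theorem spar_cst {ε : ℕ} {c : Grass p q} (hc : IsPar ε c) : SPar ε (cst c) := spar_single hc 0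

theorem SPar.coeff {ε : ℕ} {f : SuperPoly p q} (hf : SPar ε f) (m : ℕ+ →₀ ℕ) :
    IsPar ε (f.coeff m) := by
  rw [IsPar, ← coeff_sinv, hf]
  rcases Nat.even_or_odd ε with h | h <;> simp [h.neg_one_pow]

theorem SPar.iterate {ε : ℕ} {x : SuperPoly p q} (hx : SPar ε x) (δ : ℕ) :
    sinv^[δ] x = (-1) ^ (ε * δ) * x := by
  rw [sinv_iterate]
  split_ifs with h
  · rw [Even.neg_one_pow (h.mul_left ε), one_mul]
  · rw [hx, pow_mul]
    rcases Nat.even_or_odd ε with h' | h' <;>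
      simp [h'.neg_one_pow, (Nat.not_even_iff_odd.1 h).neg_one_pow]

theorem SPar.comm {ε : ℕ} {x : SuperPoly p q} (hx : SPar ε x) (y : SuperPoly p q) :
    x * y = sinv^[ε] y * x := by
  rw [← AddMonoidAlgebra.sum_coeff_single x, Finsupp.sum, Finset.mul_sum, Finset.sum_mul]
  refine Finset.sum_congr rfl fun m _ => ?_
  induction y using SuperPoly.induction with
  | h0 => simp
  | hadd y z hy hz => rw [mul_add, hy, hz, ← RingHom.coe_pow, map_add, add_mul]
  | hs n c =>
    have : sinv^[ε] (AddMonoidAlgebra.single n c : SuperPoly p q)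
        = AddMonoidAlgebra.single n (inv^[ε] c) := by
      rw [sinv_iterate, inv_iterate]
      split_ifs <;> simp [sinv_single]
    rw [this, AddMonoidAlgebra.single_mul_single, AddMonoidAlgebra.single_mul_single,
      (hx.coeff m).comm, add_comm]

theorem SPar.comm' {ε δ : ℕ} {x y : SuperPoly p q} (hx : SPar ε x) (hy : SPar δ y) :
    x * y = (-1) ^ (ε * δ) * (y * x) := by
  rw [hx.comm, hy.iterate, mul_comm ε, mul_assoc]

/-- `f` does not contain the generators of the arguments `0`, `1`. -/
def SArgFree (f : SuperPoly p q) : Prop := ∀ m, ArgFree (f.coeff m)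

/-- The substitution of zero for the generators of the arguments `0`, `1`. -/
def killArgPoly : SuperPoly p q →+* SuperPoly p q :=
  AddMonoidAlgebra.mapRingHom _ (substOdd killArg : Grass p q →ₐ[EvenParams p] Grass p q).toRingHom

theorem coeff_killArgPoly (f : SuperPoly p q) (m : ℕ+ →₀ ℕ) :
    (killArgPoly f).coeff m = substOdd killArg (f.coeff m) :=
  AddMonoidAlgebra.coeff_mapRingHom _ _ _

theorem sArgFree_iff (f : SuperPoly p q) : SArgFree f ↔ killArgPoly f = f := by
  constructor
  · intro h; ext m; rw [coeff_killArgPoly, h]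
  · intro h m; rw [ArgFree, ← coeff_killArgPoly, h]

theorem SArgFree.mul {f g : SuperPoly p q} (hf : SArgFree f) (hg : SArgFree g) :
    SArgFree (f * g) := by
  rw [sArgFree_iff] at *
  rw [map_mul, hf, hg]

theorem SArgFree.add {f g : SuperPoly p q} (hf : SArgFree f) (hg : SArgFree g) :
    SArgFree (f + g) := by
  rw [sArgFree_iff] at *
  rw [map_add, hf, hg]

theorem SArgFree.zero : SArgFree (0 : SuperPoly p q) := by
  rw [sArgFree_iff, map_zero]

theorem SArgFree.sum {ι : Type*} {x : ι → SuperPoly p q} (s : Finset ι)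
    (hx : ∀ i ∈ s, SArgFree (x i)) : SArgFree (∑ i ∈ s, x i) := by
  simp_rw [sArgFree_iff] at *
  rw [map_sum]
  exact Finset.sum_congr rfl hx

theorem sArgFree_cst {c : Grass p q} (hc : ArgFree c) : SArgFree (cst c) := by
  rw [sArgFree_iff]
  exact (AddMonoidAlgebra.mapRingHom_single _ _ _).trans (congrArg (AddMonoidAlgebra.single 0) hc)

theorem SArgFree.smul {f : SuperPoly p q} (hf : SArgFree f) (a : ℂ) : SArgFree (a • f) := by
  intro m
  rw [AddMonoidAlgebra.coeff_smul_apply, ArgFree, substOdd_smul, hf m]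

/-! #### Derivatives -/

theorem pd_single_bos (k : ℕ+) (m : ℕ+ →₀ ℕ) (c : Grass p q) :
    pd (.bos k) (AddMonoidAlgebra.single m c)
      = AddMonoidAlgebra.single (m - Finsupp.single k 1) (m k • c) := by
  simp [pd]

theorem pd_single_fer (k : ℕ) (m : ℕ+ →₀ ℕ) (c : Grass p q) :
    pd (.fer k) (AddMonoidAlgebra.single m c)
      = AddMonoidAlgebra.single m (dgen (.var k) c) := by
  simp [pd]

theorem pd_add (i : Idx) (f g : SuperPoly p q) : pd i (f + g) = pd i f + pd i g := by
  cases i with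
  | bos k =>
    simp only [pd, AddMonoidAlgebra.coeff_add]
    refine Finsupp.sum_add_index' (fun m => by simp) (fun m a b => ?_)
    rw [smul_add, AddMonoidAlgebra.single_add]
  | fer k =>
    simp only [pd, AddMonoidAlgebra.coeff_add]
    refine Finsupp.sum_add_index' (fun m => by simp) (fun m a b => ?_)
    rw [map_add, AddMonoidAlgebra.single_add]

/-- The left derivative as an additive map. -/
def pdHom (i : Idx) : SuperPoly p q →+ SuperPoly p q :=
  AddMonoidHom.mk' (pd i) (pd_add i)

theorem pd_zero (i : Idx) : pd i (0 : SuperPoly p q) = 0 := map_zero (pdHom i)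

theorem pd_neg (i : Idx) (f : SuperPoly p q) : pd i (-f) = -pd i f := map_neg (pdHom i) f

theorem coeff_pd_fer (k : ℕ) (f : SuperPoly p q) (m : ℕ+ →₀ ℕ) :
    (pd (.fer k) f).coeff m = dgen (.var k) (f.coeff m) := by
  classical
  induction f using SuperPoly.induction with
  | h0 => simp [pd_zero]
  | hadd f g hf hg => simp [pd_add, hf, hg]
  | hs n c =>
    rw [pd_single_fer, AddMonoidAlgebra.coeff_single, AddMonoidAlgebra.coeff_single,
      Finsupp.single_apply, Finsupp.single_apply]
    split_ifs <;> simp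

/-- This coefficient form has no truncated subtraction of exponents, so identities between
derivatives can be compared monomial by monomial. -/
theorem coeff_pd_bos (k : ℕ+) (f : SuperPoly p q) (m : ℕ+ →₀ ℕ) :
    (pd (.bos k) f).coeff m = (m k + 1) • f.coeff (m + Finsupp.single k 1) := by
  classical
  induction f using SuperPoly.induction with
  | h0 => simp [pd_zero]
  | hadd f g hf hg => simp [pd_add, hf, hg]
  | hs n c =>
    rw [pd_single_bos, AddMonoidAlgebra.coeff_single, AddMonoidAlgebra.coeff_single,
      Finsupp.single_apply, Finsupp.single_apply]
    by_cases h : n = m + Finsupp.single k 1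
    · subst h; simp
    · rw [if_neg h, smul_zero]
      split_ifs with h'
      · have hk : n k = 0 := by
          by_contra hk
          refine h ?_
          rw [← h', tsub_add_cancel_of_le]
          exact Finsupp.single_le_iff.2 (Nat.one_le_iff_ne_zero.2 hk)
        rw [hk, zero_smul]
      · rfl

theorem pd_smul (i : Idx) (a : ℂ) (f : SuperPoly p q) : pd i (a • f) = a • pd i f := by
  ext m
  cases i with
  | bos k => 
    simp only [coeff_pd_bos, AddMonoidAlgebra.coeff_smul_apply]
    rw [smul_comm]
  | fer k => simp only [coeff_pd_fer, AddMonoidAlgebra.coeff_smul_apply, dgen_smul]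

theorem pd_mul (i : Idx) (f g : SuperPoly p q) :
    pd i (f * g) = pd i f * g + sinv^[i.parity] f * pd i g := by
  induction f using SuperPoly.induction with
  | h0 => simp [pd_zero]
  | hadd f f' hf hf' =>
    rw [add_mul, pd_add, hf, hf', pd_add, add_mul, ← RingHom.coe_pow, map_add, add_mul]
    abel
  | hs m c =>
    induction g using SuperPoly.induction with
    | h0 => simp [pd_zero]
    | hadd g g' hg hg' => rw [mul_add, pd_add, hg, hg', pd_add, mul_add, mul_add]; abel
    | hs n d =>
      cases i with
      | bos k =>
        simp only [Idx.parity, Function.iterate_zero, id, pd_single_bos,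
          AddMonoidAlgebra.single_mul_single]
        have h1 : m k ≠ 0 → m + n - Finsupp.single k 1 = m - Finsupp.single k 1 + n := fun h =>
          tsub_add_eq_add_tsub (Finsupp.single_le_iff.2 (Nat.one_le_iff_ne_zero.2 h)) |>.symm
        have h2 : n k ≠ 0 → m + n - Finsupp.single k 1 = m + (n - Finsupp.single k 1) := fun h =>
          add_tsub_assoc_of_le (Finsupp.single_le_iff.2 (Nat.one_le_iff_ne_zero.2 h)) _
        rw [Finsupp.add_apply, add_smul, AddMonoidAlgebra.single_add, smul_mul_assoc,
          mul_smul_comm]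
        congr 1
        · by_cases h : m k = 0
          · simp [h]
          · rw [h1 h]
        · by_cases h : n k = 0
          · simp [h]
          · rw [h2 h]
      | fer k =>
        simp only [Idx.parity, Function.iterate_one, pd_single_fer, sinv_single,
          AddMonoidAlgebra.single_mul_single, dgen_mul, AddMonoidAlgebra.single_add]

theorem pd_cst {c : Grass p q} (hc : VarFree c) (i : Idx) : pd i (cst c) = 0 := by
  cases i with
  | bos k => simp [cst, pd_single_bos]
  | fer k => simp [cst, pd_single_fer, hc.dgen]

theorem pd_coord_self (i : Idx) : pd i (coord i : SuperPoly p q) = 1 := by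
  classical
  cases i with
  | bos k => simp [coord, pd_single_bos]; rfl
  | fer k => simp [coord, cst, pd_single_fer, dgen_gen]; rfl

theorem pd_coord_of_ne {i j : Idx} (h : i ≠ j) : pd i (coord j : SuperPoly p q) = 0 := by
  classical
  cases i with
  | bos k =>
    cases j with
    | bos l =>
      have : l ≠ k := fun h' => h (by rw [h'])
      simp [coord, pd_single_bos, this]
    | fer l => simp [coord, cst, pd_single_bos]
  | fer k =>
    cases j with
    | bos l => simp [coord, pd_single_fer]
    | fer l =>
      have : l ≠ k := fun h' => h (by rw [h'])
      simp [coord, cst, pd_single_fer, dgen_gen, this]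

theorem pd_comm (i j : Idx) (f : SuperPoly p q) :
    pd i (pd j f) = (-1) ^ (i.parity * j.parity) * pd j (pd i f) := by
  cases i with
  | bos k =>
    simp only [Idx.parity, zero_mul, pow_zero, one_mul]
    cases j with
    | bos l =>
      ext m
      simp only [coeff_pd_bos, Finsupp.add_apply, smul_smul]
      rw [add_right_comm m]
      congr 1
      by_cases h : k = l
      · subst h; ring
      · rw [Finsupp.single_eq_of_ne h, Finsupp.single_eq_of_ne (Ne.symm h)]; ring
    | fer l =>
      ext m
      simp only [coeff_pd_bos, coeff_pd_fer, map_nsmul]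
  | fer k =>
    cases j with
    | bos l =>
      ext m
      simp only [Idx.parity, mul_zero, pow_zero, one_mul, coeff_pd_bos, coeff_pd_fer, map_nsmul]
    | fer l =>
      ext m
      simp only [Idx.parity, mul_one, pow_one, neg_one_mul, coeff_pd_fer]
      rw [dgen_comm, ← coeff_pd_fer, ← coeff_pd_fer]
      simp

theorem SPar.pd {ε : ℕ} {f : SuperPoly p q} (hf : SPar ε f) (i : Idx) :
    SPar (i.parity + ε) (pd i f) := by
  have key : sinv (SuperLoop.pd i f) = (-1) ^ i.parity * SuperLoop.pd i (sinv f) := by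
    ext m
    cases i with
    | bos k => simp only [Idx.parity, pow_zero, one_mul, coeff_sinv, coeff_pd_bos, map_nsmul]
    | fer k =>
      simp only [Idx.parity, pow_one, neg_one_mul]
      rw [coeff_sinv, coeff_pd_fer, ← pd_neg, coeff_pd_fer, AddMonoidAlgebra.coeff_neg,
        Finsupp.neg_apply, map_neg, coeff_sinv, dgen_inv, neg_neg]
  rw [SPar, key, hf, pow_add, mul_assoc]
  congr 1
  rcases Nat.even_or_odd ε with h | h <;> simp [h.neg_one_pow, pd_neg]

theorem SArgFree.pd {f : SuperPoly p q} (hf : SArgFree f) (i : Idx) : SArgFree (pd i f) := by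
  intro m
  cases i with
  | bos k => rw [coeff_pd_bos, ArgFree, map_nsmul, hf]
  | fer k =>
    rw [coeff_pd_fer, ArgFree, ← dgen_substOdd, hf]
    rintro (_ | _ | (_ | _ | _) | (_ | _ | _)) <;> simp [killArg]

theorem spar_coord (i : Idx) : SPar i.parity (coord i : SuperPoly p q) := by
  cases i with
  | bos k => exact spar_single IsPar.one _
  | fer k => exact spar_cst (isPar_gen _)

theorem sArgFree_coord (i : Idx) : SArgFree (coord i : SuperPoly p q) := by
  cases i with
  | bos k =>
    rw [sArgFree_iff]
    exact (AddMonoidAlgebra.mapRingHom_single _ _ _).trans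
      (congrArg (AddMonoidAlgebra.single _) (map_one (substOdd killArg)))
  | fer k =>
    refine sArgFree_cst ?_
    rw [ArgFree, substOdd_gen]; rfl

theorem finite_pd (f : SuperPoly p q) : {i : Idx | pd i f ≠ 0}.Finite := by
  induction f using SuperPoly.induction with
  | h0 => simp [pd_zero]
  | hadd x y hx hy =>
    refine (hx.union hy).subset fun v hv => ?_
    by_contra h
    simp only [Set.mem_union, Set.mem_ofPred_eq, not_or, not_not] at h
    exact hv (by rw [pd_add, h.1, h.2, add_zero])
  | hs m c =>
    refine ((m.support.finite_toSet.image Idx.bos).union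
      (((finite_dgen c).preimage (f := OddVar.var) (fun a _ b _ h => OddVar.var.inj h)).image
        Idx.fer)).subset ?_
    rintro (k | k) hk
    · refine Or.inl ⟨k, ?_, rfl⟩
      rw [SetLike.mem_coe, Finsupp.mem_support_iff]
      intro h
      exact hk (by rw [pd_single_bos, h, zero_smul, AddMonoidAlgebra.single_zero])
    · refine Or.inr ⟨k, ?_, rfl⟩
      intro h
      exact hk (by rw [pd_single_fer, h, AddMonoidAlgebra.single_zero])

/-! #### Evaluation at zero -/

/-- Evaluation at `x^k = θ^k = 0` as a ring homomorphism. -/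
def augmentHom : SuperPoly p q →+* Grass p q where
  toFun := augment
  map_one' := by
    change substOdd killVar _ = 1
    rw [AddMonoidAlgebra.coeff_one_zero, map_one]
  map_zero' := by
    change substOdd killVar _ = 0
    simp
  map_add' f g := by
    change substOdd killVar _ = substOdd killVar _ + substOdd killVar _
    simp
  map_mul' f g := by
    change substOdd killVar _ = substOdd killVar _ * substOdd killVar _
    rw [AddMonoidAlgebra.coeff_mul_antidiag f g 0 {(0, 0)}]
    · simp
    · rintro ⟨a, b⟩
      simp [Prod.ext_iff]

theorem augment_eq (f : SuperPoly p q) : augment f = substOdd killVar (f.coeff 0) := rfl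

theorem augmentHom_apply (f : SuperPoly p q) : augmentHom f = augment f := rfl

theorem augment_smul (a : ℂ) (f : SuperPoly p q) : augment (a • f) = a • augment f := by
  rw [augment_eq, AddMonoidAlgebra.coeff_smul_apply, substOdd_smul, augment_eq]

theorem augment_cst {c : Grass p q} (hc : VarFree c) : augment (cst c) = c := by
  rw [augment_eq, cst, AddMonoidAlgebra.coeff_single, Finsupp.single_eq_same, hc]

theorem augment_coord (i : Idx) : augment (coord i : SuperPoly p q) = 0 := by
  classical
  cases i with
  | bos k => 
    rw [augment_eq, coord, AddMonoidAlgebra.coeff_single, Finsupp.single_apply, if_neg (by simp), map_zero]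
  | fer k =>
    rw [augment_eq, coord, cst, AddMonoidAlgebra.coeff_single, Finsupp.single_apply, if_pos rfl, substOdd_gen]
    simp [killVar]

theorem SPar.augment {ε : ℕ} {f : SuperPoly p q} (hf : SPar ε f) : IsPar ε (augment f) := by
  rw [IsPar, augment_eq, ← substOdd_inv, hf.coeff, map_mul, map_pow, map_neg, map_one]

theorem SArgFree.augment {f : SuperPoly p q} (hf : SArgFree f) : ArgFree (augment f) := by
  have : ∀ x : Grass p q, substOdd killArg (substOdd killVar x)
      = substOdd killVar (substOdd killArg x) := fun x => by
    have h : ∀ v : OddVar q, Finsupp.linearCombination (EvenParams p)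
        (killArg (p := p)) (killVar (p := p) v)
        = Finsupp.linearCombination (EvenParams p) (killVar (p := p)) (killArg (p := p) v) := by
      rintro (_ | _ | (_ | _ | _) | (_ | _ | _)) <;> simp [killArg, killVar]
    rw [substOdd_substOdd killArg killVar _ (fun v => rfl),
      substOdd_substOdd killVar killArg _ (fun v => rfl)]
    simp only [h]
  rw [ArgFree, augment_eq, this, hf]

/-! ### Vector fields with constant coefficients -/

/-- `c` is a vector of constants that are independent of the `θ^k`, of total parity `ε`. -/
structure IsForm (ε : ℕ) (c : Idx → Grass p q) : Prop where
  par : ∀ i, IsPar (i.parity + ε) (c i)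
  free : ∀ i, VarFree (c i)

/-- The vector field `∑_i c_i ∂/∂x^i`. -/
def der (c : Idx → Grass p q) (f : SuperPoly p q) : SuperPoly p q := ∑ᶠ i : Idx, cst (c i) * pd i f

theorem finite_support_der (c : Idx → Grass p q) (f : SuperPoly p q) :
    (Function.support fun i => cst (c i) * pd i f).Finite :=
  (finite_pd f).subset fun i hi h => hi (by simp only [h, mul_zero])

theorem der_eq_sum (c : Idx → Grass p q) (f : SuperPoly p q) (s : Finset Idx)
    (hs : ∀ i, pd i f ≠ 0 → i ∈ s) : der c f = ∑ i ∈ s, cst (c i) * pd i f :=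
  finsum_eq_sum_of_support_subset _ fun i hi => hs i fun h => hi (by simp only [h, mul_zero])

theorem der_zero (c : Idx → Grass p q) : der c 0 = 0 := by simp [der, pd_zero]

theorem der_add (c : Idx → Grass p q) (f g : SuperPoly p q) :
    der c (f + g) = der c f + der c g := by
  rw [der, der, der, ← finsum_add_distrib (finite_support_der c f) (finite_support_der c g)]
  simp only [pd_add, mul_add]

/-- A vector field as an additive map. -/
def derHom (c : Idx → Grass p q) : SuperPoly p q →+ SuperPoly p q :=
  AddMonoidHom.mk' (der c) (der_add c)

theorem der_nsmul (c : Idx → Grass p q) (n : ℕ) (f : SuperPoly p q) :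
    der c (n • f) = n • der c f := map_nsmul (derHom c) n f

theorem der_sum {ι : Type*} (c : Idx → Grass p q) (s : Finset ι) (f : ι → SuperPoly p q) :
    der c (∑ i ∈ s, f i) = ∑ i ∈ s, der c (f i) := map_sum (derHom c) f s

theorem der_smul (c : Idx → Grass p q) (a : ℂ) (f : SuperPoly p q) :
    der c (a • f) = a • der c f := by
  rw [der, der, smul_finsum]
  simp only [pd_smul, mul_smul_comm]

theorem der_combination (a b : Grass p q) (c c' : Idx → Grass p q) (f : SuperPoly p q) :
    der (fun i => a * c i + b * c' i) f = cst a * der c f + cst b * der c' f := by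
  rw [der_eq_sum _ f (finite_pd f).toFinset (by simp), der_eq_sum c f (finite_pd f).toFinset (by simp),
    der_eq_sum c' f (finite_pd f).toFinset (by simp), Finset.mul_sum, Finset.mul_sum,
    ← Finset.sum_add_distrib]
  refine Finset.sum_congr rfl fun i _ => ?_
  rw [cst_add, cst_mul, cst_mul, add_mul, mul_assoc, mul_assoc]

/-- The component `c_i` has the parity of `∂/∂x^i` shifted by `ε`, so every summand `c_i ∂/∂x^i` has
total parity `ε`, and a single sign serves for the whole field. -/
theorem der_mul {ε : ℕ} {c : Idx → Grass p q} (hc : IsForm ε c) (f g : SuperPoly p q) :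
    der c (f * g) = der c f * g + sinv^[ε] f * der c g := by
  classical
  let s := (finite_pd f).toFinset ∪ (finite_pd g).toFinset ∪ (finite_pd (f * g)).toFinset
  rw [der_eq_sum c f s (by simp +contextual [s]), der_eq_sum c g s (by simp +contextual [s]),
    der_eq_sum c (f * g) s (by simp +contextual [s]), Finset.mul_sum, Finset.sum_mul,
    ← Finset.sum_add_distrib]
  refine Finset.sum_congr rfl fun i _ => ?_
  rw [pd_mul, mul_add, mul_assoc, ← mul_assoc (cst (c i)) (sinv^[i.parity] f),
    (spar_cst (hc.par i)).comm (sinv^[i.parity] f), ← Function.iterate_add_apply, mul_assoc (sinv^[_] f)]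
  congr 2
  rw [sinv_iterate, sinv_iterate]
  congr 1
  -- The factor `f` is passed by `∂/∂x^i` and by `c_i`; the two contributions of the parity of `i`
  -- cancel modulo 2.
  rw [show i.parity + ε + i.parity = ε + 2 * i.parity by ring]
  simp [Nat.even_add]

theorem der_mul_even {c : Idx → Grass p q} (hc : IsForm 0 c) (f g : SuperPoly p q) :
    der c (f * g) = der c f * g + f * der c g := der_mul hc f g

theorem der_cst {a : Grass p q} (ha : VarFree a) (c : Idx → Grass p q) : der c (cst a) = 0 := by
  simp [der, pd_cst ha]

theorem der_one (c : Idx → Grass p q) : der c 1 = 0 := der_cst VarFree.one c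

theorem der_cst_mul {ε δ : ℕ} {c : Idx → Grass p q} (hc : IsForm ε c) {a : Grass p q}
    (ha : VarFree a) (ha' : IsPar δ a) (f : SuperPoly p q) :
    der c (cst a * f) = (-1) ^ (δ * ε) * (cst a * der c f) := by
  rw [der_mul hc, der_cst ha, zero_mul, zero_add, (spar_cst ha').iterate, mul_assoc]

theorem der_cst_mul_even {c : Idx → Grass p q} (hc : IsForm 0 c) {a : Grass p q}
    (ha : VarFree a) (f : SuperPoly p q) : der c (cst a * f) = cst a * der c f := by
  rw [der_mul_even hc, der_cst ha, zero_mul, zero_add]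

theorem der_coord (c : Idx → Grass p q) (i : Idx) : der c (coord i) = cst (c i) := by
  rw [der, finsum_eq_single _ i fun j hj => by rw [pd_coord_of_ne hj, mul_zero], pd_coord_self,
    mul_one]

theorem SPar.der {ε δ : ℕ} {c : Idx → Grass p q} (hc : IsForm ε c) {f : SuperPoly p q}
    (hf : SPar δ f) : SPar (ε + δ) (der c f) := by
  rw [der_eq_sum c f (finite_pd f).toFinset (by simp)]
  exact SPar.sum _ fun i _ => ((spar_cst (hc.par i)).mul (hf.pd i)).congr (by omega)

theorem SArgFree.der {c : Idx → Grass p q} (hc : ∀ i, ArgFree (c i)) {f : SuperPoly p q}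
    (hf : SArgFree f) : SArgFree (der c f) := by
  rw [der_eq_sum c f (finite_pd f).toFinset (by simp)]
  exact SArgFree.sum _ fun i _ => (sArgFree_cst (hc i)).mul (hf.pd i)

/-- Differentiation with constant coefficients introduces no new coordinates. This keeps pole bounds
stable under a further derivative. -/
theorem pd_der_eq_zero {c : Idx → Grass p q} (hc : ∀ i, VarFree (c i)) {f : SuperPoly p q} {k : Idx}
    (hf : pd k f = 0) : pd k (der c f) = 0 := by
  rw [der_eq_sum c f (finite_pd f).toFinset (by simp)]
  change pdHom k _ = 0
  rw [map_sum]
  refine Finset.sum_eq_zero fun i _ => ?_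
  change pd k _ = 0
  rw [pd_mul, pd_cst (hc i), pd_comm, hf, pd_zero]
  simp

theorem der_prod_ofFn {c : Idx → Grass p q} (hc : IsForm 0 c) {n : ℕ} (z : Fin n → SuperPoly p q) :
    der c (List.ofFn z).prod = ∑ k, (List.ofFn (Function.update z k (der c (z k)))).prod := by
  induction n with
  | zero => simp [der_one]
  | succ n ih =>
    rw [List.ofFn_succ, List.prod_cons, der_mul_even hc, ih, Fin.sum_univ_succ, Finset.mul_sum]
    congr 1
    · simp [List.ofFn_succ]
    · refine Finset.sum_congr rfl fun k _ => ?_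
      rw [List.ofFn_succ, List.prod_cons, Function.update_of_ne (Fin.succ_ne_zero k).symm]
      congr 3
      funext j
      by_cases h : j = k
      · subst h; simp
      · rw [Function.update_of_ne h, Function.update_of_ne (by simpa using h)]

/-! ### Evaluation of supersymmetric tensors -/

/-- The tensor `T` is supersymmetric. -/
def Supersymmetric {n : ℕ} (T : (Fin n → Idx) →₀ BaseRing p q) : Prop :=
  ∀ (i : Fin n → Idx) (k l : Fin n), (k : ℕ) + 1 = l →
    T (i ∘ Equiv.swap k l) = (-1) ^ ((i k).parity * (i l).parity) * T i

/-- `∑_i y₁(i₁) ⋯ yₙ(iₙ) T[i₁, …, iₙ]`. -/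
def ev {n : ℕ} (T : (Fin n → Idx) →₀ BaseRing p q) (y : Fin n → Idx → SuperPoly p q) :
    SuperPoly p q :=
  T.sum fun i r => (List.ofFn fun k => y k (i k)).prod * cst (ofBase r)

/-- Restricting to neighbours keeps the sign to one factor: a longer transposition would also pick
up signs from everything in between. -/
theorem prod_ofFn_swap {n : ℕ} (z : Fin n → SuperPoly p q) (ε : Fin n → ℕ)
    (hz : ∀ k, SPar (ε k) (z k)) (k l : Fin n) (hkl : (k : ℕ) + 1 = l) :
    (List.ofFn (z ∘ Equiv.swap k l)).prod = (-1) ^ (ε k * ε l) * (List.ofFn z).prod := by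
  induction n with
  | zero => exact k.elim0
  | succ n ih =>
    obtain ⟨l, rfl⟩ : ∃ l', l = Fin.succ l' := Fin.exists_succ_eq.2 (by rintro rfl; simp at hkl) |>.imp fun _ h => h.symm
    cases k using Fin.cases with
    | zero =>
      cases n with
      | zero => exact l.elim0
      | succ n =>
        obtain rfl : l = 0 := by ext; simpa using hkl.symm
        have h : ∀ j : Fin n, Equiv.swap (0 : Fin (n + 2)) (Fin.succ 0) j.succ.succ = j.succ.succ :=
          fun j => Equiv.swap_apply_of_ne_of_ne (Fin.succ_ne_zero _)
            (by simp [Fin.ext_iff])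
        simp only [List.ofFn_succ, List.prod_cons, Function.comp_apply, Equiv.swap_apply_left,
          Equiv.swap_apply_right, h]
        rw [← mul_assoc, (hz _).comm' (hz 0), mul_comm (ε 0), mul_assoc, mul_assoc]
    | succ k =>
      have h0 : Equiv.swap k.succ l.succ 0 = 0 :=
        Equiv.swap_apply_of_ne_of_ne (Fin.succ_ne_zero _).symm (Fin.succ_ne_zero _).symm
      have h : ∀ j : Fin n, Equiv.swap k.succ l.succ j.succ = (Equiv.swap k l j).succ :=
        fun j => (Fin.succ_injective n).swap_apply k l j
      have := ih (fun j => z j.succ) (fun j => ε j.succ) (fun j => hz _) k l (by simpa using hkl)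
      simp only [List.ofFn_succ, List.prod_cons, Function.comp_apply, h0, h]
      rw [Function.comp_def] at this
      rw [this, ← mul_assoc, ← mul_assoc, neg_one_pow_comm]

/-- The sign from exchanging two neighbouring factors cancels the sign from supersymmetry of `T`,
because each argument `y k i` has the parity of its index `i`. -/
theorem ev_swap {n : ℕ} {T : (Fin n → Idx) →₀ BaseRing p q} (hT : Supersymmetric T)
    {y : Fin n → Idx → SuperPoly p q} (hy : ∀ k i, SPar i.parity (y k i)) (k l : Fin n)
    (hkl : (k : ℕ) + 1 = l) : ev T (y ∘ Equiv.swap k l) = ev T y := by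
  have hT' : ∀ i, T (i ∘ Equiv.swap k l) = 0 ↔ T i = 0 := fun i => by
    rw [hT i k l hkl]
    rcases Nat.even_or_odd ((i k).parity * (i l).parity) with h | h <;> simp [h.neg_one_pow]
  refine Finset.sum_equiv (Equiv.arrowCongr (Equiv.swap k l) (Equiv.refl _)) (fun i => ?_)
    (fun i _ => ?_)
  · rw [Finsupp.mem_support_iff, Finsupp.mem_support_iff]
    exact (not_congr (hT' i)).symm
  · have e : (Equiv.arrowCongr (Equiv.swap k l) (Equiv.refl Idx)) i = i ∘ Equiv.swap k l := rfl
    beta_reduce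
    rw [e, hT i k l hkl, map_mul, map_pow, map_neg, map_one]
    have := prod_ofFn_swap (fun j => y j ((i ∘ Equiv.swap k l) j)) _ (fun j => hy _ _) k l hkl
    simp only [Function.comp_def, Equiv.swap_apply_self, Equiv.swap_apply_left,
      Equiv.swap_apply_right] at this ⊢
    rw [this, mul_comm (i l).parity]
    rcases Nat.even_or_odd ((i k).parity * (i l).parity) with h | h <;>
      simp [h.neg_one_pow, cst_neg]

/-- Neighbouring transpositions generate the symmetric group. -/
theorem ev_perm {n : ℕ} {T : (Fin n → Idx) →₀ BaseRing p q} (hT : Supersymmetric T)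
    {y : Fin n → Idx → SuperPoly p q} (hy : ∀ k i, SPar i.parity (y k i)) (σ : Equiv.Perm (Fin n)) :
    ev T (y ∘ σ) = ev T y := by
  cases n with
  | zero => rw [Subsingleton.elim σ 1]; rfl
  | succ n =>
    have hσ : σ ∈ Submonoid.closure
        (Set.range fun i : Fin n => Equiv.swap i.castSucc i.succ) := by
      rw [Equiv.Perm.mclosure_swap_castSucc_succ]; trivial
    induction hσ using Submonoid.closure_induction generalizing y with
    | mem σ h =>
      obtain ⟨i, rfl⟩ := h
      exact ev_swap hT hy _ _ (by simp)
    | one => rfl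
    | mul a b _ _ ha hb =>
      have : y ∘ ⇑(a * b) = (y ∘ a) ∘ b := rfl
      rw [this, hb (y := y ∘ a) (fun k i => hy _ i), ha hy]

theorem der_ev {c : Idx → Grass p q} (hc : IsForm 0 c) {n : ℕ}
    (T : (Fin n → Idx) →₀ BaseRing p q) (y : Fin n → Idx → SuperPoly p q) :
    der c (ev T y) = ∑ k, ev T (Function.update y k fun i => der c (y k i)) := by
  simp only [ev, Finsupp.sum]
  rw [der_sum, Finset.sum_comm]
  refine Finset.sum_congr rfl fun i _ => ?_
  rw [der_mul_even hc, der_cst (varFree_ofBase _), mul_zero, add_zero, der_prod_ofFn hc,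
    Finset.sum_mul]
  refine Finset.sum_congr rfl fun k _ => ?_
  congr 3
  funext j
  by_cases h : j = k
  · subst h; simp
  · rw [Function.update_of_ne h, Function.update_of_ne h]

/-- The constants `c₁, …, c_r`, followed by the coordinates. -/
def slot (ys : List (Idx → Grass p q)) (k : ℕ) : Idx → SuperPoly p q :=
  match ys[k]? with
  | some c => fun i => cst (c i)
  | none => coord

theorem slot_of_le {ys : List (Idx → Grass p q)} {k : ℕ} (h : ys.length ≤ k) :
    slot ys k = coord := by
  rw [slot, List.getElem?_eq_none h]

theorem slot_of_lt {ys : List (Idx → Grass p q)} {k : ℕ} (h : k < ys.length) :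
    slot ys k = fun i => cst (ys[k] i) := by
  rw [slot, List.getElem?_eq_getElem h]

theorem slot_cons_succ (c : Idx → Grass p q) (ys : List (Idx → Grass p q)) (k : ℕ) :
    slot (c :: ys) (k + 1) = slot ys k := rfl

theorem spar_slot {ys : List (Idx → Grass p q)} (hys : ∀ c ∈ ys, IsForm 0 c) (k : ℕ) (i : Idx) :
    SPar i.parity (slot ys k i) := by
  rcases lt_or_ge k ys.length with h | h
  · rw [slot_of_lt h]
    exact spar_cst ((hys _ (List.getElem_mem h)).par i)
  · rw [slot_of_le h]; exact spar_coord i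

/-- The tensor `T` evaluated at `c₁, …, c_r`, followed by the coordinates. -/
def evList {n : ℕ} (T : (Fin n → Idx) →₀ BaseRing p q) (ys : List (Idx → Grass p q)) :
    SuperPoly p q := ev T fun k => slot ys k

theorem ev_update_slot {n : ℕ} {T : (Fin n → Idx) →₀ BaseRing p q} (hT : Supersymmetric T)
    {c : Idx → Grass p q} (hc : IsForm 0 c) {ys : List (Idx → Grass p q)}
    (hys : ∀ c ∈ ys, IsForm 0 c) (k : Fin n) (hk : ys.length ≤ k) :
    ev T (Function.update (fun k : Fin n => slot ys k) k fun i => cst (c i))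
      = evList T (c :: ys) := by
  obtain ⟨n, rfl⟩ : ∃ m, n = m + 1 := ⟨n - 1, by have := k.2; omega⟩
  rw [evList, ← ev_perm hT (y := fun k => slot (c :: ys) k)
    (fun k i => spar_slot (fun d hd => by
      rcases List.mem_cons.1 hd with rfl | h
      exacts [hc, hys d h]) _ _) (Fin.cycleRange k)]
  congr 1
  funext j
  rw [Function.comp_apply]
  rcases lt_trichotomy j k with h | h | h
  · rw [Function.update_of_ne h.ne, Fin.coe_cycleRange_of_lt h, slot_cons_succ]
  · subst h
    rw [Function.update_self, Fin.cycleRange_self]; rfl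
  · rw [Function.update_of_ne h.ne', Fin.cycleRange_of_gt h, slot_of_le (by
      have : (k : ℕ) < j := h
      omega), slot_of_le]
    have : (k : ℕ) < j := h
    simp only [List.length_cons]; omega

/-- Slots holding constants are annihilated. Each of the `n - ys.length` coordinate slots
contributes the same value, since its new constant can be moved to the front. -/
theorem der_evList {n : ℕ} {T : (Fin n → Idx) →₀ BaseRing p q} (hT : Supersymmetric T)
    {c : Idx → Grass p q} (hc : IsForm 0 c) {ys : List (Idx → Grass p q)}
    (hys : ∀ c ∈ ys, IsForm 0 c) :
    der c (evList T ys) = (n - ys.length) • evList T (c :: ys) := by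
  rw [evList, der_ev hc]
  have : ∀ k : Fin n, ev T (Function.update (fun k : Fin n => slot ys k) k
      fun i => der c (slot ys k i))
        = if ys.length ≤ k then evList T (c :: ys) else 0 := fun k => by
    split_ifs with h
    · rw [← ev_update_slot hT hc hys k h]
      congr 2
      funext i
      rw [slot_of_le h, der_coord]
    · refine Finset.sum_eq_zero fun i _ => ?_
      beta_reduce
      rw [List.prod_eq_zero, zero_mul]
      refine List.mem_ofFn.2 ⟨k, ?_⟩
      rw [Function.update_self, slot_of_lt (not_le.1 h), der_cst]
      exact (hys _ (List.getElem_mem _)).free _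
  rw [Finset.sum_congr rfl fun k _ => this k,
    Fin.sum_univ_eq_sum_range (fun k => if ys.length ≤ k then evList T (c :: ys) else 0),
    ← Finset.sum_filter, Finset.sum_const, ← Nat.card_Ico]
  congr 2
  ext k
  simp [and_comm]

/-- The derivative applied first ends up last in the list. This lemma returns it to the first
position, where the correlator expects the distinguished argument. -/
theorem evList_append {n : ℕ} {T : (Fin n → Idx) →₀ BaseRing p q} (hT : Supersymmetric T)
    {c : Idx → Grass p q} (hc : IsForm 0 c) {ys : List (Idx → Grass p q)}
    (hys : ∀ c ∈ ys, IsForm 0 c) (hn : ys.length < n) :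
    evList T (ys ++ [c]) = evList T (c :: ys) := by
  rw [← ev_update_slot hT hc hys ⟨ys.length, hn⟩ le_rfl, evList]
  congr 1
  funext j
  rcases lt_trichotomy (j : ℕ) ys.length with h | h | h
  · rw [Function.update_of_ne (by rintro rfl; simp at h)]
    simp [slot, List.getElem?_append_left h]
  · obtain rfl : j = ⟨ys.length, hn⟩ := Fin.ext h
    rw [Function.update_self]
    simp [slot]
  · rw [Function.update_of_ne (by rintro rfl; simp at h), slot_of_le h.le, slot_of_le]
    simp; omega

/-- For `n` derivatives the falling factorial is `n!`, which will cancel the normalisation of `log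
Z`; for more than `n` it is zero. -/
theorem foldr_der_evList {n : ℕ} {T : (Fin n → Idx) →₀ BaseRing p q} (hT : Supersymmetric T)
    {cs : List (Idx → Grass p q)} (hcs : ∀ c ∈ cs, IsForm 0 c) :
    cs.foldr der (evList T []) = n.descFactorial cs.length • evList T cs := by
  induction cs with
  | nil => simp
  | cons c cs ih =>
    have h := fun d hd => hcs d (List.mem_cons_of_mem c hd)
    rw [List.foldr_cons, ih h, der_nsmul,
      der_evList hT (hcs c List.mem_cons_self) h, List.length_cons, Nat.descFactorial_succ, smul_smul,
      mul_comm]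

/-- `∑_i c₁(i₁) ⋯ cₙ(iₙ) T[i₁, …, iₙ]`. -/
def evConst {n : ℕ} (T : (Fin n → Idx) →₀ BaseRing p q) (y : Fin n → Idx → Grass p q) :
    Grass p q :=
  T.sum fun i r => (List.ofFn fun k => y k (i k)).prod * ofBase r

theorem evList_eq_cst {n : ℕ} (T : (Fin n → Idx) →₀ BaseRing p q)
    (cs : List (Idx → Grass p q)) (h : cs.length = n) :
    evList T cs = cst (evConst T fun k => cs.get (k.cast h.symm)) := by
  have hs : ∀ l : List (Grass p q), cst l.prod = (l.map cst).prod := fun l => by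
    induction l with
    | nil => rfl
    | cons a l ih => rw [List.prod_cons, cst_mul, ih, List.map_cons, List.prod_cons]
  have hc : ∀ (s : Finset (Fin n → Idx)) (f : (Fin n → Idx) → Grass p q),
      cst (∑ i ∈ s, f i) = ∑ i ∈ s, cst (f i) := fun s f =>
    map_sum (AddMonoidHom.mk' cst cst_add) f s
  rw [evList, ev, evConst, Finsupp.sum, Finsupp.sum, hc]
  refine Finset.sum_congr rfl fun i _ => ?_
  rw [cst_mul, hs, List.map_ofFn]
  congr 3
  funext k
  rw [slot_of_lt (by rw [h]; exact k.2)]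
  rfl

/-- At least one slot still holds a coordinate, and coordinates vanish at the origin. -/
theorem augment_evList {n : ℕ} (T : (Fin n → Idx) →₀ BaseRing p q)
    (cs : List (Idx → Grass p q)) (h : cs.length < n) : augment (evList T cs) = 0 := by
  rw [evList, ev, ← augmentHom_apply, Finsupp.sum, map_sum]
  refine Finset.sum_eq_zero fun i _ => ?_
  rw [map_mul, map_list_prod, List.prod_eq_zero, zero_mul]
  rw [List.mem_map]
  refine ⟨_, List.mem_ofFn.2 ⟨⟨cs.length, h⟩, rfl⟩, ?_⟩
  rw [slot_of_le le_rfl, augmentHom_apply, augment_coord]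

/-! ### Linear fields -/

theorem finsum_idx {M : Type*} [AddCommMonoid M] (f : Idx → M) (hf : f.support.Finite) :
    ∑ᶠ i, f i = (∑ᶠ k, f (.bos k)) + ∑ᶠ k, f (.fer k) := by
  have hb : Function.Injective Idx.bos := fun a b h => Idx.bos.inj h
  have hg : Function.Injective Idx.fer := fun a b h => Idx.fer.inj h
  rw [← finsum_mem_range hb, ← finsum_mem_range hg, ← finsum_mem_union', ← finsum_mem_univ]
  · congr 1
    funext i
    have : i ∈ Set.range Idx.bos ∪ Set.range Idx.fer := by cases i <;> simp
    simp only [this, Set.mem_univ]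
  · rw [Set.disjoint_left]
    rintro _ ⟨a, rfl⟩ ⟨b, h⟩
    cases h
  · exact hf.subset Set.inter_subset_right
  · exact hf.subset Set.inter_subset_right

theorem finsum_int_of_range {ι M : Type*} [AddCommMonoid M] (f : ℤ → M) (g : ι → ℤ)
    (hg : Function.Injective g) (hf : ∀ k, k ∉ Set.range g → f k = 0) :
    ∑ᶠ k, f k = ∑ᶠ k, f (g k) := by
  rw [← finsum_mem_range hg, finsum_mem_def, Set.indicator_eq_self.2]
  intro k hk
  by_contra h
  exact hk (hf k h)

/-- The creation part of `ħ⁻¹ J_k`. -/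
def creJ : ℤ → SuperPoly p q
  | .ofNat _ => 0
  | .negSucc k => (k + 1) • coord (.bos k.succPNat)

/-- The creation part of `ħ⁻¹ Γ_k`. -/
def creG : ℤ → SuperPoly p q
  | .ofNat 0 => (2⁻¹ : ℂ) • coord (.fer 0)
  | .ofNat (_ + 1) => 0
  | .negSucc k => coord (.fer (k + 1))

/-- The annihilation part of `ħ⁻¹ J_k`. -/
def annJ : ℤ → SuperPoly p q → SuperPoly p q
  | .ofNat (k + 1), f => pd (.bos k.succPNat) f
  | _, _ => 0

/-- The annihilation part of `ħ⁻¹ Γ_k`. -/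
def annG : ℤ → SuperPoly p q → SuperPoly p q
  | .ofNat k, f => pd (.fer k) f
  | _, _ => 0

theorem coeff_zero_opJ (k : ℤ) (f : HSeries p q) : PowerSeries.coeff 0 (opJ k f) = 0 := by
  rcases k with (_ | k) | k <;> simp [opJ]

theorem coeff_zero_opG (k : ℤ) (f : HSeries p q) : PowerSeries.coeff 0 (opG k f) = 0 := by
  rcases k with (_ | k) | k <;> simp [opG]

theorem coeff_succ_opJ (k : ℤ) (f : HSeries p q) (d : ℕ) :
    PowerSeries.coeff (d + 1) (opJ k f)
      = creJ k * PowerSeries.coeff d f + annJ k (PowerSeries.coeff d f) := by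
  rcases k with (_ | k) | k
  · simp [opJ, creJ, annJ]
  · simp [opJ, creJ, annJ, PowerSeries.coeff_succ_X_mul, mapH]
  · rw [opJ, map_nsmul, PowerSeries.coeff_succ_X_mul, creJ, annJ, smul_mul_assoc, add_zero]
    · simp [mapH]
    · exact fun _ h => by cases h

theorem coeff_succ_opG (k : ℤ) (f : HSeries p q) (d : ℕ) :
    PowerSeries.coeff (d + 1) (opG k f)
      = creG k * PowerSeries.coeff d f + annG k (PowerSeries.coeff d f) := by
  rcases k with (_ | k) | k <;> simp [opG, creG, annG, PowerSeries.coeff_succ_X_mul, mapH]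

/-- The annihilation part of a linear field, as a vector field. -/
def modeForm (X : Mode p q) : Idx → Grass p q
  | .bos k => ofBase (X.1 k)
  | .fer k => ofBase (X.2.1 k)

/-- The creation part of a linear field. -/
def Mode.cre (X : Mode p q) : SuperPoly p q :=
  ∑ᶠ k : ℤ, (cst (ofBase (X.1 k)) * creJ k + cst (ofBase (X.2.1 k)) * creG k)

/-- `X` is a linear field of parity `ε` with finitely many creation operators. -/
structure IsField (ε : ℕ) (X : Mode p q) : Prop where
  par_J : ∀ k, HasParity (ε : ZMod 2) (X.1 k)
  par_G : ∀ k, HasParity ((1 + ε : ℕ) : ZMod 2) (X.2.1 k)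
  par_c : HasParity (ε : ZMod 2) X.2.2
  finite : {k : ℤ | k ≤ 0 ∧ (X.1 k ≠ 0 ∨ X.2.1 k ≠ 0)}.Finite

theorem isForm_modeForm {ε : ℕ} {X : Mode p q} (hX : IsField ε X) : IsForm ε (modeForm X) where
  par i := by
    cases i with
    | bos k => exact isPar_ofBase _ (by simpa [Idx.parity] using hX.par_J k)
    | fer k => exact isPar_ofBase _ (hX.par_G k)
  free i := by cases i <;> exact varFree_ofBase _

theorem creJ_of_nonneg {k : ℤ} (hk : 0 ≤ k) : (creJ k : SuperPoly p q) = 0 := by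
  obtain ⟨k, rfl⟩ := Int.eq_ofNat_of_zero_le hk
  rfl

theorem creG_of_pos {k : ℤ} (hk : 0 < k) : (creG k : SuperPoly p q) = 0 := by
  obtain ⟨k, rfl⟩ := Int.eq_ofNat_of_zero_le hk.le
  cases k with
  | zero => simp at hk
  | succ k => rfl

theorem finite_support_cre {ε : ℕ} {X : Mode p q} (hX : IsField ε X) (f : SuperPoly p q) :
    (Function.support fun k : ℤ => (cst (ofBase (X.1 k)) * creJ k
      + cst (ofBase (X.2.1 k)) * creG k) * f).Finite := by
  refine hX.finite.subset fun k hk => ?_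
  by_contra h
  refine hk ?_
  simp only [Set.mem_ofPred_eq, not_and_or, not_or, not_not, not_le] at h
  rcases h with h | ⟨h1, h2⟩
  · simp only [creJ_of_nonneg h.le, creG_of_pos h]; simp
  · simp only [h1, h2, map_zero, cst_zero]; simp

theorem annJ_natCast (k : ℕ+) (f : SuperPoly p q) : annJ (k : ℤ) f = pd (.bos k) f := by
  have h : ((k : ℕ) : ℤ) = .ofNat (k.natPred + 1) := by rw [PNat.natPred_add_one]; rfl
  rw [h, annJ, PNat.succPNat_natPred]

theorem annJ_eq_zero {k : ℤ} (hk : k ∉ Set.range fun k : ℕ+ => (k : ℤ)) (f : SuperPoly p q) :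
    annJ k f = 0 := by
  rcases k with (_ | k) | k
  · rfl
  · exact absurd ⟨k.succPNat, rfl⟩ hk
  · rfl

theorem finite_support_annJ (c : ℤ → Grass p q) (f : SuperPoly p q) :
    (Function.support fun k : ℤ => cst (c k) * annJ k f).Finite := by
  refine (((finite_pd f).preimage (f := Idx.bos) fun a _ b _ h => Idx.bos.inj h).image
    fun k : ℕ+ => (k : ℤ)).subset fun k hk => ?_
  by_cases h : k ∈ Set.range fun k : ℕ+ => (k : ℤ)
  · obtain ⟨k, rfl⟩ := h
    refine ⟨k, fun h => hk ?_, rfl⟩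
    simp only [annJ_natCast, h, mul_zero]
  · exact absurd (by simp only [annJ_eq_zero h, mul_zero]) hk

theorem finite_support_annG (c : ℤ → Grass p q) (f : SuperPoly p q) :
    (Function.support fun k : ℤ => cst (c k) * annG k f).Finite := by
  refine (((finite_pd f).preimage (f := Idx.fer) fun a _ b _ h => Idx.fer.inj h).image
    fun k : ℕ => (k : ℤ)).subset fun k hk => ?_
  rcases k with k | k
  · refine ⟨k, fun h => hk ?_, rfl⟩
    simp only [annG, h, mul_zero]
  · exact absurd (by simp only [annG, mul_zero]) hk

/-- Annihilation operators are indexed by integers and vector fields by `Idx`. The bosonic index 0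
is absent from `Idx`, in agreement with `J_0 = 0`, while `Γ_0` does contribute `∂/∂θ^0`. -/
theorem finsum_ann (X : Mode p q) (f : SuperPoly p q) :
    ∑ᶠ k : ℤ, (cst (ofBase (X.1 k)) * annJ k f + cst (ofBase (X.2.1 k)) * annG k f)
      = der (modeForm X) f := by
  rw [finsum_add_distrib (finite_support_annJ (fun k => ofBase (X.1 k)) f)
    (finite_support_annG (fun k => ofBase (X.2.1 k)) f), der,
    finsum_idx _ (finite_support_der _ _)]
  congr 1
  · rw [finsum_int_of_range _ (fun k : ℕ+ => (k : ℤ)) (fun a b h => by simpa using h)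
      fun k hk => by rw [annJ_eq_zero hk, mul_zero]]
    simp only [annJ_natCast]; rfl
  · rw [finsum_int_of_range _ (fun k : ℕ => (k : ℤ)) Nat.cast_injective
      fun k hk => by
        rcases k with k | k
        · exact absurd ⟨k, rfl⟩ hk
        · rw [annG, mul_zero]
          simp]
    rfl

theorem coeff_act_zero (X : Mode p q) (f : HSeries p q) :
    PowerSeries.coeff 0 (X.act f) = cst (ofBase X.2.2) * PowerSeries.coeff 0 f := by
  rw [Mode.act, PowerSeries.coeff_mk]
  simp [coeff_zero_opJ, coeff_zero_opG]

theorem coeff_act_succ {ε : ℕ} {X : Mode p q} (hX : IsField ε X) (f : HSeries p q) (d : ℕ) :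
    PowerSeries.coeff (d + 1) (X.act f) = der (modeForm X) (PowerSeries.coeff d f)
      + X.cre * PowerSeries.coeff d f + cst (ofBase X.2.2) * PowerSeries.coeff (d + 1) f := by
  rw [Mode.act, PowerSeries.coeff_mk]
  congr 1
  rw [← finsum_ann, Mode.cre, finsum_mul' _ _ (by
    have := finite_support_cre hX 1
    simp only [mul_one] at this
    exact this),
    ← finsum_add_distrib _ (finite_support_cre hX _)]
  · refine finsum_congr fun k => ?_
    rw [coeff_succ_opJ, coeff_succ_opG]
    noncomm_ring
  · exact ((finite_support_annJ (fun k => ofBase (X.1 k)) _).union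
      (finite_support_annG (fun k => ofBase (X.2.1 k)) _)).subset (Function.support_add _ _)

theorem coeff_mapH (D : SuperPoly p q → SuperPoly p q) (f : HSeries p q) (d : ℕ) :
    PowerSeries.coeff d (mapH D f) = D (PowerSeries.coeff d f) := PowerSeries.coeff_mk _ _

theorem act_eq {ε : ℕ} {X : Mode p q} (hX : IsField ε X) (f : HSeries p q) :
    X.act f = PowerSeries.X * mapH (der (modeForm X)) f
      + (PowerSeries.C (cst (ofBase X.2.2)) + PowerSeries.X * PowerSeries.C X.cre) * f := by
  ext1 d
  cases d with
  | zero => rw [coeff_act_zero]; simp [add_mul, mul_assoc]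
  | succ d =>
    rw [coeff_act_succ hX]
    simp only [map_add, add_mul, mul_assoc, PowerSeries.coeff_succ_X_mul, PowerSeries.coeff_C_mul,
      coeff_mapH]
    abel

/-- `(Z⁻¹ X Z) 1`. -/
def fieldZ (F : FCoeffs p q) (X : Mode p q) : HSeries p q :=
  PowerSeries.C (cst (ofBase X.2.2)) + PowerSeries.X * PowerSeries.C X.cre
    + PowerSeries.X * mapH (der (modeForm X)) (logZ F)

/-- Evenness of `f` removes the Leibniz sign even when the field is odd. It is applied with `f = log
Z`. -/
theorem mapH_der_mul {ε : ℕ} {c : Idx → Grass p q} (hc : IsForm ε c) (f g : HSeries p q)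
    (hf : ∀ d, SPar 0 (PowerSeries.coeff d f)) :
    mapH (der c) (f * g) = mapH (der c) f * g + f * mapH (der c) g := by
  ext1 d
  rw [coeff_mapH, PowerSeries.coeff_mul, map_add, PowerSeries.coeff_mul, PowerSeries.coeff_mul,
    der_sum, ← Finset.sum_add_distrib]
  refine Finset.sum_congr rfl fun a _ => ?_
  rw [der_mul hc, (hf _).iterate, coeff_mapH, coeff_mapH, zero_mul, pow_zero, one_mul]

theorem commute_of_even {f : HSeries p q} (hf : ∀ d, SPar 0 (PowerSeries.coeff d f))
    (g : HSeries p q) : f * g = g * f := by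
  ext1 d
  rw [PowerSeries.coeff_mul, PowerSeries.coeff_mul, ← Finset.sum_equiv (Equiv.prodComm ℕ ℕ)
    (s := Finset.HasAntidiagonal.antidiagonal d) (t := Finset.HasAntidiagonal.antidiagonal d)]
  · intro i; simp [add_comm]
  · intro i _
    rw [(hf _).comm]; rfl

/-- In the commutator with `log Z` the constant and the creation part drop out, because `log Z` is
even and hence central. Only the Leibniz term in which the vector field hits `log Z` survives, and
it joins the multiplication operator `fieldZ F X`. -/
theorem conjZ_eq {ε : ℕ} {X : Mode p q} (hX : IsField ε X) {F : FCoeffs p q}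
    (hF : ∀ d, SPar 0 (PowerSeries.coeff d (logZ F))) (f : HSeries p q) :
    conjZ F X f = PowerSeries.X * mapH (der (modeForm X)) f + fieldZ F X * f := by
  rw [conjZ, act_eq hX, act_eq hX, mapH_der_mul (isForm_modeForm hX) _ _ hF, fieldZ]
  generalize PowerSeries.C (cst (ofBase X.2.2)) + PowerSeries.X * PowerSeries.C X.cre = A
  have h1 : A * (logZ F * f) = logZ F * (A * f) := by
    rw [← mul_assoc, ← commute_of_even hF A, mul_assoc]
  have h2 : ∀ y : HSeries p q, PowerSeries.X * (logZ F * y) = logZ F * (PowerSeries.X * y) :=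
    fun y => by rw [← mul_assoc, ← commute_of_even hF PowerSeries.X, mul_assoc]
  rw [mul_add, mul_add, h1, h2, add_mul, mul_assoc PowerSeries.X]
  abel

theorem conjZ_one {ε : ℕ} {X : Mode p q} (hX : IsField ε X) {F : FCoeffs p q}
    (hF : ∀ d, SPar 0 (PowerSeries.coeff d (logZ F))) : conjZ F X 1 = fieldZ F X := by
  rw [conjZ_eq hX hF, mul_one]
  have : mapH (der (modeForm X)) (1 : HSeries p q) = 0 := by
    ext1 d
    rw [coeff_mapH, PowerSeries.coeff_one]
    split_ifs <;> simp [der_one, der_zero]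
  rw [this, mul_zero, zero_add]

/-- Wick's theorem for two fields: the vector field of `X` acts on `(Z⁻¹YZ)1`. It meets either the
creation part of `Y`, giving the contraction, or the derivative of `log Z`, giving a second
derivative; multiplication gives the disconnected product. -/
theorem conjZ_conjZ_one {ε δ : ℕ} {X Y : Mode p q} (hX : IsField ε X) (hY : IsField δ Y)
    {F : FCoeffs p q} (hF : ∀ d, SPar 0 (PowerSeries.coeff d (logZ F))) :
    conjZ F X (conjZ F Y 1) = PowerSeries.X ^ 2 * PowerSeries.C (der (modeForm X) Y.cre)
      + PowerSeries.X ^ 2 * mapH (der (modeForm X)) (mapH (der (modeForm Y)) (logZ F))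
      + fieldZ F X * fieldZ F Y := by
  rw [conjZ_one hY hF, conjZ_eq hX hF, pow_two, mul_assoc, mul_assoc, ← mul_add]
  congr 2
  ext1 d
  rw [coeff_mapH, fieldZ]
  cases d with
  -- At order `ħ⁰` only the constant of `Y` is present, and a derivation kills it.
  | zero => simp [der_cst (varFree_ofBase _)]
  | succ d =>
    simp only [map_add, PowerSeries.coeff_succ_X_mul, coeff_mapH, der_add, PowerSeries.coeff_C,
      Nat.succ_ne_zero, if_false, zero_add]
    congr 1
    split_ifs <;> simp [der_zero]

/-- The parity of a coefficient equals that of its monomial in the coordinates, so each term of `log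
Z` is even; this is the source of centrality above. -/
theorem spar_logZ {F : FCoeffs p q} (hF : ∀ g n (i : Fin n → Idx),
    HasParity ((∑ k, (i k).parity : ℕ) : ZMod 2) (F g n i)) (d : ℕ) :
    SPar 0 (PowerSeries.coeff d (logZ F)) := by
  have hp : ∀ {n : ℕ} (i : Fin n → Idx),
      SPar (∑ k, (i k).parity) (List.ofFn fun k => (coord (i k) : SuperPoly p q)).prod := by
    intro n
    induction n with
    | zero => intro i; simpa using SPar.one
    | succ n ih =>
      intro i
      rw [List.ofFn_succ, List.prod_cons, Fin.sum_univ_succ]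
      exact (spar_coord _).mul (ih _)
  rw [logZ, PowerSeries.coeff_mk]
  refine SPar.sum _ fun g _ => SPar.smul ?_ _
  refine SPar.sum _ fun i _ => ?_
  refine ((hp i).mul (spar_cst (isPar_ofBase _ (hF _ _ i)))).congr ?_
  omega

theorem coeff_logZ (F : FCoeffs p q) (d : ℕ) : PowerSeries.coeff d (logZ F)
    = ∑ g ∈ Finset.range ((d + 1) / 2 + 1),
      (((d + 2 - 2 * g).factorial : ℂ)⁻¹) • evList (F g (d + 2 - 2 * g)) [] := by
  rw [logZ, PowerSeries.coeff_mk]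
  rfl

theorem sArgFree_logZ (F : FCoeffs p q) (d : ℕ) :
    SArgFree (PowerSeries.coeff d (logZ F)) := by
  have hp : ∀ {n : ℕ} (i : Fin n → Idx),
      SArgFree (List.ofFn fun k => (coord (i k) : SuperPoly p q)).prod := by
    intro n
    induction n with
    | zero =>
      intro i
      rw [List.ofFn_zero, List.prod_nil]
      exact sArgFree_cst (p := p) (q := q) (c := 1) (map_one _)
    | succ n ih =>
      intro i
      rw [List.ofFn_succ, List.prod_cons]
      exact (sArgFree_coord _).mul (ih _)
  rw [logZ, PowerSeries.coeff_mk]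
  refine SArgFree.sum _ fun g _ => SArgFree.smul ?_ _
  exact SArgFree.sum _ fun i _ => (hp i).mul (sArgFree_cst (argFree_ofBase _))

/-! ### The conjugated modes -/

theorem HasParity.add {ε : ZMod 2} {r s : BaseRing p q} (hr : HasParity ε r) (hs : HasParity ε s) :
    HasParity ε (r + s) := add_mem hr hs

theorem HasParity.zero (ε : ZMod 2) : HasParity ε (0 : BaseRing p q) := zero_mem _

theorem HasParity.one : HasParity 0 (1 : BaseRing p q) := SetLike.one_mem_graded _

theorem HasParity.mul {ε δ η : ZMod 2} {r s : BaseRing p q} (hr : HasParity ε r)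
    (hs : HasParity δ s) (h : ε + δ = η) : HasParity η (r * s) := h ▸ SetLike.mul_mem_graded hr hs

theorem HasParity.smul {ε : ZMod 2} {r : BaseRing p q} (hr : HasParity ε r) (a : ℂ) :
    HasParity ε (a • r) := by
  rw [HasParity, ← algebraMap_smul (EvenParams p) a r]
  exact Submodule.smul_mem _ _ hr

theorem HasParity.ite {ε : ZMod 2} {r s : BaseRing p q} (P : Prop) [Decidable P]
    (hr : HasParity ε r) (hs : HasParity ε s) : HasParity ε (if P then r else s) := by
  split_ifs
  exacts [hr, hs]

namespace CurveData

/-- `J_{-N}` or `Γ_{-N}`. -/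
def baseMode : Bool → ℤ → Mode p q
  | false, N => modeJ (-N)
  | true, N => modeG (-N)

/-- The conjugate of `J_{-N}` or `Γ_{-N}`. -/
def field (S : CurveData p q) (ε : Bool) (N : ℤ) : Mode p q := S.conj (baseMode ε N)

/-- The commutator with `log Φ` sees only the modes of index at most 0. When these are concentrated
at one index the infinite sums reduce to a single term, as happens for every field needed. -/
theorem adPhi_eq (S : CurveData p q) (X : Mode p q) (n : ℕ) (a b : BaseRing p q)
    (h1 : ∀ m : ℕ, X.1 (-m) = if m = n then a else 0)
    (h2 : ∀ m : ℕ, X.2.1 (-m) = if m = n then b else 0) :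
    S.adPhi X = (fun k : ℤ => if 0 < k then (k : ℂ)⁻¹ • (a * S.B n k.toNat + b * S.φ k.toNat n) else 0,
      fun k : ℤ => if 0 ≤ k then a * S.φ n k.toNat + b * S.V k.toNat n else 0, 0) := by
  have h : ∀ f g : ℕ → BaseRing p q, ∑ᶠ m : ℕ, (X.1 (-m) * f m + X.2.1 (-m) * g m)
      = a * f n + b * g n := fun f g => by
    rw [finsum_eq_single _ n fun m hm => by rw [h1, h2, if_neg hm, if_neg hm, zero_mul, zero_mul,
      add_zero], h1, h2, if_pos rfl, if_pos rfl]
  simp only [adPhi, h]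

theorem adT_baseMode (S : CurveData p q) (ε : Bool) (N : ℤ) :
    S.adT (baseMode ε N) = (0, 0, cond ε (S.τ N) (S.t N)) := by
  rw [adT, finsum_eq_single _ N]
  · cases ε <;> simp [baseMode, modeJ, modeG]
  · intro k hk
    have : -k ≠ -N := fun h => hk (neg_injective h)
    cases ε <;> simp [baseMode, modeJ, modeG, this]

/-- For `N < 0` the mode is a pure annihilation operator of positive index and commutes with `log
Φ`; only the constant from `T` is added. -/
theorem field_neg (S : CurveData p q) (ε : Bool) {N : ℤ} (hN : N < 0) :
    S.field ε N = ((baseMode ε N).1, (baseMode ε N).2.1, cond ε (S.τ N) (S.t N)) := by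
  have h1 : ∀ m : ℕ, (-m : ℤ) ≠ -N := fun m => by omega
  have hc : (baseMode ε N : Mode p q).2.2 = 0 := by cases ε <;> rfl
  rw [field, conj, adT_baseMode, adPhi_eq S _ 0 0 0, adPhi_eq S _ 0 0 0]
  · ext k : 2
    · simp
    · funext k; simp
    · simp [hc]
  · intro m; simp
  · intro m; simp
  · intro m; cases ε <;> simp [baseMode, modeJ, modeG, h1]
  · intro m; cases ε <;> simp [baseMode, modeJ, modeG, h1]

/-- The coefficients of `Γ_0` in the conjugates of `J_{-n}` and `Γ_{-n}`, up to `δ_{n,0}`. -/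
def zeroCoeff (S : CurveData p q) (ε : Bool) (n : ℕ) : BaseRing p q :=
  cond ε (S.V 0 n) (S.φ n 0)

/-- The first commutator with `log Φ` produces modes of nonnegative index, and `Γ_0` is the only one
of them on which a second commutator can act. The factor `1/2` is that of the quadratic term of the
exponential. -/
theorem field_natCast (S : CurveData p q) (ε : Bool) (n : ℕ) :
    S.field ε n = (fun k => (baseMode ε n).1 k + if 0 < k then (k : ℂ)⁻¹ •
        (cond ε (S.φ k.toNat n) (S.B n k.toNat)
          + (2⁻¹ : ℂ) • (S.zeroCoeff ε n * S.φ k.toNat 0)) else 0,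
      fun k => (baseMode ε n).2.1 k + if 0 ≤ k then
        (cond ε (S.V k.toNat n) (S.φ n k.toNat)
          + (2⁻¹ : ℂ) • (S.zeroCoeff ε n * S.V k.toNat 0)) else 0,
      cond ε (S.τ n) (S.t n)) := by
  have h1 : ∀ m : ℕ, ((-m : ℤ) = -n) ↔ m = n := fun m => by omega
  have hc : (baseMode ε n : Mode p q).2.2 = 0 := by cases ε <;> rfl
  rw [field, conj, adT_baseMode, adPhi_eq S _ n (cond ε 0 1) (cond ε 1 0),
    adPhi_eq S _ 0 0 (S.zeroCoeff ε n)]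
  · ext k : 2
    · by_cases h : 0 < k
      · cases ε <;> simp [h, smul_comm (2⁻¹ : ℂ), add_assoc]
      · simp [h]
    · funext k
      by_cases h : 0 ≤ k
      · cases ε <;> simp [h, add_assoc]
      · simp [h]
    · simp [hc]
  · intro m; simp
  · intro m
    by_cases hm : m = 0
    · subst hm; cases ε <;> simp [zeroCoeff]
    · simp [hm]
  · intro m; cases ε <;> simp [baseMode, modeJ, modeG, Pi.single_apply, h1]
  · intro m; cases ε <;> simp [baseMode, modeJ, modeG, Pi.single_apply, h1]

/-- Besides the original mode of index `-N`, conjugation creates nothing of index at most 0 except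
`Γ_0`; hence the creation part is finite. -/
theorem isField_field {S : CurveData p q} {s : ℤ} (hS : S.IsLocalSuperSpectralCurve s) (ε : Bool)
    (N : ℤ) : IsField ε.toNat (S.field ε N) := by
  have hJ : ∀ k, HasParity (ε.toNat : ZMod 2) ((baseMode ε N : Mode p q).1 k) := fun k => by
    cases ε
    · simp only [baseMode, modeJ, Pi.single_apply]
      exact HasParity.ite _ HasParity.one (HasParity.zero _)
    · exact HasParity.zero _
  have hG : ∀ k, HasParity ((1 + ε.toNat : ℕ) : ZMod 2) ((baseMode ε N : Mode p q).2.1 k) :=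
    fun k => by
      cases ε
      · exact HasParity.zero _
      · simp only [baseMode, modeG, Pi.single_apply]
        exact HasParity.ite _ HasParity.one (HasParity.zero _)
  have hfin : {k : ℤ | k ≤ 0 ∧ ((baseMode ε N : Mode p q).1 k ≠ 0
      ∨ (baseMode ε N : Mode p q).2.1 k ≠ 0)} ⊆ {-N} := by
    rintro k ⟨_, h⟩
    by_contra hk
    have hk' : k ≠ -N := hk
    cases ε <;> simp [baseMode, modeJ, modeG, hk'] at h
  have hc : HasParity (ε.toNat : ZMod 2) (cond ε (S.τ N) (S.t N)) := by
    cases ε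
    · exact hS.t_even N
    · simpa using hS.tau_odd N
  rcases lt_or_ge N 0 with hN | hN
  · rw [field_neg S ε hN]
    exact ⟨hJ, hG, hc, (Set.finite_singleton _).subset hfin⟩
  · obtain ⟨n, rfl⟩ := Int.eq_ofNat_of_zero_le hN
    rw [field_natCast S ε n]
    have e2 : ((1 + 1 : ℕ) : ZMod 2) = 0 := rfl
    refine ⟨fun k => (hJ k).add (HasParity.ite _ (HasParity.smul (HasParity.add ?_
      (HasParity.smul ?_ _)) _) (HasParity.zero _)), fun k => (hG k).add (HasParity.ite _
      (HasParity.add ?_ (HasParity.smul ?_ _)) (HasParity.zero _)), hc,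
      ((Set.finite_singleton (-(n : ℤ))).union (Set.finite_singleton 0)).subset ?_⟩
    · cases ε
      · exact hS.B_even _ _
      · simpa using hS.phi_odd _ _
    · cases ε
      · exact (hS.phi_odd _ _).mul (hS.phi_odd _ _) rfl
      · exact (hS.V_even _ _).mul (hS.phi_odd _ _) (by simp)
    · cases ε
      · simpa using hS.phi_odd _ _
      · exact hS.V_even _ _
    · cases ε
      · exact (hS.phi_odd _ _).mul (hS.V_even _ _) (by simp)
      · exact (hS.V_even _ _).mul (hS.V_even _ _) rfl
    · rintro k ⟨hk, h⟩
      by_contra hk'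
      simp only [Set.mem_union, Set.mem_singleton_iff, not_or] at hk'
      have h1 : ¬ 0 < k := not_lt.2 hk
      have h2 : ¬ 0 ≤ k := fun h' => hk'.2 (le_antisymm hk h')
      simp only [h1, h2, if_false, add_zero] at h
      exact hk'.1 (hfin ⟨hk, h⟩)

/-- The coefficients of `z^N` in the `u`- or `v`-parts of the forms `dξ_{-k}`, `dη_{-k}`. -/
def frm (S : CurveData p q) (ε : Bool) (N : ℤ) (i : Idx) : Grass p q :=
  ofBase (cond ε ((S.xi i).v N) ((S.xi i).u N))

/-- This is the transposition between operators and forms: the quadratic corrections in `dξ_{-k}`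
and `dη_{-k}` are those of the exponential of `ad log Φ`, read along the index of the mode instead
of that of the coordinate. Symmetry of `B_{kl}` and centrality of `V_{kl}` reconcile the two orders
of writing. -/
theorem modeForm_field {S : CurveData p q} {s : ℤ} (hS : S.IsLocalSuperSpectralCurve s) (ε : Bool)
    (N : ℤ) : modeForm (S.field ε N) = S.frm ε N := by
  have hV : ∀ k l (r : BaseRing p q), ofBase (S.V k l * r) = ofBase (r * S.V k l) := fun k l r => by
    rw [map_mul, map_mul, (isPar_ofBase 0 (hS.V_even k l)).comm_even]
  have h2 : ∀ r : BaseRing p q, 2 * r = (2 : ℂ) • r := fun r => by rw [two_mul, two_smul]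
  have h3 : ∀ r : BaseRing p q, (2⁻¹ : ℂ) • (2 • r) = r := fun r => by
    rw [two_smul, ← two_smul ℂ r, smul_smul, inv_mul_cancel₀ two_ne_zero, one_smul]
  funext i
  rcases lt_or_ge N 0 with hN | hN
  · rw [field_neg S ε hN]
    have h0 : ¬ 0 ≤ N := not_le.2 hN
    have h0' : ¬ 0 < N := not_lt.2 hN.le
    have hn : ¬ N = 0 := hN.ne
    rcases i with k | _ | k
    · have e : ((k : ℤ) = -N) ↔ N = -(k : ℤ) := by omega
      cases ε <;> simp [modeForm, frm, xi, baseMode, modeJ, modeG, h0, Pi.single_apply, e]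
    · have : (0 : ℤ) ≠ -N := by omega
      cases ε <;> simp [modeForm, frm, xi, baseMode, modeJ, modeG, h0', this, hn]
    · have e : ((k : ℤ) + 1 = -N) ↔ N = -((k : ℤ) + 1) := by omega
      cases ε <;> simp [modeForm, frm, xi, baseMode, modeJ, modeG, h0, Pi.single_apply, e]
  · obtain ⟨n, rfl⟩ := Int.eq_ofNat_of_zero_le hN
    rw [field_natCast S ε n]
    rcases i with k | _ | k
    · have e1 : ¬ ((n : ℤ) = -(k : ℤ)) := by have := k.pos; omega
      have e2 : ¬ ((k : ℤ) = -(n : ℤ)) := by have := k.pos; omega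
      cases ε
      · simp [modeForm, frm, xi, baseMode, modeJ, zeroCoeff, e1, e2]
        rw [hS.B_symm]
        simp [h2, ofBase_smul, smul_smul]
      · simp [modeForm, frm, xi, baseMode, modeG, zeroCoeff, e1]
        simp [h2, ofBase_smul, smul_smul]
    · cases ε
      · rcases Nat.eq_zero_or_pos n with rfl | hn
        · simp [modeForm, frm, xi, baseMode, modeJ, zeroCoeff, hS.phi_zero]
        · simp [modeForm, frm, xi, baseMode, modeJ, zeroCoeff, hn, hS.V_zero]
      · rcases Nat.eq_zero_or_pos n with rfl | hn
        · simp [modeForm, frm, xi, baseMode, modeG, zeroCoeff, hS.V_zero]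
        · have e1 : ¬ ((0 : ℤ) = -(n : ℤ)) := by omega
          have e2 : ¬ n = 0 := by omega
          simp [modeForm, frm, xi, baseMode, modeG, zeroCoeff, hn, hS.V_zero, e2]
    · have e1 : ¬ ((n : ℤ) = -((k : ℤ) + 1)) := by omega
      have e2 : ¬ ((k : ℤ) + 1 = -(n : ℤ)) := by omega
      have e3 : (0 : ℤ) ≤ (k : ℤ) + 1 := by omega
      have e4 : ((k : ℤ) + 1).toNat = k + 1 := by omega
      cases ε
      · simp only [modeForm, frm, xi, baseMode, modeJ, zeroCoeff, cond, Nat.cast_succ, e3, if_true,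
          e4, Pi.zero_apply, zero_add, Nat.cast_nonneg, Int.toNat_natCast]
        simp only [smul_add, h3, map_add, ofBase_smul, hV (k + 1) 0]
      · simp only [modeForm, frm, xi, baseMode, modeG, zeroCoeff, cond, Nat.cast_succ, e3, if_true,
          e4, Pi.single_apply, e2, e1, if_false, zero_add, Nat.cast_nonneg, Int.toNat_natCast]
        simp only [smul_add, h3, map_add, ofBase_smul, hV (k + 1) 0]

end CurveData

/-! ### Contractions of the conjugated modes -/

namespace CurveData

theorem isForm_frm {S : CurveData p q} {s : ℤ} (hS : S.IsLocalSuperSpectralCurve s) (ε : Bool)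
    (N : ℤ) : IsForm ε.toNat (S.frm ε N) :=
  modeForm_field hS ε N ▸ isForm_modeForm (isField_field hS ε N)

theorem argFree_frm (S : CurveData p q) (ε : Bool) (N : ℤ) (i : Idx) : ArgFree (S.frm ε N i) :=
  argFree_ofBase _

theorem field_of_neg (S : CurveData p q) (ε : Bool) (N : ℤ) {k : ℤ} (hk : k < 0) :
    (S.field ε N).1 k = (baseMode ε N).1 k ∧ (S.field ε N).2.1 k = (baseMode ε N).2.1 k := by
  rcases lt_or_ge N 0 with hN | hN
  · rw [field_neg S ε hN]; exact ⟨rfl, rfl⟩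
  · obtain ⟨n, rfl⟩ := Int.eq_ofNat_of_zero_le hN
    rw [field_natCast S ε n]
    simp [not_lt.2 hk.le, not_le.2 hk]

theorem field_const (S : CurveData p q) (ε : Bool) (N : ℤ) :
    (S.field ε N).2.2 = cond ε (S.τ N) (S.t N) := by
  rcases lt_or_ge N 0 with hN | hN
  · rw [field_neg S ε hN]
  · obtain ⟨n, rfl⟩ := Int.eq_ofNat_of_zero_le hN
    rw [field_natCast S ε n]

/-- There are two sources of creation operators: the mode itself when `N > 0`, and the summand
`θ^0/2` of whatever multiple of `Γ_0` is present. For the conjugate of `Γ_0` itself the second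
source already covers everything, hence the strict inequality. -/
theorem cre_field {S : CurveData p q} {s : ℤ} (hS : S.IsLocalSuperSpectralCurve s) (ε : Bool)
    (N : ℤ) : (S.field ε N).cre = (if 0 < N then cond ε (creG (-N)) (creJ (-N)) else 0)
      + cst (S.frm ε N (.fer 0)) * creG 0 := by
  have h0 : cst (S.frm ε N (.fer 0)) * creG 0 = cst (ofBase ((S.field ε N).1 0)) * creJ 0
      + cst (ofBase ((S.field ε N).2.1 0)) * creG 0 := by
    rw [← modeForm_field hS, creJ_of_nonneg le_rfl, mul_zero, zero_add]; rfl
  have hz : ∀ k : ℤ, k ≠ 0 → (k = -N → N ≤ 0) → cst (ofBase ((S.field ε N).1 k)) * creJ k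
      + cst (ofBase ((S.field ε N).2.1 k)) * creG k = 0 := fun k hk hk' => by
    rcases lt_or_gt_of_ne hk with h | h
    · have : k ≠ -N := fun h' => by have := hk' h'; omega
      rw [(field_of_neg S ε N h).1, (field_of_neg S ε N h).2]
      cases ε <;> simp [baseMode, modeJ, modeG, this, cst_zero]
    · rw [creJ_of_nonneg h.le, creG_of_pos h, mul_zero, mul_zero, add_zero]
  rw [Mode.cre, h0]
  split_ifs with hN
  · rw [finsum_eq_sum_of_support_subset (s := {-N, 0}), Finset.sum_pair (by omega)]
    · congr 1
      rw [(field_of_neg S ε N (by omega)).1, (field_of_neg S ε N (by omega)).2]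
      cases ε <;> simp [baseMode, modeJ, modeG, cst_one, cst_zero]
    · intro k hk
      by_contra h
      simp only [Finset.coe_insert, Finset.coe_singleton, Set.mem_insert_iff,
        Set.mem_singleton_iff, not_or] at h
      exact hk (hz k h.2 fun h' => absurd h' h.1)
  · rw [finsum_eq_single _ 0 fun k hk => hz k hk fun _ => by omega, zero_add]

theorem der_creG_zero (c : Idx → Grass p q) :
    der c (creG 0) = cst ((2⁻¹ : ℂ) • c (.fer 0)) := by
  change der c ((2⁻¹ : ℂ) • coord (.fer 0)) = _
  rw [der_smul, der_coord, cst_smul]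

/-- The regular part of the two-point function of the conjugated modes. -/
def regPart (S : CurveData p q) (ε δ : Bool) (a b : ℤ) : Grass p q :=
  if 0 ≤ a ∧ 0 ≤ b then
    let k := a.toNat
    let l := b.toNat
    let δk : ℂ := if k = 0 then 2⁻¹ else 0
    let δl : ℂ := if l = 0 then 2⁻¹ else 0
    match ε, δ with
    | false, false => ofBase (S.B k l)
    | false, true => (1 - δl) • ofBase (S.φ k l)
    | true, false => (1 - δk) • ofBase (S.φ l k)
    | true, true => -((1 - δk - δl) • ofBase (S.V k l))
  else 0

/-- The vacuum expectation values of the products of two modes. -/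
def vev (ε δ : Bool) (a b : ℤ) : Grass p q :=
  if a + b = 0 then
    match ε, δ with
    | false, false => if 0 < b then (b : Grass p q) else 0
    | true, true => if 0 < b then 1 else if b = 0 then algebraMap ℂ _ 2⁻¹ else 0
    | _, _ => 0
  else 0

/-- The contraction of two conjugated modes splits into the vacuum value and the coefficients of `B
- B^R`. The halved weights at index 0 come from the self-conjugate mode `Γ_0`, whose creation part
is `θ^0/2`: products of its coefficients cancel the quadratic corrections in `ζ_i`, up to the terms
with an index 0. -/
theorem der_cre {S : CurveData p q} {s : ℤ} (hS : S.IsLocalSuperSpectralCurve s) (ε δ : Bool)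
    (a b : ℤ) : der (S.frm ε a) (S.field δ b).cre = cst (vev ε δ a b + S.regPart ε δ a b) := by
  have h1 : der (S.frm ε a) (cst (S.frm δ b (.fer 0)) * creG 0)
      = cst ((-1) ^ ((1 + δ.toNat) * ε.toNat) * ((2⁻¹ : ℂ) •
        (S.frm δ b (.fer 0) * S.frm ε a (.fer 0)))) := by
    rw [der_cst_mul (isForm_frm hS ε a) ((isForm_frm hS δ b).free _) ((isForm_frm hS δ b).par _),
      der_creG_zero, ← cst_mul, mul_smul_comm]
    simp only [Idx.parity]
    rcases Nat.even_or_odd ((1 + δ.toNat) * ε.toNat) with h | h <;> simp [h.neg_one_pow, cst_neg]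
  have hB0 : ∀ k, S.B 0 k = 0 := fun k => by rw [hS.B_symm, hS.B_zero]
  have h2 : ∀ r : BaseRing p q, 2 * r = (2 : ℂ) • r := fun r => by rw [two_mul, two_smul]
  have h3 : ∀ a : ℕ, (0 : ℤ) ≤ (a : ℤ) + 1 := fun a => by omega
  have h4 : ∀ a : ℕ, ¬ ((a : ℤ) + 1 = 0) := fun a => by omega
  have h5 : ∀ a b : ℕ, ¬ ((a : ℤ) + 1 = -1 + -b) := fun a b => by omega
  have h6 : ∀ a b : ℕ, ¬ ((a : ℤ) + 1 + ((b : ℤ) + 1) = 0) := fun a b => by omega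
  have h7 : ∀ b : ℕ, ¬ ((0 : ℤ) = -1 + -b) := fun b => by omega
  have h8 : ∀ a b : ℕ, Int.negSucc a = -1 + -(b : ℤ) ↔ a = b := fun a b => by omega
  have h9 : ∀ a b : ℕ, Int.negSucc a + ((b : ℤ) + 1) = 0 ↔ a = b := fun a b => by omega
  have hc : ∀ (b : ℕ) (x : Grass p q), ((b : Grass p q) + 1) * x = ((b : ℂ) + 1) • x :=
    fun b x => by
      rw [add_mul, add_smul, one_smul, one_mul, ← nsmul_eq_mul, ← Nat.cast_smul_eq_nsmul ℂ]
  have hn : ∀ b : ℕ, (b : ℂ) + 1 ≠ 0 := fun b => by exact_mod_cast b.succ_ne_zero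
  have hcc : ∀ b : ℕ, ((b : ℂ) + 1) * (((b : ℂ) + 1)⁻¹ * 2⁻¹) = 2⁻¹ := fun b => by
    rw [mul_inv_cancel_left₀ (hn b)]
  have hc1 : ∀ b : ℕ, ((b : ℂ) + 1) * ((b : ℂ) + 1)⁻¹ = 1 := fun b => mul_inv_cancel₀ (hn b)
  have hφ : ∀ k l m n, ofBase (S.φ k l) * ofBase (S.φ m n)
      = -(ofBase (S.φ m n) * ofBase (S.φ k l)) := fun k l m n => by
      rw [(isPar_ofBase 1 (by simpa using hS.phi_odd k l)).comm' (isPar_ofBase 1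
        (by simpa using hS.phi_odd m n))]
      simp
  have hV : ∀ k l r, ofBase (S.V k l) * ofBase r = ofBase r * ofBase (S.V k l) := fun k l r => by
    rw [(isPar_ofBase 0 (hS.V_even k l)).comm_even]
  rw [cre_field hS, der_add, h1]
  -- For `b = 0` only the multiple of `θ^0/2` contributes, for `b > 0` there is a genuine creation
  -- operator as well, and for `b < 0` the creation part is zero.
  rcases b with (_ | b) | b
  · -- b = 0
    simp only [Int.ofNat_eq_natCast, Nat.cast_zero, lt_irrefl, if_false, der_zero, zero_add]
    congr 1
    rcases a with (_ | a) | a <;> cases ε <;> cases δ <;>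
      simp [frm, xi, vev, regPart, hS.phi_zero, hS.V_zero, hS.B_zero, h3, h4,
        Algebra.algebraMap_eq_smul_one]
    · module
    · rw [hS.V_antisymm 0 (a + 1), map_neg]; module
  · have hb : (0 : ℤ) < Int.ofNat (b + 1) := by simp
    have e : -(Int.ofNat (b + 1)) = Int.negSucc b := rfl
    rw [if_pos hb, e]
    cases δ
    · simp only [cond, creJ]
      rw [der_nsmul, der_coord]
      have : ∀ x : Grass p q, (b + 1) • cst x = cst ((b + 1) • x) := fun x =>
        (map_nsmul (AddMonoidHom.mk' cst cst_add) (b + 1) x).symm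
      rw [this, ← cst_add]
      congr 1
      rcases a with (_ | a) | a <;> cases ε <;>
        simp [frm, xi, vev, regPart, hS.phi_zero, hS.V_zero, hS.B_zero, hB0, h2, h3, h4, h5, h6, h7,
          h8, h9, ofBase_smul, smul_smul, hc, hcc]
      · rw [hc1]; module
      · rw [hc1, hφ (b + 1) 0, hS.B_symm (a + 1)]; module
      · rw [hc1, hV]; module
      · rw [add_smul, one_smul, Nat.cast_smul_eq_nsmul, nsmul_one]
    · simp only [cond, creG]
      rw [der_coord, ← cst_add]
      congr 1
      rcases a with (_ | a) | a <;> cases ε <;>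
        simp [frm, xi, vev, regPart, hS.phi_zero, hS.V_zero, h2, h3, h4, h5, h6, h7, h8, h9,
          ofBase_smul, smul_smul]
      · rw [hS.V_antisymm (b + 1) 0, map_neg]; module
      · rw [hS.V_antisymm (b + 1) 0, map_neg, neg_mul]; module
      · rw [hS.V_antisymm (b + 1) 0, hS.V_antisymm (b + 1) (a + 1), map_neg, map_neg,
          neg_mul]; module
  · have hb : ¬ (0 : ℤ) < Int.negSucc b := by omega
    have hb' : ¬ (0 : ℤ) ≤ Int.negSucc b := by omega
    have hb'' : Int.negSucc b ≠ 0 := by omega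
    rw [if_neg hb, der_zero, zero_add]
    congr 1
    cases ε <;> cases δ <;> simp [frm, xi, vev, regPart, hb, hb', hb'']

end CurveData

/-! ### Iterated derivatives at the origin -/

theorem foldr_der_add (cs : List (Idx → Grass p q)) (f g : SuperPoly p q) :
    cs.foldr der (f + g) = cs.foldr der f + cs.foldr der g := by
  induction cs with
  | nil => rfl
  | cons c cs ih => rw [List.foldr_cons, ih, der_add, List.foldr_cons, List.foldr_cons]

/-- The value at the origin of the iterated derivative along a list of vector fields. -/
def evalDer (cs : List (Idx → Grass p q)) : SuperPoly p q →+ Grass p q :=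
  AddMonoidHom.mk' (fun f => augment (cs.foldr der f)) fun f g => by
    rw [foldr_der_add, ← augmentHom_apply, map_add]; rfl

theorem evalDer_apply (cs : List (Idx → Grass p q)) (f : SuperPoly p q) :
    evalDer cs f = augment (cs.foldr der f) := rfl

theorem evalDer_append (cs ds : List (Idx → Grass p q)) (f : SuperPoly p q) :
    evalDer (cs ++ ds) f = evalDer cs (ds.foldr der f) := by
  rw [evalDer_apply, evalDer_apply, List.foldr_append]

theorem evalDer_smul (cs : List (Idx → Grass p q)) (a : ℂ) (f : SuperPoly p q) :
    evalDer cs (a • f) = a • evalDer cs f := by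
  have : cs.foldr der (a • f) = a • cs.foldr der f := by
    induction cs with
    | nil => rfl
    | cons c cs ih => rw [List.foldr_cons, ih, der_smul, List.foldr_cons]
  rw [evalDer_apply, this, augment_smul, evalDer_apply]

theorem evalDer_cst_mul {cs : List (Idx → Grass p q)} (hcs : ∀ c ∈ cs, IsForm 0 c) {a : Grass p q}
    (ha : VarFree a) (f : SuperPoly p q) : evalDer cs (cst a * f) = a * evalDer cs f := by
  have : cs.foldr der (cst a * f) = cst a * cs.foldr der f := by
    induction cs with
    | nil => rfl
    | cons c cs ih =>
      rw [List.foldr_cons, ih fun c hc => hcs c (List.mem_cons_of_mem _ hc),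
        der_cst_mul_even (hcs c List.mem_cons_self) ha, List.foldr_cons]
  rw [evalDer_apply, this, ← augmentHom_apply, map_mul, augmentHom_apply, augmentHom_apply,
    augment_cst ha, evalDer_apply]

theorem foldr_der_cst {cs : List (Idx → Grass p q)} (hcs : cs ≠ []) {a : Grass p q}
    (ha : VarFree a) : cs.foldr der (cst a) = 0 := by
  induction cs with
  | nil => exact absurd rfl hcs
  | cons c cs ih =>
    rw [List.foldr_cons]
    by_cases h : cs = []
    · rw [h, List.foldr_nil, der_cst ha]
    · rw [ih h, der_zero]

theorem evalDer_cst {cs : List (Idx → Grass p q)} (hcs : cs ≠ []) {a : Grass p q}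
    (ha : VarFree a) : evalDer cs (cst a) = 0 := by
  rw [evalDer_apply, foldr_der_cst hcs ha, ← augmentHom_apply, map_zero]

theorem spar_foldr_der {cs : List (Idx → Grass p q)} (hcs : ∀ c ∈ cs, IsForm 0 c) {ε : ℕ}
    {f : SuperPoly p q} (hf : SPar ε f) : SPar ε (cs.foldr der f) := by
  induction cs with
  | nil => exact hf
  | cons c cs ih =>
    rw [List.foldr_cons]
    exact (SPar.der (hcs c List.mem_cons_self)
      (ih fun c hc => hcs c (List.mem_cons_of_mem _ hc))).congr (by omega)

theorem SPar.evalDer {cs : List (Idx → Grass p q)} (hcs : ∀ c ∈ cs, IsForm 0 c) {ε : ℕ}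
    {f : SuperPoly p q} (hf : SPar ε f) : IsPar ε (evalDer cs f) :=
  (spar_foldr_der hcs hf).augment

/-- The Leibniz rule for iterated even derivatives. -/
theorem foldr_der_mul {ι : Type*} [DecidableEq ι] {c : ι → Idx → Grass p q}
    (hc : ∀ k, IsForm 0 (c k)) (f g : SuperPoly p q) (l : List ι) (hl : l.Nodup) :
    (l.map c).foldr der (f * g) = ∑ I ∈ l.toFinset.powerset,
      ((l.filter fun k => k ∈ I).map c).foldr der f
        * ((l.filter fun k => k ∉ I).map c).foldr der g := by
  induction l with
  | nil => simp
  | cons a l ih =>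
    rw [List.nodup_cons] at hl
    have ha : a ∉ l.toFinset := by simpa using hl.1
    rw [List.map_cons, List.foldr_cons, ih hl.2, der_sum, List.toFinset_cons,
      Finset.sum_powerset_insert ha, add_comm, ← Finset.sum_add_distrib]
    refine Finset.sum_congr rfl fun I hI => ?_
    have haI : a ∉ I := fun h => ha (Finset.mem_powerset.1 hI h)
    have e : ∀ k ∈ l, (k ∈ insert a I ↔ k ∈ I) := fun k hk => by
      have : k ≠ a := fun h => hl.1 (h ▸ hk)
      simp [this]
    have e1 : (l.filter fun k => decide (k ∈ insert a I)) = l.filter fun k => decide (k ∈ I) :=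
      List.filter_congr fun k hk => by simp only [e k hk]
    have e2 : (l.filter fun k => decide (k ∉ insert a I)) = l.filter fun k => decide (k ∉ I) :=
      List.filter_congr fun k hk => by simp only [e k hk]
    rw [der_mul_even (hc a), List.filter_cons_of_pos (by simp), List.filter_cons_of_neg (by simp),
      List.filter_cons_of_neg (by simpa using haI), List.filter_cons_of_pos (by simpa using haI),
      e1, e2]
    simp only [List.map_cons, List.foldr_cons]

/-- The members of a list of vector fields with index in `I`. -/
def subForms {n : ℕ} (c : Fin n → Idx → Grass p q) (I : Finset (Fin n)) : List (Idx → Grass p q) :=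
  List.ofFn fun k : Fin I.card => c (I.orderEmbOfFin rfl k)

/-- The increasing enumeration of `I` is the sublist of `0, …, n-1` selected by the Leibniz rule, so
the spectators stay in order. -/
theorem subForms_eq {n : ℕ} (c : Fin n → Idx → Grass p q) (I : Finset (Fin n)) :
    subForms c I = ((List.finRange n).filter fun k => k ∈ I).map c := by
  have h1 : ((List.finRange n).filter fun k => k ∈ I) = I.sort (· ≤ ·) := by
    refine List.Perm.eq_of_pairwise' (r := (· ≤ ·)) ?_ ?_ ?_
    · exact (List.pairwise_le_finRange n).filter _
    · exact Finset.pairwise_sort _ _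
    · refine (List.perm_ext_iff_of_nodup ((List.nodup_finRange n).filter _)
        (Finset.sort_nodup _ _)).2 fun k => ?_
      simp
  rw [h1]
  apply List.ext_getElem
  · simp [subForms]
  · intro i h1 h2
    simp [subForms, Finset.orderEmbOfFin_apply]

/-- Even derivations produce no signs in the Leibniz rule, and evaluation at the origin is
multiplicative; the sum over subsets is the distribution of spectators between the two factors. -/
theorem evalDer_mul {n : ℕ} {c : Fin n → Idx → Grass p q} (hc : ∀ k, IsForm 0 (c k))
    (f g : SuperPoly p q) : evalDer (List.ofFn c) (f * g)
      = ∑ I : Finset (Fin n), evalDer (subForms c I) f * evalDer (subForms c Iᶜ) g := by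
  classical
  rw [evalDer_apply, List.ofFn_eq_map, foldr_der_mul hc f g _ (List.nodup_finRange n),
    ← augmentHom_apply, map_sum]
  have : (List.finRange n).toFinset.powerset = Finset.univ := by
    rw [List.toFinset_finRange, Finset.powerset_univ]
  rw [this]
  refine Finset.sum_congr rfl fun I _ => ?_
  rw [map_mul, evalDer_apply, evalDer_apply, subForms_eq, subForms_eq]
  simp only [Finset.mem_compl]
  rfl

/-! ### Derivatives of `log Z` -/

/-- Among the terms of one power of `ħ`, those with more arguments than derivatives retain a
coordinate, and those with fewer are killed. In the remaining one the factorials cancel. -/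
theorem evalDer_coeff_logZ {F : FCoeffs p q} (hF : ∀ g n, Supersymmetric (F g n))
    {cs : List (Idx → Grass p q)} (hcs : ∀ c ∈ cs, IsForm 0 c) (hcs' : cs ≠ []) {g n d : ℕ}
    (hn : cs.length = n) (hd : d + 2 = 2 * g + n) :
    evalDer cs (PowerSeries.coeff d (logZ F)) = augment (evList (F g n) cs) := by
  have hn0 : 0 < n := hn ▸ List.length_pos_iff.2 hcs'
  rw [coeff_logZ, map_sum, Finset.sum_eq_single g]
  · obtain rfl : n = d + 2 - 2 * g := by omega
    rw [evalDer_smul, evalDer_apply, foldr_der_evList (hF _ _) hcs, hn, Nat.descFactorial_self,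
      ← Nat.cast_smul_eq_nsmul ℂ, augment_smul, smul_smul, inv_mul_cancel₀, one_smul]
    exact_mod_cast Nat.factorial_ne_zero _
  · intro h hh hne
    rw [Finset.mem_range] at hh
    rw [evalDer_smul, evalDer_apply, foldr_der_evList (hF _ _) hcs,
      ← Nat.cast_smul_eq_nsmul ℂ, augment_smul]
    rcases lt_or_ge cs.length (d + 2 - 2 * h) with h' | h'
    · rw [augment_evList _ _ h', smul_zero, smul_zero]
    · rw [Nat.descFactorial_of_lt (by omega), Nat.cast_zero, zero_smul, smul_zero]
  · intro h
    rw [Finset.mem_range] at h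
    omega

/-- No genus balances the power of `ħ` against the number of derivatives, so the surviving case of
the previous argument does not occur. This covers both wrong parity and negative genus. -/
theorem evalDer_coeff_logZ_eq_zero {F : FCoeffs p q} (hF : ∀ g n, Supersymmetric (F g n))
    {cs : List (Idx → Grass p q)} (hcs : ∀ c ∈ cs, IsForm 0 c) {d : ℕ}
    (hd : ∀ g, d + 2 ≠ 2 * g + cs.length) :
    evalDer cs (PowerSeries.coeff d (logZ F)) = 0 := by
  rw [coeff_logZ, map_sum, Finset.sum_eq_zero]
  intro h hh
  rw [Finset.mem_range] at hh
  rw [evalDer_smul, evalDer_apply, foldr_der_evList (hF _ _) hcs,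
    ← Nat.cast_smul_eq_nsmul ℂ, augment_smul]
  rcases lt_or_ge cs.length (d + 2 - 2 * h) with h' | h'
  · rw [augment_evList _ _ h', smul_zero, smul_zero]
  · have := hd h
    rw [Nat.descFactorial_of_lt (by omega), Nat.cast_zero, zero_smul, smul_zero]

theorem varFree_evConst {n : ℕ} (T : (Fin n → Idx) →₀ BaseRing p q) {y : Fin n → Idx → Grass p q}
    (hy : ∀ k i, VarFree (y k i)) : VarFree (evConst T y) := by
  have hsum : ∀ (s : Finset (Fin n → Idx)) (f : (Fin n → Idx) → Grass p q),
      (∀ i, VarFree (f i)) → VarFree (∑ i ∈ s, f i) := fun s f hf => by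
    rw [VarFree, map_sum]; exact Finset.sum_congr rfl fun i _ => hf i
  refine hsum _ _ fun i => VarFree.mul ?_ (varFree_ofBase _)
  rw [VarFree, map_list_prod]
  congr 1
  refine (List.map_congr_left fun x hx => ?_).trans (List.map_id _)
  obtain ⟨k, rfl⟩ := (List.mem_ofFn' _ _).1 hx
  exact hy k _

theorem augment_evList_ofFn {n : ℕ} (T : (Fin n → Idx) →₀ BaseRing p q)
    {y : Fin n → Idx → Grass p q} (hy : ∀ k i, VarFree (y k i)) :
    augment (evList T (List.ofFn y)) = evConst T y := by
  rw [evList_eq_cst T _ List.length_ofFn, augment_cst]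
  · congr 1
    funext k
    simp
  · refine varFree_evConst _ fun k i => ?_
    simpa using hy _ i

/-- `[dz_j] z_j⁻¹ = [dθ_j] θ_j` and `[dθ_j]`. -/
def basisForm (ε : Bool) (j : ℕ) : Grass p q := cond ε (dth j) (dth j * th j)

theorem isPar_basisForm (ε : Bool) (j : ℕ) : IsPar ε.toNat (basisForm ε j : Grass p q) := by
  cases ε
  · exact ((isPar_gen _).mul (isPar_gen _)).congr rfl
  · exact isPar_gen _

theorem varFree_basisForm (ε : Bool) (j : ℕ) : VarFree (basisForm ε j : Grass p q) := by
  cases ε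
  · exact (varFree_dth _).mul (varFree_th _)
  · exact varFree_dth _

/-! ### One-point values and the correlators -/

namespace CurveData

/-- The coefficients of `z_j^N` of the forms `dξ_{-k}`, `dη_{-k}`. -/
def argForm (S : CurveData p q) (j : ℕ) (N : ℤ) (i : Idx) : Grass p q := (S.xi i).coeff j N

theorem argForm_eq (S : CurveData p q) (j : ℕ) (N : ℤ) :
    S.argForm j N = fun i => basisForm true j * S.frm true N i
      + basisForm false j * S.frm false N i := by
  funext i
  exact add_comm _ _

theorem isForm_argForm {S : CurveData p q} {s : ℤ} (hS : S.IsLocalSuperSpectralCurve s) (j : ℕ)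
    (N : ℤ) : IsForm 0 (S.argForm j N) := by
  rw [argForm_eq]
  have h : ∀ ε : Bool, ∀ i, IsPar (i.parity + 0) (basisForm ε j * S.frm ε N i) := fun ε i =>
    ((isPar_basisForm ε j).mul ((isForm_frm hS ε N).par i)).congr (by omega)
  have h' : ∀ ε : Bool, ∀ i, VarFree (basisForm ε j * S.frm ε N i) := fun ε i =>
    (varFree_basisForm ε j).mul ((isForm_frm hS ε N).free i)
  exact ⟨fun i => (h true i).add (h false i), fun i => (h' true i).add (h' false i)⟩

theorem der_argForm (S : CurveData p q) (j : ℕ) (N : ℤ) (f : SuperPoly p q) :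
    der (S.argForm j N) f = ∑ ε : Bool, cst (basisForm ε j) * der (S.frm ε N) f := by
  rw [argForm_eq, der_combination, Fintype.sum_bool]

/-- `(Z⁻¹ X Z) 1` for `X` the conjugate of `J_{-N}` or `Γ_{-N}`. -/
def oneZ (S : CurveData p q) (F : FCoeffs p q) (ε : Bool) (N : ℤ) : HSeries p q :=
  fieldZ F (S.field ε N)

theorem coeff_zero_oneZ (S : CurveData p q) (F : FCoeffs p q) (ε : Bool) (N : ℤ) :
    PowerSeries.coeff 0 (S.oneZ F ε N) = cst (ofBase (cond ε (S.τ N) (S.t N))) := by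
  rw [oneZ, fieldZ, field_const]
  simp

theorem coeff_succ_oneZ {S : CurveData p q} {s : ℤ} (hS : S.IsLocalSuperSpectralCurve s)
    (F : FCoeffs p q) (ε : Bool) (N : ℤ) (d : ℕ) : PowerSeries.coeff (d + 1) (S.oneZ F ε N)
      = (if d = 0 then (S.field ε N).cre else 0)
        + der (S.frm ε N) (PowerSeries.coeff d (logZ F)) := by
  rw [oneZ, fieldZ, modeForm_field hS]
  simp [PowerSeries.coeff_succ_X_mul, PowerSeries.coeff_X, coeff_mapH]

theorem omegaF_eq_evConst (S : CurveData p q) (F : FCoeffs p q) (g n : ℕ) (j : Fin n → ℕ)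
    (e : Fin n → ℤ) : S.omegaF F g n j e = evConst (F g n) fun k => S.argForm (j k) (e k) := rfl

theorem isForm_of_mem_ofFn {S : CurveData p q} {s : ℤ} (hS : S.IsLocalSuperSpectralCurve s) {n : ℕ}
    (lab : Fin n → ℕ) (e : Fin n → ℤ) :
    ∀ c ∈ List.ofFn (fun k => S.argForm (lab k) (e k)), IsForm 0 c := fun c h => by
  obtain ⟨k, rfl⟩ := (List.mem_ofFn' _ _).1 h
  exact isForm_argForm hS _ _

theorem ofFn_cons_argForm (S : CurveData p q) {n : ℕ} (j : ℕ) (N : ℤ) (lab : Fin n → ℕ)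
    (e : Fin n → ℤ) : S.argForm j N :: List.ofFn (fun k => S.argForm (lab k) (e k))
      = List.ofFn fun k => S.argForm (Fin.cons (α := fun _ => ℕ) j lab k)
        (Fin.cons (α := fun _ => ℤ) N e k) := by
  rw [List.ofFn_succ]
  rfl

/-- The coefficient of `ħ^d` in `log Z` with `n + 1` arguments has genus `g` exactly when `d = 2g -
2 + (n + 1)`. The form in the distinguished variable acts first and is then moved to the front. -/
theorem evalDer_argForm_logZ {S : CurveData p q} {s : ℤ} (hS : S.IsLocalSuperSpectralCurve s)
    {F : FCoeffs p q} (hF : S.IsPartitionFunction s F) {g n d : ℕ} (hd : d + 1 = 2 * g + n) (j : ℕ)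
    (N : ℤ) (lab : Fin n → ℕ) (e : Fin n → ℤ) :
    evalDer (List.ofFn fun k => S.argForm (lab k) (e k))
        (der (S.argForm j N) (PowerSeries.coeff d (logZ F)))
      = S.omegaF F g (n + 1) (Fin.cons j lab) (Fin.cons N e) := by
  have hcs := isForm_of_mem_ofFn hS lab e
  have hj := isForm_argForm hS j N
  rw [show der (S.argForm j N) (PowerSeries.coeff d (logZ F))
      = [S.argForm j N].foldr der (PowerSeries.coeff d (logZ F)) from rfl, ← evalDer_append,
    evalDer_coeff_logZ hF.symm (g := g) (n := n + 1)
      (fun c h => (List.mem_append.1 h).elim (hcs c) fun h => List.mem_singleton.1 h ▸ hj)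
      (by simp) (by simp) (by omega), evList_append (hF.symm _ _) hj hcs (by simp),
    ofFn_cons_argForm, augment_evList_ofFn _ fun k i => (isForm_argForm hS _ _).free i,
    omegaF_eq_evConst]

/-- The two distinguished forms act before all spectators and are moved to the front one after the
other, which preserves their order. -/
theorem evalDer_argForm_argForm_logZ {S : CurveData p q} {s : ℤ}
    (hS : S.IsLocalSuperSpectralCurve s) {F : FCoeffs p q} (hF : S.IsPartitionFunction s F)
    (g n : ℕ) (j j' : ℕ) (N N' : ℤ) (lab : Fin n → ℕ) (e : Fin n → ℤ) :
    evalDer (List.ofFn fun k => S.argForm (lab k) (e k))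
        (der (S.argForm j N) (der (S.argForm j' N') (PowerSeries.coeff (2 * g + n) (logZ F))))
      = S.omegaF F g (n + 2) (Fin.cons j (Fin.cons j' lab)) (Fin.cons N (Fin.cons N' e)) := by
  have hcs := isForm_of_mem_ofFn hS lab e
  have hj := isForm_argForm hS j N
  have hj' := isForm_argForm hS j' N'
  have hcs1 : ∀ c ∈ List.ofFn (fun k => S.argForm (lab k) (e k)) ++ [S.argForm j N], IsForm 0 c :=
    fun c h => (List.mem_append.1 h).elim (hcs c) fun h => List.mem_singleton.1 h ▸ hj
  rw [show ∀ f, der (S.argForm j N) (der (S.argForm j' N') f)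
      = ([S.argForm j N] ++ [S.argForm j' N']).foldr der f from fun _ => rfl, ← evalDer_append,
    ← List.append_assoc, evalDer_coeff_logZ hF.symm (g := g) (n := n + 2)
      (fun c h => (List.mem_append.1 h).elim (hcs1 c) fun h => List.mem_singleton.1 h ▸ hj')
      (by simp) (by simp) (by omega), evList_append (hF.symm _ _) hj' hcs1 (by simp),
    ← List.cons_append, evList_append (hF.symm _ _) hj
      (by rw [ofFn_cons_argForm]; exact isForm_of_mem_ofFn hS _ _) (by simp),
    ofFn_cons_argForm, ofFn_cons_argForm,
    augment_evList_ofFn _ fun k i => (isForm_argForm hS _ _).free i, omegaF_eq_evConst]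

theorem evalDer_argForm_logZ_eq_zero {S : CurveData p q} {s : ℤ}
    (hS : S.IsLocalSuperSpectralCurve s) {F : FCoeffs p q} (hF : S.IsPartitionFunction s F)
    {n d : ℕ} (hd : ∀ g, d + 1 ≠ 2 * g + n) (j : ℕ) (N : ℤ) (lab : Fin n → ℕ) (e : Fin n → ℤ) :
    evalDer (List.ofFn fun k => S.argForm (lab k) (e k))
      (der (S.argForm j N) (PowerSeries.coeff d (logZ F))) = 0 := by
  have hcs := isForm_of_mem_ofFn hS lab e
  have hj := isForm_argForm hS j N
  rw [show der (S.argForm j N) (PowerSeries.coeff d (logZ F))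
      = [S.argForm j N].foldr der (PowerSeries.coeff d (logZ F)) from rfl, ← evalDer_append,
    evalDer_coeff_logZ_eq_zero hF.symm
      (fun c h => (List.mem_append.1 h).elim (hcs c) fun h => List.mem_singleton.1 h ▸ hj)]
  intro g h
  refine hd g ?_
  simp at h
  omega

theorem gen_mul_gen (v w : OddVar q) : (gen v * gen w : Grass p q) = -(gen w * gen v) := by
  rw [(isPar_gen v).comm' (isPar_gen w)]
  simp

/-- Here `b` is the exponent of `z_j`, the argument of the field whose creation part is contracted.
The vacuum value is supported on `b ≥ 0`, which is the expansion in `|z_j| < |z_k|`, so the indices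
`a` and `b` appear exchanged. -/
theorem sum_basisForm_vev (j k : ℕ) (a b : ℤ) :
    ∑ δ : Bool, basisForm δ j * ∑ ε : Bool, basisForm ε k * (vev ε δ a b : Grass p q)
      = bRExp j k b a := by
  have h : (th j * dth k : Grass p q) = -(dth k * th j) := gen_mul_gen _ _
  have h' : (dth j * th j * (dth k * th k) : Grass p q) = -(dth j * dth k * th j * th k) := by
    rw [mul_assoc, ← mul_assoc (th j), h]; noncomm_ring
  simp only [Fintype.sum_bool, basisForm, cond, vev, bRExp, add_comm b a]
  split_ifs with h1 h2 h3
  · obtain ⟨m, rfl⟩ := Int.eq_ofNat_of_zero_le h2.le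
    simp only [mul_one, mul_zero, add_zero, zero_add]
    rw [← mul_assoc, h', zsmul_eq_mul, neg_mul, Int.cast_natCast, add_comm, Nat.cast_comm]
  · simp [Algebra.algebraMap_eq_smul_one]
  · simp
  · simp

/-- The contraction comes with the spectator mode on the left, the bidifferential with the
distinguished argument on the left; symmetry of `B` and antisymmetry of `V` account for the
exchange. -/
theorem sum_basisForm_regPart {S : CurveData p q} {s : ℤ} (hS : S.IsLocalSuperSpectralCurve s)
    (j k : ℕ) (a b : ℤ) : ∑ δ : Bool, basisForm δ j * ∑ ε : Bool, basisForm ε k * S.regPart ε δ a b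
      = S.bReg j k b a := by
  simp only [Fintype.sum_bool, basisForm, cond, regPart, bReg, and_comm (a := 0 ≤ b)]
  by_cases h : 0 ≤ a ∧ 0 ≤ b
  · simp only [if_pos h]
    rw [hS.B_symm a.toNat, hS.V_antisymm a.toNat]
    generalize (if a.toNat = 0 then (2⁻¹ : ℂ) else 0) = x
    generalize (if b.toNat = 0 then (2⁻¹ : ℂ) else 0) = y
    simp only [mul_add, mul_assoc, map_neg, smul_neg, neg_neg, mul_smul_comm]
    module
  · simp only [if_neg h, mul_zero, add_zero]

/-- In the order used by the Casimir the explicit sign moves `[dθ_0]` past `[dθ_1]`, and no symmetry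
of the coefficients is needed. -/
theorem sum_basisForm_regPart' (S : CurveData p q) (a b : ℤ) :
    ∑ ε : Bool, ∑ δ : Bool, (-1) ^ (ε.toNat * δ.toNat) * (basisForm ε 0 * basisForm δ 1)
      * S.regPart ε δ a b = S.bReg 0 1 a b := by
  simp only [Fintype.sum_bool, basisForm, cond, regPart, bReg]
  by_cases h : 0 ≤ a ∧ 0 ≤ b
  · simp only [if_pos h]
    generalize (if a.toNat = 0 then (2⁻¹ : ℂ) else 0) = x
    generalize (if b.toNat = 0 then (2⁻¹ : ℂ) else 0) = y
    simp [mul_assoc]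
    module
  · simp only [if_neg h, mul_zero, add_zero]

theorem varFree_regPart (S : CurveData p q) (ε δ : Bool) (a b : ℤ) :
    VarFree (S.regPart ε δ a b) := by
  rw [regPart]
  split_ifs
  · cases ε <;> cases δ
    exacts [varFree_ofBase _, (varFree_ofBase _).smul _, (varFree_ofBase _).smul _,
      ((varFree_ofBase _).smul _).neg]
  · exact VarFree.zero

theorem varFree_vev_add (S : CurveData p q) (ε δ : Bool) (a b : ℤ) :
    VarFree (vev ε δ a b + S.regPart ε δ a b) := by
  refine VarFree.add ?_ (S.varFree_regPart ε δ a b)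
  cases ε <;> cases δ <;> simp only [vev, ite_self, VarFree.zero]
  · split_ifs
    exacts [map_intCast _ _, VarFree.zero, VarFree.zero]
  · rw [Algebra.algebraMap_eq_smul_one]
    split_ifs
    exacts [VarFree.one, VarFree.one.smul _, VarFree.zero, VarFree.zero]

/-- The three parts of the one-point value have disjoint roles: the constant is `ω_{0,1}`, the
creation part differentiated by the single spectator is `B`, and the derivative of `log Z` is the
tensor part of `ω_{g,n+1}`. -/
theorem omega_eq {S : CurveData p q} {s : ℤ} (hS : S.IsLocalSuperSpectralCurve s)
    {F : FCoeffs p q} (hF : S.IsPartitionFunction s F) (g n j : ℕ) (N : ℤ) (lab : Fin n → ℕ)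
    (e : Fin n → ℤ) : S.omega F g (n + 1) (Fin.cons j lab) (Fin.cons N e)
      = ∑ ε : Bool, basisForm ε j * evalDer (List.ofFn fun k => S.argForm (lab k) (e k))
          (PowerSeries.coeff (2 * g + n) (S.oneZ F ε N)) := by
  have hcs := isForm_of_mem_ofFn hS lab e
  simp only [← evalDer_cst_mul hcs (varFree_basisForm _ _)]
  rw [← map_sum]
  obtain ⟨d, hd⟩ | ⟨rfl, rfl⟩ : (∃ d, 2 * g + n = d + 1) ∨ (g = 0 ∧ n = 0) := by
    rcases Nat.eq_zero_or_pos (2 * g + n) with h | h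
    · right; omega
    · exact Or.inl ⟨2 * g + n - 1, by omega⟩
  · rw [hd]
    simp only [coeff_succ_oneZ hS, mul_add, Finset.sum_add_distrib, ← der_argForm]
    rw [map_add, evalDer_argForm_logZ hS hF hd.symm, omega]
    congr 1
    -- The creation part sits at order `ħ`, so it is visible only for `2g + n = 1`, that is, `(g, n)
    -- = (0, 1)`.
    by_cases h0 : d = 0
    · obtain ⟨rfl, rfl⟩ : g = 0 ∧ n = 1 := by omega
      subst h0
      rw [omegaUnstable, ← sum_basisForm_vev, ← sum_basisForm_regPart hS, ← Finset.sum_add_distrib,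
        map_sum]
      refine Finset.sum_congr rfl fun δ _ => ?_
      rw [evalDer_cst_mul hcs (varFree_basisForm _ _), ← mul_add, ← Finset.sum_add_distrib]
      congr 1
      simp only [if_true, ← mul_add]
      rw [List.ofFn_succ, List.ofFn_zero, evalDer_apply, List.foldr_cons, List.foldr_nil,
        der_argForm, ← augmentHom_apply, map_sum]
      refine Finset.sum_congr rfl fun ε _ => ?_
      rw [map_mul, augmentHom_apply, augmentHom_apply, augment_cst (varFree_basisForm _ _),
        der_cre hS, augment_cst (varFree_vev_add S _ _ _ _)]
      rfl
    · simp only [h0, if_false, mul_zero, Finset.sum_const_zero, map_zero]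
      match g, n, hd with
      | 0, 0, hd => omega
      | 0, 1, hd => omega
      | 0, n + 2, _ => rfl
      | g + 1, n, _ => rfl
  · rw [omega, omegaF, hF.unstable 0 1 (by omega), Finsupp.sum_zero_index, add_zero, omegaUnstable]
    simp only [Nat.mul_zero, Nat.add_zero, coeff_zero_oneZ, ← cst_mul, Fintype.sum_bool]
    rw [List.ofFn_zero, map_add, evalDer_apply, evalDer_apply, List.foldr_nil, List.foldr_nil,
      augment_cst ((varFree_basisForm _ _).mul (varFree_ofBase _)),
      augment_cst ((varFree_basisForm _ _).mul (varFree_ofBase _))]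
    exact add_comm _ _

theorem augment_cre {S : CurveData p q} {s : ℤ} (hS : S.IsLocalSuperSpectralCurve s)
    (ε : Bool) (N : ℤ) : augment (S.field ε N).cre = 0 := by
  have h : ∀ k : ℤ, augment (creJ k : SuperPoly p q) = 0 ∧ augment (creG k : SuperPoly p q) = 0 := by
    intro k
    simp only [← augmentHom_apply]
    rcases k with (_ | k) | k
    · simp only [creJ, creG, map_zero, augmentHom_apply, augment_smul, augment_coord, smul_zero,
        and_true]
    · exact ⟨map_zero augmentHom, map_zero augmentHom⟩
    · constructor
      · rw [creJ, map_nsmul, augmentHom_apply, augment_coord, smul_zero]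
      · rw [creG, augmentHom_apply, augment_coord]
  rw [cre_field hS, ← augmentHom_apply, map_add, map_mul, augmentHom_apply (creG 0), (h 0).2,
    mul_zero, add_zero, augmentHom_apply]
  split_ifs
  · cases ε
    exacts [(h _).1, (h _).2]
  · exact map_zero augmentHom

/-- Powers of `ħ` that correspond to no genus contribute nothing. This makes the product over all
powers of `ħ` collapse to the sum over `g₁ + g₂ = g`. -/
theorem sum_evalDer_oneZ_eq_zero {S : CurveData p q} {s : ℤ} (hS : S.IsLocalSuperSpectralCurve s)
    {F : FCoeffs p q} (hF : S.IsPartitionFunction s F) {n d : ℕ} (hd : ∀ g, d ≠ 2 * g + n)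
    (j : ℕ) (N : ℤ) (lab : Fin n → ℕ) (e : Fin n → ℤ) :
    ∑ ε : Bool, basisForm ε j * evalDer (List.ofFn fun k => S.argForm (lab k) (e k))
      (PowerSeries.coeff d (S.oneZ F ε N)) = 0 := by
  have hcs := isForm_of_mem_ofFn hS lab e
  simp only [← evalDer_cst_mul hcs (varFree_basisForm _ _)]
  rw [← map_sum]
  cases d with
  | zero =>
    have hn : n ≠ 0 := fun h => hd 0 (by omega)
    simp only [coeff_zero_oneZ, ← cst_mul]
    rw [map_sum]
    exact Finset.sum_eq_zero fun ε _ => evalDer_cst (by simpa using hn)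
      ((varFree_basisForm _ _).mul (varFree_ofBase _))
  | succ d =>
    simp only [coeff_succ_oneZ hS, mul_add, Finset.sum_add_distrib, ← der_argForm]
    rw [map_add, evalDer_argForm_logZ_eq_zero hS hF hd, add_zero, map_sum]
    refine Finset.sum_eq_zero fun ε _ => ?_
    rw [evalDer_cst_mul hcs (varFree_basisForm _ _)]
    split_ifs with h0
    · subst h0
      match n, hd, lab, e with
      | 0, _, _, _ => exact mul_eq_zero_of_right _ (augment_cre hS _ _)
      | 1, hd, _, _ => exact absurd rfl (hd 0)
      -- The creation part is linear in the coordinates, so a second derivative kills it.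
      | n + 2, _, lab, e =>
        rw [List.ofFn_succ', List.concat_eq_append, evalDer_append, List.foldr_cons, List.foldr_nil,
          der_argForm, map_sum, Finset.sum_eq_zero, mul_zero]
        intro ε' _
        rw [der_cre hS, ← cst_mul, evalDer_cst (by simp)
          ((varFree_basisForm _ _).mul (varFree_vev_add S _ _ _ _))]
    · rw [map_zero, mul_zero]

end CurveData

/-! ### The twisted super quadratic Casimir -/

theorem dgen_gen_mul_self (v : OddVar q) (x : Grass p q) :
    dgen v (gen v * x) = x - gen v * dgen v x := by
  rw [gen, dgen_ι_mul, Finsupp.single_eq_same, one_smul]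

theorem dgen_gen_mul_of_ne {v w : OddVar q} (h : w ≠ v) (x : Grass p q) :
    dgen v (gen w * x) = -(gen w * dgen v x) := by
  rw [gen, dgen_ι_mul, Finsupp.single_eq_of_ne (Ne.symm h), zero_smul, zero_sub]

theorem dgen_gen_self (v : OddVar q) : dgen v (gen v : Grass p q) = 1 := by
  simpa using dgen_gen_mul_self v (1 : Grass p q)

theorem dgen_gen_of_ne {v w : OddVar q} (h : w ≠ v) : dgen v (gen w : Grass p q) = 0 := by
  simpa using dgen_gen_mul_of_ne h (1 : Grass p q)

theorem ArgFree.dgen {x : Grass p q} (hx : ArgFree x) {v : OddVar q}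
    (hv : v = .theta 0 ∨ v = .theta 1 ∨ v = .dtheta 0 ∨ v = .dtheta 1) : dgen v x = 0 := by
  rw [← hx]
  refine dgen_substOdd_eq_zero _ _ (fun w => ?_) x
  have h : ∀ w' : OddVar q, w' ≠ v → (Finsupp.single w' (1 : EvenParams p)) v = 0 :=
    fun w' h => Finsupp.single_eq_of_ne (Ne.symm h)
  rcases w with i | k | (_ | _ | j) | (_ | _ | j) <;>
    first
    | rfl
    | exact h _ (by rcases hv with rfl | rfl | rfl | rfl <;> simp)

/-- Coefficients built from spectators and base constants do not contain the four generators of the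
Casimir arguments, so every restriction used there passes through them. -/
theorem ArgFree.substOdd {x : Grass p q} (hx : ArgFree x)
    (f : OddVar q → (OddVar q →₀ EvenParams p))
    (hf : ∀ v, v ≠ .theta 0 → v ≠ .theta 1 → v ≠ .dtheta 0 → v ≠ .dtheta 1 →
      f v = Finsupp.single v 1) : substOdd f x = x := by
  conv_lhs => rw [← hx]
  rw [substOdd_substOdd _ _ killArg, hx]
  intro w
  rcases w with i | k | (_ | _ | j) | (_ | _ | j) <;>
    first
    | exact map_zero _
    | (simp only [killArg, Finsupp.linearCombination_single, one_smul]; exact hf _ (by simp)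
        (by simp) (by simp) (by simp))

theorem gen_mul_self (v : OddVar q) : (gen v * gen v : Grass p q) = 0 :=
  ExteriorAlgebra.ι_sq_zero _

theorem gen_mul_gen_mul (v : OddVar q) (x : Grass p q) : gen v * (gen v * x) = 0 := by
  rw [← mul_assoc, gen_mul_self, zero_mul]

/-- The restriction to `θ_1 = -θ_0`. -/
def substPos : Grass p q →ₐ[EvenParams p] Grass p q :=
  substOdd fun v => match v with
    | .theta 1 => -Finsupp.single (.theta 0) 1
    | v => Finsupp.single v 1

/-- The restriction to `(-θ_0, θ_0)`. -/
def substNeg : Grass p q →ₐ[EvenParams p] Grass p q :=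
  substOdd fun v => match v with
    | .theta 0 => -Finsupp.single (.theta 0) 1
    | .theta 1 => Finsupp.single (.theta 0) 1
    | v => Finsupp.single v 1

theorem restrictPos_eq (f : ℤ → ℤ → Grass p q) (N : ℤ) :
    restrictPos f N = ∑ᶠ a : ℤ, ((-1 : ℂ) ^ (N - a)) • substPos (f a (N - a)) := rfl

theorem restrictNeg_eq (f : ℤ → ℤ → Grass p q) (N : ℤ) :
    restrictNeg f N = ∑ᶠ a : ℤ, ((-1 : ℂ) ^ a) • substNeg (f a (N - a)) := rfl

theorem substPos_th_zero : substPos (th 0 : Grass p q) = th 0 := substOdd_gen _ _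

theorem substPos_th_one : substPos (th 1 : Grass p q) = -th 0 :=
  (substOdd_gen _ _).trans (map_neg _ _)

theorem substNeg_th_zero : substNeg (th 0 : Grass p q) = -th 0 :=
  (substOdd_gen _ _).trans (map_neg _ _)

theorem substNeg_th_one : substNeg (th 1 : Grass p q) = th 0 := substOdd_gen _ _

theorem ArgFree.substPos {x : Grass p q} (hx : ArgFree x) : substPos x = x :=
  hx.substOdd _ fun v h0 h _ _ => by
    rcases v with i | k | (_ | _ | j) | j <;> first | rfl | exact absurd rfl h

theorem ArgFree.substNeg {x : Grass p q} (hx : ArgFree x) : substNeg x = x :=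
  hx.substOdd _ fun v h0 h _ _ => by
    rcases v with i | k | (_ | _ | j) | j <;>
      first | rfl | exact absurd rfl h | exact absurd rfl h0

/-- A double series with poles of bounded order. -/
def Bounded (f : ℤ → ℤ → Grass p q) : Prop := ∃ M : ℤ, ∀ a b, a < M ∨ b < M → f a b = 0

theorem Bounded.mulDiag {f : ℤ → ℤ → Grass p q} (hf : Bounded f) : Bounded (mulDiag f) := by
  obtain ⟨M, hM⟩ := hf
  exact ⟨M, fun a b h => by
    rw [SuperLoop.mulDiag, hM _ _ (by omega), hM _ _ (by omega), sub_zero]⟩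

theorem Bounded.add {f g : ℤ → ℤ → Grass p q} (hf : Bounded f) (hg : Bounded g) :
    Bounded fun a b => f a b + g a b := by
  obtain ⟨M, hM⟩ := hf
  obtain ⟨K, hK⟩ := hg
  exact ⟨min M K, fun a b h => by
    simp only [hM a b (by omega), hK a b (by omega), add_zero]⟩

theorem Bounded.map {f : ℤ → ℤ → Grass p q} (hf : Bounded f) (φ : ℤ → ℤ → Grass p q → Grass p q)
    (hφ : ∀ a b, φ a b 0 = 0) : Bounded fun a b => φ a b (f a b) := by
  obtain ⟨M, hM⟩ := hf
  exact ⟨M, fun a b h => by simp only [hM _ _ h, hφ]⟩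

theorem Bounded.shift {f : ℤ → ℤ → Grass p q} (hf : Bounded f) : Bounded fun a b => f (a - 1) b := by
  obtain ⟨M, hM⟩ := hf
  exact ⟨M, fun a b h => hM _ _ (by omega)⟩

theorem Bounded.finite {f : ℤ → ℤ → Grass p q} (hf : Bounded f) (N : ℤ)
    (φ : ℤ → Grass p q → Grass p q) (hφ : ∀ a, φ a 0 = 0) :
    (Function.support fun a => φ a (f a (N - a))).Finite := by
  obtain ⟨M, hM⟩ := hf
  refine (Set.finite_Icc M (N - M)).subset fun a ha => ?_
  by_contra h
  rw [Set.mem_Icc, not_and_or] at h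
  exact ha (by simp only [hM a (N - a) (by omega), hφ])

theorem Bounded.stripForms {f : ℤ → ℤ → Grass p q} (hf : Bounded f) : Bounded (stripForms f) :=
  hf.map (fun _ _ x => dgen (.dtheta 1) (dgen (.dtheta 0) x)) fun _ _ => by simp

theorem Bounded.dStar {f : ℤ → ℤ → Grass p q} (hf : Bounded f) : Bounded (dStar f) :=
  hf.map (fun a _ x => dgen (.theta 0) x + a • (th 0 * x)) fun _ _ => by simp

theorem Bounded.dStarFrac {f : ℤ → ℤ → Grass p q} (hf : Bounded f) (m : ℕ) :
    Bounded (dStarFrac m f) := by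
  have := hf.dStar.mulDiag.add (hf.shift.map (fun _ _ x => -(m • (th 0 * x))) fun _ _ => by simp)
  simp only [← sub_eq_add_neg] at this
  exact this

/-- Summation by parts along the antidiagonal; boundedness of the poles makes both sums finite. -/
theorem finsum_mulDiag {f : ℤ → ℤ → Grass p q} (hf : Bounded f) (w : ℤ → ℂ)
    (ψ : Grass p q →ₐ[EvenParams p] Grass p q) (N : ℤ) :
    ∑ᶠ a : ℤ, w a • ψ (mulDiag f a (N + 1 - a))
      = ∑ᶠ a : ℤ, (w (a + 1) - w a) • ψ (f a (N - a)) := by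
  have h1 := hf.finite N (fun a x => w (a + 1) • ψ x) fun a => by rw [map_zero, smul_zero]
  have h2 := hf.finite N (fun a x => w a • ψ x) fun a => by rw [map_zero, smul_zero]
  simp only [sub_smul]
  rw [finsum_sub_distrib h1 h2]
  have h3 : ∀ a, w a • ψ (mulDiag f a (N + 1 - a))
      = w a • ψ (f (a - 1) (N + 1 - a)) - w a • ψ (f a (N - a)) := fun a => by
    rw [mulDiag, map_sub, smul_sub]
    congr 4
    ring
  simp only [h3]
  have h4 : (fun a => w a • ψ (f (a - 1) (N + 1 - a)))
      = (fun a => w (a + 1) • ψ (f a (N - a))) ∘ (Equiv.subRight (1 : ℤ)) := by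
    funext a
    simp only [Function.comp_apply, Equiv.subRight_apply, sub_add_cancel]
    congr 3
    ring
  rw [finsum_sub_distrib _ h2]
  · congr 1
    exact (finsum_congr (congrFun h4)).trans
      (finsum_comp_equiv (Equiv.subRight (1 : ℤ)) (f := fun a => w (a + 1) • ψ (f a (N - a))))
  · change (Function.support fun a => w a • ψ (f (a - 1) (N + 1 - a))).Finite
    rw [h4]
    exact h1.preimage (Equiv.injective _).injOn

/-- The factor `z_0 - z_1` restricts to `2z`: consecutive alternating weights differ by twice
themselves. -/
theorem restrictPos_mulDiag {f : ℤ → ℤ → Grass p q} (hf : Bounded f) (N : ℤ) :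
    restrictPos (mulDiag f) (N + 1) = (2 : ℂ) • restrictPos f N := by
  rw [restrictPos, restrictPos, smul_finsum]
  refine (finsum_mulDiag hf (fun a => (-1 : ℂ) ^ (N + 1 - a)) (substOdd _) N).trans ?_
  refine finsum_congr fun a => ?_
  rw [smul_smul]
  congr 1
  rw [show N + 1 - a = (N - a) + 1 by ring, show N + 1 - (a + 1) = N - a by ring,
    zpow_add_one₀ (by norm_num)]
  ring

theorem restrictNeg_mulDiag {f : ℤ → ℤ → Grass p q} (hf : Bounded f) (N : ℤ) :
    restrictNeg (mulDiag f) (N + 1) = (-2 : ℂ) • restrictNeg f N := by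
  rw [restrictNeg, restrictNeg, smul_finsum]
  refine (finsum_mulDiag hf (fun a => (-1 : ℂ) ^ a) (substOdd _) N).trans ?_
  refine finsum_congr fun a => ?_
  rw [smul_smul]
  congr 1
  rw [zpow_add_one₀ (by norm_num)]
  ring

theorem stripForms_mulDiag (f : ℤ → ℤ → Grass p q) :
    stripForms (mulDiag f) = mulDiag (stripForms f) := by
  funext a b
  simp only [stripForms, mulDiag, map_sub]

/-- Cancelling a common factor commutes with the quotient rule: the derivative `θ_0 z_0` of the
extra factor compensates the increase of `m` by one. -/
theorem dStarFrac_mulDiag (m : ℕ) (h : ℤ → ℤ → Grass p q) :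
    dStarFrac (m + 1) (mulDiag h) = mulDiag (dStarFrac m h) := by
  funext a b
  simp only [dStarFrac, dStar, mulDiag, map_sub, mul_sub, smul_sub]
  rw [show a - 1 - 1 = a - 2 by ring]
  module

/-- The Casimir does not depend on the representation of the bidifferential. -/
theorem casimir_mulDiag {f : ℤ → ℤ → Grass p q} (hf : Bounded f) (m : ℕ) (N : ℤ) :
    casimir ⟨m + 1, mulDiag f⟩ N = casimir ⟨m, f⟩ N := by
  simp only [casimir, stripForms_mulDiag, dStarFrac_mulDiag]
  rw [show N + (((m + 1 : ℕ) : ℤ) + 1) = N + (m + 1) + 1 by push_cast; ring,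
    restrictPos_mulDiag (hf.stripForms.dStarFrac m), restrictNeg_mulDiag (hf.stripForms.dStarFrac m),
    smul_smul, smul_smul]
  congr 3
  · rw [pow_succ _ (m + 1), mul_inv, inv_mul_cancel_right₀ two_ne_zero]
  · rw [pow_succ _ (m + 1), mul_inv, inv_mul_cancel_right₀ (by norm_num)]

theorem casimir_add {f g : ℤ → ℤ → Grass p q} (hf : Bounded f) (hg : Bounded g) (m : ℕ) (N : ℤ) :
    casimir ⟨m, fun a b => f a b + g a b⟩ N = casimir ⟨m, f⟩ N + casimir ⟨m, g⟩ N := by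
  have h1 : dStarFrac m (stripForms fun a b => f a b + g a b)
      = fun a b => dStarFrac m (stripForms f) a b + dStarFrac m (stripForms g) a b := by
    funext a b
    simp only [dStarFrac, dStar, mulDiag, stripForms, map_add, mul_add, smul_add]
    abel
  have h2 : ∀ (u v : ℤ → ℤ → Grass p q) (K : ℤ), Bounded u → Bounded v →
      restrictPos (fun a b => u a b + v a b) K = restrictPos u K + restrictPos v K
      ∧ restrictNeg (fun a b => u a b + v a b) K = restrictNeg u K + restrictNeg v K :=
    fun u v K hu hv => by
      have h := fun (w : ℤ → ℂ) (ψ : Grass p q →ₐ[EvenParams p] Grass p q) =>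
        finsum_add_distrib (hu.finite K (fun a x => w a • ψ x) fun a => by simp)
          (hv.finite K (fun a x => w a • ψ x) fun a => by simp)
      refine ⟨Eq.trans ?_ (h _ _), Eq.trans ?_ (h _ _)⟩ <;>
        exact finsum_congr fun a => by rw [map_add, smul_add]
  have h3 := h2 _ _ (N + (m + 1)) (hf.stripForms.dStarFrac m) (hg.stripForms.dStarFrac m)
  simp only [casimir, h1, h3.1, h3.2]
  module

/-- The expansion of `B^R` cannot be restricted to `z_1 = -z_0`, as it lives in `|z_0| < |z_1|`; the
rational form can. The resulting constant is the anomaly that the central term `ħ²/4` of `L_0` has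
to match. -/
theorem casimir_bRNum (N : ℤ) : casimir (⟨2, CurveData.bRNum⟩ : Bidiff p q) N
    = if N = 0 then -((2⁻¹ : ℂ) • th 0) else 0 := by
  have hh : ∀ a b : ℤ, (stripForms CurveData.bRNum a b : Grass p q) = if a = 1 ∧ b = 1 then -(th 0 * th 1)
      else if a = 2 ∧ b = 0 then -((2⁻¹ : ℂ) • 1)
      else if a = 0 ∧ b = 2 then (2⁻¹ : ℂ) • 1 else 0 := by
    intro a b
    rw [stripForms, CurveData.bRNum]
    split_ifs <;> simp (disch := simp) only [mul_assoc, dth, th, map_neg, map_zero, dgen_smul,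
      dgen_gen_mul_self, dgen_gen_mul_of_ne, dgen_gen_of_ne, dgen_gen_self, mul_zero, neg_zero,
      sub_zero]
  have hd : ∀ a b : ℤ, (dStar (stripForms CurveData.bRNum) a b : Grass p q) = if a = 1 ∧ b = 1 then -th 1
      else if a = 2 ∧ b = 0 then -th 0 else 0 := by
    intro a b
    rw [dStar, hh]
    split_ifs with h1 h2 h3
    · rw [h1.1, one_smul]
      simp (disch := simp) only [th, map_neg, dgen_gen_mul_self, dgen_gen_of_ne, mul_zero, sub_zero,
        mul_neg, gen_mul_gen_mul, neg_zero, add_zero]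
    · rw [h2.1, map_neg, dgen_smul, dgen_one, smul_zero, neg_zero, zero_add, mul_neg,
        mul_smul_comm, mul_one]
      module
    · rw [h3.1, dgen_smul, dgen_one, smul_zero, zero_add, zero_smul]
    · simp
  have hf : ∀ a b : ℤ, (dStarFrac 2 (stripForms CurveData.bRNum) a b : Grass p q)
      = if a = 2 ∧ b = 1 then th 0 - th 1 else if a = 1 ∧ b = 2 then th 1 - th 0 else 0 := by
    intro a b
    have h0 : (th 0 * (th 0 * th 1) : Grass p q) = 0 := gen_mul_gen_mul _ _
    rw [dStarFrac, mulDiag, hd, hd, hh]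
    by_cases hab : a + b = 3
    · obtain rfl : b = 3 - a := by omega
      by_cases ha : 1 ≤ a ∧ a ≤ 3
      · obtain ⟨ha1, ha2⟩ := ha
        interval_cases a
        all_goals norm_num [h0]
        · rw [two_mul]; module
        · abel
        · rw [two_mul]; module
      · simp [show ¬ a - 1 = 1 by omega, show ¬ a = 1 by omega, show ¬ a - 1 = 2 by omega,
          show ¬ a = 2 by omega, show ¬ a - 1 = 0 by omega]
    · simp [show ¬ (a - 1 = 1 ∧ b = 1) by omega, show ¬ (a - 1 = 2 ∧ b = 0) by omega,
        show ¬ (a = 1 ∧ b - 1 = 1) by omega, show ¬ (a = 2 ∧ b - 1 = 0) by omega,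
        show ¬ (a - 1 = 0 ∧ b = 2) by omega, show ¬ (a = 2 ∧ b = 1) by omega,
        show ¬ (a = 1 ∧ b = 2) by omega]
  rw [casimir, restrictPos_eq, restrictNeg_eq]
  simp only [hf]
  split_ifs with hN
  · subst hN
    rw [finsum_eq_sum_of_support_subset (s := {1, 2}), finsum_eq_sum_of_support_subset (s := {1, 2})]
    · norm_num
      simp only [substPos_th_zero, substPos_th_one, substNeg_th_zero, substNeg_th_one]
      module
    · intro a ha
      by_contra h
      simp at h
      refine ha ?_
      simp [h]
    · intro a ha
      by_contra h
      simp at h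
      refine ha ?_
      simp [h]
  · have h1 : ∀ a : ℤ, ¬ (a = 2 ∧ N + ((2 : ℕ) + 1) - a = 1) := fun a => by omega
    have h2 : ∀ a : ℤ, ¬ (a = 1 ∧ N + ((2 : ℕ) + 1) - a = 2) := fun a => by omega
    simp only [h1, h2, if_false, map_zero, smul_zero, finsum_zero, sub_zero]

/-- The Casimir of a regular bidifferential in terms of its components. -/
theorem casimir_components {T : Bool → Bool → ℤ → ℤ → Grass p q} {f : ℤ → ℤ → Grass p q}
    (hT : ∀ ε δ, Bounded (T ε δ)) (hT' : ∀ ε δ a b, ArgFree (T ε δ a b))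
    (hf : ∀ a b, f a b = ∑ ε : Bool, ∑ δ : Bool, (-1) ^ (ε.toNat * δ.toNat)
      * (basisForm ε 0 * basisForm δ 1) * T ε δ a b) (N : ℤ) :
    casimir ⟨0, f⟩ N = if Even N then
      th 0 * ∑ᶠ a : ℤ, (-1 : ℂ) ^ a • (T false false a (N - a) - a • T true true a (N - a))
      else ∑ᶠ a : ℤ, (-1 : ℂ) ^ a • T false true a (N - a) := by
  have hz : ∀ ε δ a b, dgen (.theta 0) (T ε δ a b) = 0 ∧ dgen (.dtheta 0) (T ε δ a b) = 0
      ∧ dgen (.dtheta 1) (T ε δ a b) = 0 := fun ε δ a b =>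
    ⟨(hT' ε δ a b).dgen (by simp), (hT' ε δ a b).dgen (by simp), (hT' ε δ a b).dgen (by simp)⟩
  have hfB : Bounded f := by
    have h := fun ε δ => (hT ε δ).map (fun _ _ x => (-1) ^ (ε.toNat * δ.toNat)
      * (basisForm ε 0 * basisForm δ 1) * x) fun _ _ => mul_zero _
    have := ((h true true).add (h true false)).add ((h false true).add (h false false))
    rw [show f = _ from funext fun a => funext fun b => hf a b]
    simpa only [Fintype.sum_bool] using this
  have hD : ∀ a b, dStar (stripForms f) a b = -(th 1 * T false false a b) - T false true a b
      + a • (th 0 * (th 1 * T true false a b) - th 0 * T true true a b) := by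
    intro a b
    have hs : stripForms f a b = -(th 0 * (th 1 * T false false a b)) - th 0 * T false true a b
        + th 1 * T true false a b - T true true a b := by
      rw [stripForms, hf]
      simp only [Fintype.sum_bool, basisForm, cond, mul_assoc, Bool.toNat_true, Bool.toNat_false,
        mul_zero, mul_one, pow_zero, pow_one, one_mul, neg_mul, dth, th]
      simp (disch := simp) only [map_add, map_neg, dgen_gen_mul_self, dgen_gen_mul_of_ne, hz,
        mul_zero, neg_zero, sub_zero]
      abel
    rw [dStar, hs]
    simp (disch := simp) only [th, map_add, map_sub, map_neg, dgen_gen_mul_self, dgen_gen_mul_of_ne,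
      hz, mul_zero, neg_zero, sub_zero, add_zero, mul_add, mul_sub, mul_neg, gen_mul_gen_mul, zero_add,
      sub_self]
  have hF : dStarFrac 0 (stripForms f) = mulDiag (dStar (stripForms f)) := by
    funext a b
    rw [dStarFrac, zero_smul, sub_zero]
  -- With no denominator initially, `D^*` is represented over `z_0 - z_1`; the values `±2` of the
  -- extra factor cancel the constants in `casimir`.
  have hC : casimir ⟨0, f⟩ N = (2⁻¹ : ℂ) • (restrictPos (dStar (stripForms f)) N
      - restrictNeg (dStar (stripForms f)) N) := by
    simp only [casimir, hF, Nat.cast_zero, zero_add]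
    rw [restrictPos_mulDiag hfB.stripForms.dStar, restrictNeg_mulDiag hfB.stripForms.dStar]
    congr 1
    module
  have hP : restrictPos (dStar (stripForms f)) N = ∑ᶠ a : ℤ, (-1 : ℂ) ^ (N - a) •
      (th 0 * T false false a (N - a) - T false true a (N - a)
        - a • (th 0 * T true true a (N - a))) := by
    rw [restrictPos_eq]
    refine finsum_congr fun a => ?_
    congr 1
    -- The `[dθ_0][dz_1]` component disappears because it is left with `θ_0 θ_1`, which restricts to
    -- a multiple of `θ_0² = 0`.
    have h1 : th 0 * (th 0 * T true false a (N - a)) = 0 := gen_mul_gen_mul _ _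
    rw [hD]
    simp only [map_add, map_sub, map_neg, map_mul, map_zsmul, (hT' _ _ _ _).substPos,
      substPos_th_zero, substPos_th_one, neg_mul, mul_neg, h1]
    module
  have hM : restrictNeg (dStar (stripForms f)) N = ∑ᶠ a : ℤ, (-1 : ℂ) ^ a •
      (-(th 0 * T false false a (N - a)) - T false true a (N - a)
        + a • (th 0 * T true true a (N - a))) := by
    rw [restrictNeg_eq]
    refine finsum_congr fun a => ?_
    congr 1
    have h1 : th 0 * (th 0 * T true false a (N - a)) = 0 := gen_mul_gen_mul _ _
    rw [hD]
    simp only [map_add, map_sub, map_neg, map_mul, map_zsmul, (hT' _ _ _ _).substNeg,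
      substNeg_th_zero, substNeg_th_one, neg_mul, h1]
    module
  have hB : Bounded fun a b => T false false a b - a • T true true a b := by
    have := (hT false false).add ((hT true true).map (fun a _ x => -(a • x)) fun _ _ => by simp)
    simpa only [← sub_eq_add_neg] using this
  have h1 : (Function.support fun a : ℤ => (-1 : ℂ) ^ (N - a) •
      (th 0 * T false false a (N - a) - T false true a (N - a)
        - a • (th 0 * T true true a (N - a)))).Finite := by
    refine (((hT false false).finite N (fun _ x => x) fun _ => rfl).union
      (((hT false true).finite N (fun _ x => x) fun _ => rfl).union
      ((hT true true).finite N (fun _ x => x) fun _ => rfl))).subset fun a ha => ?_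
    by_contra h
    simp only [Set.mem_union, Function.mem_support, not_or, not_not] at h
    exact ha (by simp only [h.1, h.2.1, h.2.2]; simp)
  have h2 : (Function.support fun a : ℤ => (-1 : ℂ) ^ a •
      (-(th 0 * T false false a (N - a)) - T false true a (N - a)
        + a • (th 0 * T true true a (N - a)))).Finite := by
    refine (((hT false false).finite N (fun _ x => x) fun _ => rfl).union
      (((hT false true).finite N (fun _ x => x) fun _ => rfl).union
      ((hT true true).finite N (fun _ x => x) fun _ => rfl))).subset fun a ha => ?_
    by_contra h
    simp only [Set.mem_union, Function.mem_support, not_or, not_not] at h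
    exact ha (by simp only [h.1, h.2.1, h.2.2]; simp)
  have hs : ∀ a : ℤ, (-1 : ℂ) ^ (N - a) = (-1) ^ N * (-1) ^ a := fun a => by
    rw [zpow_sub₀ (by norm_num), div_eq_mul_inv, ← inv_zpow, inv_neg, inv_one]
  rw [hC, hP, hM, ← finsum_sub_distrib h1 h2, smul_finsum]
  -- The two restrictions carry the weights `(-1)^(N-a)` and `(-1)^a`. Hence their difference
  -- doubles the terms with `θ` for even `N` and those without `θ` for odd `N`.
  split_ifs with hN
  · rw [mul_finsum' _ _ (hB.finite N (fun a x => (-1 : ℂ) ^ a • x) fun a => smul_zero _)]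
    refine finsum_congr fun a => ?_
    rw [hs, hN.neg_one_zpow, mul_smul_comm, mul_sub, mul_smul_comm]
    module
  · refine finsum_congr fun a => ?_
    rw [hs, (Int.not_even_iff_odd.1 hN).neg_one_zpow]
    module

theorem ArgFree.mul {x y : Grass p q} (hx : ArgFree x) (hy : ArgFree y) : ArgFree (x * y) := by
  rw [ArgFree, map_mul, hx, hy]

theorem ArgFree.add {x y : Grass p q} (hx : ArgFree x) (hy : ArgFree y) : ArgFree (x + y) := by
  rw [ArgFree, map_add, hx, hy]

theorem argFree_th (j : ℕ) : ArgFree (th (j + 2) : Grass p q) := substOdd_gen _ _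

theorem argFree_dth (j : ℕ) : ArgFree (dth (j + 2) : Grass p q) := substOdd_gen _ _

theorem SArgFree.evalDer {cs : List (Idx → Grass p q)} (hcs : ∀ c ∈ cs, ∀ i, ArgFree (c i))
    {f : SuperPoly p q} (hf : SArgFree f) : ArgFree (evalDer cs f) := by
  rw [evalDer_apply]
  refine SArgFree.augment ?_
  induction cs with
  | nil => exact hf
  | cons c cs ih =>
    rw [List.foldr_cons]
    exact SArgFree.der (hcs c List.mem_cons_self) (ih fun c hc => hcs c (List.mem_cons_of_mem _ hc))

/-! ### Extraction of coefficients with the spectator fields -/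

namespace CurveData

/-- The vector fields `ad_{ħ⁻¹ 𝒥(z_k)}` of the spectators. -/
def spectatorForms (S : CurveData p q) {n : ℕ} (e : Fin n → ℤ) : List (Idx → Grass p q) :=
  List.ofFn fun k => S.argForm (spectator k) (e k)

theorem extract_eq (S : CurveData p q) (g n : ℕ) (e : Fin n → ℤ) (f : HSeries p q) :
    S.extract g n e f = evalDer (S.spectatorForms e) (PowerSeries.coeff (2 * g + n) f) := by
  rw [extract, evalDer_apply, spectatorForms, List.ofFn_eq_map, List.foldr_map]
  rfl

theorem extract_smul (S : CurveData p q) (g n : ℕ) (e : Fin n → ℤ) (a : ℂ) (f : HSeries p q) :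
    S.extract g n e (a • f) = a • S.extract g n e f := by
  rw [extract_eq, extract_eq, ← evalDer_smul]
  rfl

theorem extract_neg (S : CurveData p q) (g n : ℕ) (e : Fin n → ℤ) (f : HSeries p q) :
    S.extract g n e (-f) = -S.extract g n e f := by
  rw [extract_eq, extract_eq, map_neg, map_neg]

theorem extract_zero (S : CurveData p q) (g n : ℕ) (e : Fin n → ℤ) :
    S.extract g n e (0 : HSeries p q) = 0 := by
  rw [extract_eq, map_zero, map_zero]

theorem argFree_spectatorForms (S : CurveData p q) {n : ℕ} (e : Fin n → ℤ) :
    ∀ c ∈ S.spectatorForms e, ∀ i, ArgFree (c i) := fun c h i => by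
  obtain ⟨k, rfl⟩ := (List.mem_ofFn' _ _).1 h
  exact (((argFree_dth _).mul (argFree_th _)).mul (argFree_ofBase _)).add
    ((argFree_dth _).mul (argFree_ofBase _))

theorem spar_cre {S : CurveData p q} {s : ℤ} (hS : S.IsLocalSuperSpectralCurve s) (ε : Bool)
    (N : ℤ) : SPar ε.toNat (S.field ε N).cre := by
  have h0 : SPar 1 (creG 0 : SuperPoly p q) := (spar_coord (.fer 0)).smul _
  rw [cre_field hS]
  refine SPar.add ?_ (((spar_cst ((isForm_frm hS ε N).par _)).mul h0).congr ?_)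
  · split_ifs with h
    · obtain ⟨k, rfl⟩ := Int.eq_succ_of_zero_lt h
      cases ε
      exacts [(spar_coord _).nsmul _, spar_coord (.fer (k + 1))]
    · exact SPar.zero _
  · simp only [Idx.parity]; omega

theorem sArgFree_cre {S : CurveData p q} {s : ℤ} (hS : S.IsLocalSuperSpectralCurve s) (ε : Bool)
    (N : ℤ) : SArgFree (S.field ε N).cre := by
  have h0 : SArgFree (creG 0 : SuperPoly p q) := (sArgFree_coord (.fer 0)).smul _
  rw [cre_field hS]
  refine SArgFree.add ?_ ((sArgFree_cst (argFree_frm S _ _ _)).mul h0)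
  split_ifs with h
  · obtain ⟨k, rfl⟩ := Int.eq_succ_of_zero_lt h
    cases ε
    · have := (sArgFree_coord (p := p) (q := q) (.bos k.succPNat)).smul ((k + 1 : ℕ) : ℂ)
      rw [Nat.cast_smul_eq_nsmul] at this
      exact this
    · exact sArgFree_coord (.fer (k + 1))
  · exact SArgFree.zero

theorem spar_oneZ {S : CurveData p q} {s : ℤ} (hS : S.IsLocalSuperSpectralCurve s)
    {F : FCoeffs p q} (hF : S.IsPartitionFunction s F) (ε : Bool) (N : ℤ) (d : ℕ) :
    SPar ε.toNat (PowerSeries.coeff d (S.oneZ F ε N)) := by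
  cases d with
  | zero =>
    have h := (isField_field hS ε N).par_c
    rw [field_const] at h
    rw [coeff_zero_oneZ]
    exact spar_cst (isPar_ofBase _ h)
  | succ d =>
    rw [coeff_succ_oneZ hS]
    refine SPar.add ?_ ((SPar.der (isForm_frm hS ε N) (spar_logZ hF.parity d)).congr rfl)
    split_ifs
    exacts [spar_cre hS ε N, SPar.zero _]

theorem sArgFree_oneZ {S : CurveData p q} {s : ℤ} (hS : S.IsLocalSuperSpectralCurve s)
    (F : FCoeffs p q) (ε : Bool) (N : ℤ) (d : ℕ) :
    SArgFree (PowerSeries.coeff d (S.oneZ F ε N)) := by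
  cases d with
  | zero =>
    rw [coeff_zero_oneZ]
    exact sArgFree_cst (argFree_ofBase _)
  | succ d =>
    rw [coeff_succ_oneZ hS]
    refine SArgFree.add ?_ (SArgFree.der (argFree_frm S ε N) (sArgFree_logZ F d))
    split_ifs
    exacts [sArgFree_cre hS ε N, SArgFree.zero]

/-! ### The linear loop equations -/

theorem tJ_one {S : CurveData p q} {s : ℤ} (hS : S.IsLocalSuperSpectralCurve s)
    {F : FCoeffs p q} (hF : S.IsPartitionFunction s F) {k N : ℤ} (hk : k = -N) :
    S.tJ F k 1 = S.oneZ F false N := by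
  subst hk
  exact conjZ_one (isField_field hS false N) (spar_logZ hF.parity)

theorem tG_one {S : CurveData p q} {s : ℤ} (hS : S.IsLocalSuperSpectralCurve s)
    {F : FCoeffs p q} (hF : S.IsPartitionFunction s F) {k N : ℤ} (hk : k = -N) :
    S.tG F k 1 = S.oneZ F true N := by
  subst hk
  exact conjZ_one (isField_field hS true N) (spar_logZ hF.parity)

/-- The one-point values `Z⁻¹ X Z`. -/
def onePoint (S : CurveData p q) (F : FCoeffs p q) (g n : ℕ) (e : Fin n → ℤ) (ε : Bool) (N : ℤ) :
    Grass p q := S.extract g n e (S.oneZ F ε N)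

theorem argFree_onePoint {S : CurveData p q} {s : ℤ} (hS : S.IsLocalSuperSpectralCurve s)
    (F : FCoeffs p q) (g n : ℕ) (e : Fin n → ℤ) (ε : Bool) (N : ℤ) :
    ArgFree (S.onePoint F g n e ε N) := by
  rw [onePoint, extract_eq]
  exact SArgFree.evalDer (S.argFree_spectatorForms e) (sArgFree_oneZ hS F ε N _)

theorem omegaOne_eq {S : CurveData p q} {s : ℤ} (hS : S.IsLocalSuperSpectralCurve s)
    {F : FCoeffs p q} (hF : S.IsPartitionFunction s F) (g n : ℕ) (e : Fin n → ℤ) (N : ℤ) :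
    S.omegaOne F g n e N = dth 0 * S.onePoint F g n e true N
      + dth 0 * th 0 * S.onePoint F g n e false N := by
  rw [omegaOne, omega_eq hS hF, Fintype.sum_bool, onePoint, onePoint, extract_eq, extract_eq]
  rfl

/-- The substitution `θ_0 ↦ -θ_0`, `[dθ_0] ↦ -[dθ_0]`. -/
def substSigma : Grass p q →ₐ[EvenParams p] Grass p q :=
  substOdd fun v => match v with
    | .theta 0 => -Finsupp.single (.theta 0) 1
    | .dtheta 0 => -Finsupp.single (.dtheta 0) 1
    | v => Finsupp.single v 1

theorem sigmaPull_eq (f : ℤ → Grass p q) (N : ℤ) :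
    sigmaPull f N = (-1 : ℂ) ^ N • substSigma (f N) := rfl

theorem substSigma_th : substSigma (th 0 : Grass p q) = -th 0 :=
  (substOdd_gen _ _).trans (map_neg _ _)

theorem substSigma_dth : substSigma (dth 0 : Grass p q) = -dth 0 :=
  (substOdd_gen _ _).trans (map_neg _ _)

theorem substSigma_argFree {x : Grass p q} (hx : ArgFree x) : substSigma x = x :=
  hx.substOdd _ fun v h0 _ h1 _ => by
    rcases v with i | k | (_ | j) | (_ | j) <;>
      first | rfl | exact absurd rfl h0 | exact absurd rfl h1

/-- The product `[dθ]θ` is invariant under `σ` and `[dθ]` changes sign, in addition to the sign of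
`z^N`. -/
theorem sigmaPull_oneForm {f : ℤ → Grass p q} {a b : Grass p q} (ha : ArgFree a) (hb : ArgFree b)
    (N : ℤ) (hf : f N = dth 0 * a + dth 0 * th 0 * b) :
    sigmaPull f N = (-1 : ℂ) ^ N • (dth 0 * th 0 * b - dth 0 * a) := by
  rw [sigmaPull_eq, hf, map_add, map_mul, map_mul, map_mul, substSigma_argFree ha,
    substSigma_argFree hb, substSigma_th, substSigma_dth]
  noncomm_ring

/-- Adding the `σ`-image doubles the `[dz]`-part at even exponents and the `[dθ]`-part at odd ones,
and cancels the rest. The factor 2 on the other side is `√2·√2`, from `[dφ] = √2 z[dθ]` together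
with the `√2` of either `Γ` or `φ`. -/
theorem pullback_E1 {S : CurveData p q} {s : ℤ} (hS : S.IsLocalSuperSpectralCurve s)
    {F : FCoeffs p q} (hF : S.IsPartitionFunction s F) (g n : ℕ) (e : Fin n → ℤ) (N : ℤ) :
    dth 0 * (S.E1 F g n e).pullback 1 N
      = S.omegaOne F g n e N + sigmaPull (S.omegaOne F g n e) N := by
  have h2 : (Real.sqrt 2 : ℂ) * Real.sqrt 2 = 2 := by
    rw [← Complex.ofReal_mul, Real.mul_self_sqrt (by norm_num)]; norm_num
  rw [sigmaPull_oneForm (argFree_onePoint hS F g n e true N) (argFree_onePoint hS F g n e false N)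
    N (omegaOne_eq hS hF g n e N), omegaOne_eq hS hF, BaseForm.pullback]
  split_ifs with h
  · have hN : Odd N := by
      have := h.add_odd odd_one
      simpa using this
    simp only [E1, G1]
    rw [tG_one hS hF (N := N) (by push_cast; obtain ⟨k, rfl⟩ := hN; omega), extract_smul, smul_smul,
      pow_one, h2, hN.neg_one_zpow, mul_smul_comm, onePoint, onePoint]
    module
  · have hN : Even N := by
      rw [Int.not_even_iff_odd] at h
      have := h.add_odd odd_one
      simpa using this
    simp only [E1, G1]
    rw [tJ_one hS hF (N := N) (by push_cast; obtain ⟨k, rfl⟩ := hN; omega), pow_succ, pow_one, h2,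
      hN.neg_one_zpow, mul_smul_comm, onePoint, onePoint, mul_assoc]
    module

/-- The local linear condition says that twice the coefficient vanishes. The odd generators in front
of it are stripped by left derivatives. -/
theorem linear_eq_zero {S : CurveData p q} {s : ℤ} (hS : S.IsLocalSuperSpectralCurve s) (ε : Bool)
    {N : ℤ} (hN : N < 1) (hN' : cond ε (Odd N) (Even N)) :
    (ofBase (cond ε (S.τ N) (S.t N)) : Grass p q) = 0 := by
  have h := hS.linear N hN
  have e : ∀ N, S.omega01.coeff 0 N = dth 0 * ofBase (S.τ N) + dth 0 * th 0 * ofBase (S.t N) :=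
    fun N => add_comm _ _
  rw [sigmaPull_oneForm (argFree_ofBase (S.τ N)) (argFree_ofBase (S.t N)) N (e N), e] at h
  have hz : ∀ r : BaseRing p q, dgen (.theta 0) (ofBase r) = 0 ∧ dgen (.dtheta 0) (ofBase r) = 0 :=
    fun r => ⟨(argFree_ofBase r).dgen (by simp), (argFree_ofBase r).dgen (by simp)⟩
  cases ε
  · rw [Even.neg_one_zpow (by exact hN')] at h
    have h' : (2 : ℂ) • (dth 0 * (th 0 * ofBase (S.t N))) = 0 := by
      rw [← h, mul_assoc]; module
    have h1 := congrArg (fun x => dgen (.theta 0) (dgen (.dtheta 0) x))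
      ((smul_eq_zero.1 h').resolve_left two_ne_zero)
    simp (disch := simp) only [dth, th, dgen_gen_mul_self, dgen_gen_mul_of_ne, hz, mul_zero,
      neg_zero, sub_zero, map_zero] at h1
    exact h1
  · rw [Odd.neg_one_zpow (by exact hN')] at h
    have h' : (2 : ℂ) • (dth 0 * ofBase (S.τ N)) = 0 := by
      rw [← h]; module
    have h1 := congrArg (dgen (.dtheta 0)) ((smul_eq_zero.1 h').resolve_left two_ne_zero)
    simp only [dth, dgen_gen_mul_self, hz, mul_zero, sub_zero, map_zero] at h1
    exact h1

/-- For negative `N` conjugation only adds a constant, which the linear local condition removes. The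
conjugate is therefore the plain generator, known to annihilate `Z`. -/
theorem oneZ_of_neg {S : CurveData p q} {s : ℤ} (hS : S.IsLocalSuperSpectralCurve s)
    {F : FCoeffs p q} (hF : S.IsPartitionFunction s F) (ε : Bool) {N : ℤ} (hN : N < 0)
    (hN' : cond ε (Odd N) (Even N)) (h : conjZ F (baseMode ε N) 1 = 0) : S.oneZ F ε N = 0 := by
  have hb : (baseMode ε N : Mode p q).2.2 = 0 := by cases ε <;> rfl
  have hX : IsField ε.toNat (baseMode ε N : Mode p q) := by
    have := isField_field hS ε N
    rw [field_neg S ε hN] at this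
    exact ⟨this.par_J, this.par_G, hb ▸ HasParity.zero _, this.finite⟩
  have h0 := linear_eq_zero hS ε (N := N) (by omega) hN'
  rw [conjZ_one hX (spar_logZ hF.parity)] at h
  rw [oneZ, ← h, fieldZ, fieldZ, field_const, h0, hb, map_zero, field_neg S ε hN]
  rfl

/-- The mode `J_0` is zero; what conjugation adds are `t_0`, `B_{0k}` and `φ_{0k}`, all normalised
to zero. -/
theorem oneZ_false_zero {S : CurveData p q} {s : ℤ} (hS : S.IsLocalSuperSpectralCurve s)
    (F : FCoeffs p q) : S.oneZ F false 0 = 0 := by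
  have h0 : S.frm false 0 = 0 := by
    funext i
    rcases i with k | _ | k
    · simp [frm, xi, hS.B_zero, hS.phi_zero]
    · simp [frm, xi]
    · simp [frm, xi, hS.phi_zero]
  rw [oneZ, fieldZ, modeForm_field hS, cre_field hS, field_const, h0]
  have : mapH (der (0 : Idx → Grass p q)) (logZ F) = 0 := by
    ext1 d
    rw [coeff_mapH, map_zero]
    simp [der, cst_zero]
  rw [this]
  simp [hS.t_zero, cst_zero]

theorem isBigO_E1 {S : CurveData p q} {s : ℤ} (hS : S.IsLocalSuperSpectralCurve s)
    {F : FCoeffs p q} (hF : S.IsPartitionFunction s F) (g n : ℕ) (e : Fin n → ℤ) :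
    (S.E1 F g n e).IsBigO 0 := by
  intro m hm
  constructor
  · have h := hF.ann_Gamma (-m) (by omega)
    rw [show 2 * -m - 1 = -(2 * m + 1) by ring] at h
    simp only [E1, G1]
    rw [tG_one hS hF (N := 2 * m + 1) (by ring), oneZ_of_neg hS hF true (by omega) ⟨m, rfl⟩ h,
      smul_zero, extract_zero]
  · simp only [E1, G1]
    rw [tJ_one hS hF (N := 2 * m + 2) (by ring)]
    -- The exponent `m = -1` corresponds to `J_0`, which is not among the generators and is treated
    -- directly.
    rcases eq_or_ne m (-1) with rfl | hm'
    · rw [show (2 * -1 + 2 : ℤ) = 0 by norm_num, oneZ_false_zero hS, extract_zero]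
    · have h := hF.ann_J (-m - 1) (by omega)
      rw [show 2 * (-m - 1) = -(2 * m + 2) by ring] at h
      rw [oneZ_of_neg hS hF false (by omega) ⟨m + 1, by ring⟩ h, extract_zero]

end CurveData

/-- Vector fields supercommute. -/
theorem der_der_comm {ε δ : ℕ} {c c' : Idx → Grass p q} (hc : IsForm ε c) (hc' : IsForm δ c')
    (f : SuperPoly p q) : der c (der c' f) = (-1) ^ (ε * δ) * der c' (der c f) := by
  classical
  have h : ∀ {ε δ : ℕ} {c c' : Idx → Grass p q}, IsForm ε c → IsForm δ c' → ∀ s : Finset Idx,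
      (∀ i, pd i f ≠ 0 → i ∈ s) → der c (der c' f) = ∑ i ∈ s, ∑ k ∈ s,
        (-1) ^ ((i.parity + δ) * ε) * (cst (c' i) * (cst (c k) * pd k (pd i f))) := by
    intro ε δ c c' hc hc' s hs
    rw [der_eq_sum c' f s hs, der_sum]
    refine Finset.sum_congr rfl fun i _ => ?_
    rw [der_cst_mul hc (hc'.free i) (hc'.par i), der_eq_sum c (pd i f) s, Finset.mul_sum,
      Finset.mul_sum]
    -- A derivative of `∂f/∂x^i` can be nonzero only in the coordinates of `f`, so one finite set
    -- serves both orders of differentiation.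
    intro k hk
    refine hs k fun h => hk ?_
    rw [pd_comm, h, pd_zero, mul_zero]
  have hs : ∀ i, pd i f ≠ 0 → i ∈ (finite_pd f).toFinset := by simp
  rw [h hc hc' _ hs, h hc' hc _ hs, Finset.sum_comm, Finset.mul_sum]
  refine Finset.sum_congr rfl fun k _ => ?_
  rw [Finset.mul_sum]
  refine Finset.sum_congr rfl fun i _ => ?_
  have hsw : ∀ (m : ℕ) (x y : SuperPoly p q), x * ((-1) ^ m * y) = (-1) ^ m * (x * y) :=
    fun m x y => by rw [← mul_assoc, neg_one_pow_comm, mul_assoc]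
  rw [pd_comm k i, hsw, hsw, ← mul_assoc (cst (c' i)),
    (spar_cst (hc'.par i)).comm' (spar_cst (hc.par k)), mul_assoc ((-1) ^ _) (cst (c k) * _),
    mul_assoc (cst (c k)), ← mul_assoc ((-1) ^ _), ← mul_assoc ((-1) ^ (ε * δ)), ← pow_add,
    ← pow_add, ← mul_assoc ((-1) ^ _), ← pow_add]
  congr 1
  refine neg_one_pow_congr ?_
  simp only [Nat.even_add, Nat.even_mul]
  tauto

/-! ### The two-point function and its finiteness -/

namespace CurveData

/-- The degree of a coordinate. -/
def idxDegree : Idx → ℤ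
  | .bos k => k
  | .fer k => k

/-- The form `ζ_i` has a single polar term, whose order is the degree of `i`. -/
theorem frm_eq_zero (S : CurveData p q) (ε : Bool) {N : ℤ} (hN : N < 0) {i : Idx}
    (hi : N ≠ -idxDegree i) : S.frm ε N i = 0 := by
  have h0 : ¬ 0 ≤ N := not_le.2 hN
  have h0' : ¬ 0 < N := not_lt.2 hN.le
  rcases i with k | _ | k
  · have : ¬ N = -(k : ℤ) := hi
    cases ε <;> simp [frm, xi, h0, this]
  · cases ε <;> simp [frm, xi, h0', hN.ne]
  · have : ¬ N = -((k : ℤ) + 1) := fun h => hi (by rw [h]; simp [idxDegree])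
    cases ε <;> simp only [frm, xi, h0, this, if_false, cond, map_zero]

/-- A polynomial in finitely many coordinates meets poles of bounded order. The bound is uniform
over all `g` involving no further coordinates, so it also applies after one differentiation. -/
theorem exists_der_frm_eq_zero (S : CurveData p q) (f : SuperPoly p q) :
    ∃ M : ℤ, ∀ N < M, ∀ ε g, (∀ i, pd i f = 0 → pd i g = 0) → der (S.frm ε N) g = 0 := by
  obtain ⟨K, hK⟩ := ((finite_pd f).image idxDegree).bddAbove
  refine ⟨min 0 (-K), fun N hN ε g hg => ?_⟩
  rw [der]
  refine (finsum_congr fun i => ?_).trans finsum_zero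
  by_cases h : pd i f = 0
  · rw [hg i h, mul_zero]
  · have := hK ⟨i, h, rfl⟩
    rw [frm_eq_zero S ε (by omega) (by omega), cst_zero, zero_mul]

/-- `(Z⁻¹ X Y Z) 1`, without the vacuum expectation value of `X Y`. -/
def twoZ (S : CurveData p q) (F : FCoeffs p q) (ε δ : Bool) (a b : ℤ) : HSeries p q :=
  PowerSeries.X ^ 2 * (PowerSeries.C (cst (S.regPart ε δ a b))
    + mapH (der (S.frm ε a)) (mapH (der (S.frm δ b)) (logZ F)))
    + S.oneZ F ε a * S.oneZ F δ b

/-- Separating the vacuum value isolates precisely what normal ordering subtracts; the remainder has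
bounded poles and can be restricted to `z_1 = -z_0`. -/
theorem conjZ_conjZ_field {S : CurveData p q} {s : ℤ} (hS : S.IsLocalSuperSpectralCurve s)
    {F : FCoeffs p q} (hF : S.IsPartitionFunction s F) (ε δ : Bool) (a b : ℤ) :
    conjZ F (S.field ε a) (conjZ F (S.field δ b) 1)
      = PowerSeries.X ^ 2 * PowerSeries.C (cst (vev ε δ a b)) + S.twoZ F ε δ a b := by
  rw [conjZ_conjZ_one (isField_field hS ε a) (isField_field hS δ b) (spar_logZ hF.parity),
    modeForm_field hS, modeForm_field hS, der_cre hS, cst_add, map_add, twoZ, oneZ, oneZ]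
  simp only [mul_add, add_assoc]

theorem exists_coeff_oneZ_eq_zero {S : CurveData p q} {s : ℤ} (hS : S.IsLocalSuperSpectralCurve s)
    (F : FCoeffs p q) (d : ℕ) :
    ∃ M : ℤ, ∀ N < M, ∀ ε, PowerSeries.coeff d (S.oneZ F ε N) = 0 := by
  cases d with
  | zero =>
    obtain ⟨M, hM⟩ := hS.meromorphic
    refine ⟨M, fun N hN ε => ?_⟩
    rw [coeff_zero_oneZ, (hM N hN).1, (hM N hN).2]
    cases ε <;> simp [cst_zero]
  | succ d =>
    obtain ⟨M, hM⟩ := S.exists_der_frm_eq_zero (PowerSeries.coeff d (logZ F))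
    refine ⟨min M 0, fun N hN ε => ?_⟩
    have h0 : N ≠ -idxDegree (.fer 0) := by simp only [idxDegree]; omega
    have h1 : N < 0 := by omega
    rw [coeff_succ_oneZ hS, hM N (by omega) ε _ fun _ h => h, cre_field hS, if_neg h1.not_gt,
      frm_eq_zero S ε h1 h0]
    simp [cst_zero]

theorem exists_coeff_der_der_eq_zero {S : CurveData p q} {s : ℤ}
    (hS : S.IsLocalSuperSpectralCurve s) (F : FCoeffs p q) (d : ℕ) :
    ∃ M : ℤ, ∀ ε δ a b, a < M ∨ b < M → PowerSeries.coeff d (PowerSeries.X ^ 2 *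
      (PowerSeries.C (cst (S.regPart ε δ a b))
        + mapH (der (S.frm ε a)) (mapH (der (S.frm δ b)) (logZ F)))) = 0 := by
  obtain ⟨M, hM⟩ := S.exists_der_frm_eq_zero (PowerSeries.coeff (d - 2) (logZ F))
  refine ⟨min M 0, fun ε δ a b h => ?_⟩
  have h0 : S.regPart ε δ a b = 0 := by rw [regPart, if_neg (by omega)]
  rw [PowerSeries.coeff_X_pow_mul']
  split_ifs
  · rw [h0, cst_zero, map_zero, zero_add, coeff_mapH, coeff_mapH]
    by_cases hb : b < M
    · rw [hM b hb δ _ fun _ h => h, der_zero]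
    · exact hM a (by omega) ε _ fun i hi => pd_der_eq_zero (isForm_frm hS δ b).free hi
  · rfl

theorem exists_coeff_oneZ_mul_eq_zero {S : CurveData p q} {s : ℤ}
    (hS : S.IsLocalSuperSpectralCurve s) (F : FCoeffs p q) (d : ℕ) :
    ∃ M : ℤ, ∀ ε δ a b, a < M ∨ b < M →
      PowerSeries.coeff d (S.oneZ F ε a * S.oneZ F δ b) = 0 := by
  choose M hM using exists_coeff_oneZ_eq_zero hS F
  -- The pole order depends on the power of `ħ`; only powers up to `d` enter, so a common bound
  -- exists.
  obtain ⟨K, hK⟩ := ((Finset.range (d + 1)).image M).finite_toSet.bddBelow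
  have hK' : ∀ k ≤ d, K ≤ M k := fun k hk => hK (by
    simp only [Finset.coe_image, Finset.coe_range]
    exact ⟨k, Nat.lt_succ_of_le hk, rfl⟩)
  refine ⟨K, fun ε δ a b h => ?_⟩
  rw [PowerSeries.coeff_mul]
  refine Finset.sum_eq_zero fun k hk => ?_
  have hk := Finset.HasAntidiagonal.mem_antidiagonal.1 hk
  rcases h with h | h
  · rw [hM k.1 a (h.trans_le (hK' _ (by omega))), zero_mul]
  · rw [hM k.2 b (h.trans_le (hK' _ (by omega))), mul_zero]

/-- The contribution of the disconnected part of the two-point function. -/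
def splitPart (S : CurveData p q) (F : FCoeffs p q) (g n : ℕ) (e : Fin n → ℤ) (ε δ : Bool)
    (a b : ℤ) : Grass p q := S.extract g n e (S.oneZ F ε a * S.oneZ F δ b)

/-- The contribution of the connected part of the two-point function. -/
def connPart (S : CurveData p q) (F : FCoeffs p q) (g n : ℕ) (e : Fin n → ℤ) (ε δ : Bool)
    (a b : ℤ) : Grass p q :=
  S.extract g n e (PowerSeries.X ^ 2 * (PowerSeries.C (cst (S.regPart ε δ a b))
    + mapH (der (S.frm ε a)) (mapH (der (S.frm δ b)) (logZ F))))

theorem bounded_splitPart {S : CurveData p q} {s : ℤ} (hS : S.IsLocalSuperSpectralCurve s)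
    (F : FCoeffs p q) (g n : ℕ) (e : Fin n → ℤ) (ε δ : Bool) :
    Bounded (S.splitPart F g n e ε δ) := by
  obtain ⟨M, hM⟩ := exists_coeff_oneZ_mul_eq_zero hS F (2 * g + n)
  exact ⟨M, fun a b h => by rw [splitPart, extract_eq, hM _ _ _ _ h, map_zero]⟩

theorem bounded_connPart {S : CurveData p q} {s : ℤ} (hS : S.IsLocalSuperSpectralCurve s)
    (F : FCoeffs p q) (g n : ℕ) (e : Fin n → ℤ) (ε δ : Bool) :
    Bounded (S.connPart F g n e ε δ) := by
  obtain ⟨M, hM⟩ := exists_coeff_der_der_eq_zero hS F (2 * g + n)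
  exact ⟨M, fun a b h => by rw [connPart, extract_eq, hM _ _ _ _ h, map_zero]⟩

theorem argFree_regPart (S : CurveData p q) (ε δ : Bool) (a b : ℤ) :
    ArgFree (S.regPart ε δ a b) := by
  have hs : ∀ (c : ℂ) (r : BaseRing p q), ArgFree (c • ofBase r) := fun c r => by
    rw [← ofBase_smul]; exact argFree_ofBase _
  rw [regPart]
  split_ifs
  · cases ε <;> cases δ
    exacts [argFree_ofBase _, hs _ _, hs _ _, by simp only [← neg_smul, hs]]
  · exact map_zero _

theorem argFree_connPart (S : CurveData p q) (F : FCoeffs p q) (g n : ℕ) (e : Fin n → ℤ)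
    (ε δ : Bool) (a b : ℤ) : ArgFree (S.connPart F g n e ε δ a b) := by
  rw [connPart, extract_eq, PowerSeries.coeff_X_pow_mul']
  refine SArgFree.evalDer (S.argFree_spectatorForms e) ?_
  split_ifs
  · rw [map_add, coeff_mapH, coeff_mapH, PowerSeries.coeff_C]
    refine SArgFree.add ?_ (SArgFree.der (argFree_frm S ε a)
      (SArgFree.der (argFree_frm S δ b) (sArgFree_logZ F _)))
    split_ifs
    exacts [sArgFree_cst (S.argFree_regPart _ _ _ _), SArgFree.zero]
  · exact SArgFree.zero

theorem argFree_splitPart {S : CurveData p q} {s : ℤ} (hS : S.IsLocalSuperSpectralCurve s)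
    (F : FCoeffs p q) (g n : ℕ) (e : Fin n → ℤ)
    (ε δ : Bool) (a b : ℤ) : ArgFree (S.splitPart F g n e ε δ a b) := by
  rw [splitPart, extract_eq, PowerSeries.coeff_mul]
  exact SArgFree.evalDer (S.argFree_spectatorForms e) (SArgFree.sum _ fun k _ =>
    (sArgFree_oneZ hS F _ _ _).mul (sArgFree_oneZ hS F _ _ _))

/-- Both factors are odd, and interchanging them also interchanges the two powers of `ħ` in the
Cauchy product. -/
theorem splitPart_antisymm {S : CurveData p q} {s : ℤ} (hS : S.IsLocalSuperSpectralCurve s)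
    {F : FCoeffs p q} (hF : S.IsPartitionFunction s F) (g n : ℕ) (e : Fin n → ℤ) (a b : ℤ) :
    S.splitPart F g n e true true a b = -S.splitPart F g n e true true b a := by
  rw [splitPart, splitPart, ← extract_neg]
  congr 1
  ext1 d
  rw [map_neg, PowerSeries.coeff_mul, PowerSeries.coeff_mul, ← Finset.sum_neg_distrib,
    ← Finset.sum_equiv (Equiv.prodComm ℕ ℕ)
    (s := Finset.HasAntidiagonal.antidiagonal d) (t := Finset.HasAntidiagonal.antidiagonal d)]
  · intro i; simp [add_comm]
  · intro i _
    rw [(spar_oneZ hS hF true b i.1).comm' (spar_oneZ hS hF true a i.2)]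
    simp

/-- The regular contraction is antisymmetric because `V` is, and the second derivative because odd
vector fields anticommute. -/
theorem connPart_antisymm {S : CurveData p q} {s : ℤ} (hS : S.IsLocalSuperSpectralCurve s)
    (F : FCoeffs p q) (g n : ℕ) (e : Fin n → ℤ) (a b : ℤ) :
    S.connPart F g n e true true a b = -S.connPart F g n e true true b a := by
  have hr : S.regPart true true a b = -S.regPart true true b a := by
    simp only [regPart, and_comm (a := 0 ≤ b)]
    by_cases h : 0 ≤ a ∧ 0 ≤ b
    · simp only [if_pos h]
      rw [hS.V_antisymm a.toNat, map_neg]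
      module
    · simp only [if_neg h, neg_zero]
  have hd : mapH (der (S.frm true a)) (mapH (der (S.frm true b)) (logZ F))
      = -mapH (der (S.frm true b)) (mapH (der (S.frm true a)) (logZ F)) := by
    ext1 d
    rw [map_neg, coeff_mapH, coeff_mapH, coeff_mapH, coeff_mapH,
      der_der_comm (isForm_frm hS true a) (isForm_frm hS true b)]
    simp
  rw [connPart, connPart, ← extract_neg, hr, hd, cst_neg, map_neg, ← neg_add, mul_neg]

end CurveData

/-! ### Disconnected and connected parts as correlators -/

namespace CurveData

/-- Moving the basis form of the argument `1` to the left past a coefficient of the first factor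
costs the Koszul sign appearing in the components of the Casimir. -/
theorem sum_mul_sum_basisForm {A B : Bool → Grass p q} (hA : ∀ ε, IsPar ε.toNat (A ε)) :
    (∑ ε : Bool, basisForm ε 0 * A ε) * ∑ δ : Bool, basisForm δ 1 * B δ
      = ∑ ε : Bool, ∑ δ : Bool, (-1) ^ (ε.toNat * δ.toNat)
        * (basisForm ε 0 * basisForm δ 1) * (A ε * B δ) := by
  rw [Finset.sum_mul_sum]
  refine Finset.sum_congr rfl fun ε _ => Finset.sum_congr rfl fun δ _ => ?_
  rw [mul_assoc, ← mul_assoc (A ε), (hA ε).comm' (isPar_basisForm δ 1), ← mul_assoc, ← mul_assoc,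
    neg_one_pow_comm]
  simp only [mul_assoc]

theorem omegaSub_eq {S : CurveData p q} {s : ℤ} (hS : S.IsLocalSuperSpectralCurve s)
    {F : FCoeffs p q} (hF : S.IsPartitionFunction s F) (g : ℕ) {n : ℕ} (e : Fin n → ℤ) (j : ℕ)
    (I : Finset (Fin n)) (N : ℤ) : S.omegaSub F g e j I N = ∑ ε : Bool, basisForm ε j *
      evalDer (subForms (fun k => S.argForm (spectator k) (e k)) I)
        (PowerSeries.coeff (2 * g + I.card) (S.oneZ F ε N)) :=
  omega_eq hS hF g I.card j N _ _

/-- The Leibniz rule distributes the spectators and the Cauchy product distributes the powers of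
`ħ`; each factor is a one-point value and hence a correlator. -/
theorem omegaSplit_eq {S : CurveData p q} {s : ℤ} (hS : S.IsLocalSuperSpectralCurve s)
    {F : FCoeffs p q} (hF : S.IsPartitionFunction s F) (g n : ℕ) (e : Fin n → ℤ) (a b : ℤ) :
    (S.omegaSplit F g n e).num a b = ∑ ε : Bool, ∑ δ : Bool, (-1) ^ (ε.toNat * δ.toNat)
      * (basisForm ε 0 * basisForm δ 1) * S.splitPart F g n e ε δ a b := by
  have hc := fun k => isForm_argForm hS (spectator (n := n) k) (e k)
  have hsub : ∀ I : Finset (Fin n), ∀ c ∈ subForms (fun k => S.argForm (spectator k) (e k)) I,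
      IsForm 0 c := fun I c h => by
    obtain ⟨k, rfl⟩ := (List.mem_ofFn' _ _).1 h
    exact hc _
  let Y : ℕ → Finset (Fin n) → ℕ → ℤ → Grass p q := fun j I d N => ∑ ε : Bool, basisForm ε j *
      evalDer (subForms (fun k => S.argForm (spectator k) (e k)) I)
        (PowerSeries.coeff d (S.oneZ F ε N))
  have hY0 : ∀ j I d N, (∀ h, d ≠ 2 * h + Finset.card I) → Y j I d N = 0 := fun j I d N h =>
    sum_evalDer_oneZ_eq_zero hS hF h j N _ _
  have hR : ∑ ε : Bool, ∑ δ : Bool, (-1) ^ (ε.toNat * δ.toNat)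
      * (basisForm ε 0 * basisForm δ 1) * S.splitPart F g n e ε δ a b
      = ∑ I : Finset (Fin n), ∑ d ∈ Finset.HasAntidiagonal.antidiagonal (2 * g + n),
        Y 0 I d.1 a * Y 1 Iᶜ d.2 b := by
    simp only [Y]
    have h1 := fun (I : Finset (Fin n)) (d : ℕ × ℕ) => sum_mul_sum_basisForm
      (A := fun ε => evalDer (subForms (fun k => S.argForm (spectator k) (e k)) I)
        (PowerSeries.coeff d.1 (S.oneZ F ε a)))
      (B := fun δ => evalDer (subForms (fun k => S.argForm (spectator k) (e k)) Iᶜ)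
        (PowerSeries.coeff d.2 (S.oneZ F δ b)))
      fun ε => SPar.evalDer (hsub I) (spar_oneZ hS hF ε a d.1)
    simp only [h1]
    have h2 : ∀ ε δ : Bool, S.splitPart F g n e ε δ a b = ∑ I : Finset (Fin n),
        ∑ d ∈ Finset.HasAntidiagonal.antidiagonal (2 * g + n),
          evalDer (subForms (fun k => S.argForm (spectator k) (e k)) I)
            (PowerSeries.coeff d.1 (S.oneZ F ε a))
          * evalDer (subForms (fun k => S.argForm (spectator k) (e k)) Iᶜ)
            (PowerSeries.coeff d.2 (S.oneZ F δ b)) := fun ε δ => by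
      rw [splitPart, extract_eq, PowerSeries.coeff_mul, map_sum, Finset.sum_comm]
      exact Finset.sum_congr rfl fun d _ => evalDer_mul hc _ _
    simp only [h2, Finset.mul_sum, Fintype.sum_bool, Finset.sum_add_distrib]
  rw [hR]
  simp only [omegaSplit, omegaSub_eq hS hF]
  rw [Finset.sum_comm]
  refine Finset.sum_congr rfl fun I _ => ?_
  have hI : I.card + Iᶜ.card = n := by
    rw [Finset.card_add_card_compl, Fintype.card_fin]
  -- A decomposition `g = g₁ + g₂` determines the powers `2g₁ + |I|` and `2g₂ + |J|`. Splittings of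
  -- `2g + n` not of this form contain a factor that corresponds to no genus.
  refine Finset.sum_of_injOn (fun h => (2 * h.1 + I.card, 2 * h.2 + Iᶜ.card)) ?_ ?_ ?_
    fun h _ => rfl
  · intro x _ y _ h
    simp only [Prod.mk.injEq] at h
    exact Prod.ext (by omega) (by omega)
  · intro x hx
    have hx := Finset.HasAntidiagonal.mem_antidiagonal.1 hx
    exact Finset.HasAntidiagonal.mem_antidiagonal.2 (by simp only; omega)
  · intro d hd hd'
    have hd := Finset.HasAntidiagonal.mem_antidiagonal.1 hd
    by_cases h1 : ∀ h, d.1 ≠ 2 * h + I.card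
    · rw [hY0 _ _ _ _ h1, zero_mul]
    · push Not at h1
      obtain ⟨h, hh⟩ := h1
      rw [hY0 1 _ _ _, mul_zero]
      intro h' hh'
      refine hd' ⟨(h, h'), Finset.HasAntidiagonal.mem_antidiagonal.2 (by simp only; omega), ?_⟩
      exact Prod.ext hh.symm hh'.symm

/-- The prefactor `ħ²` lowers the power to `2g + n - 2`, which belongs to `n + 2` arguments in genus
`g - 1`. The regular contraction, being constant, survives only without spectators and supplies `B -
B^R`; in genus 0 nothing remains. -/
theorem sum_connPart {S : CurveData p q} {s : ℤ} (hS : S.IsLocalSuperSpectralCurve s)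
    {F : FCoeffs p q} (hF : S.IsPartitionFunction s F) (g n : ℕ) (e : Fin n → ℤ) (a b : ℤ) :
    (∑ ε : Bool, ∑ δ : Bool, (-1) ^ (ε.toNat * δ.toNat)
      * (basisForm ε 0 * basisForm δ 1) * S.connPart F g n e ε δ a b)
      = match g with
        | 0 => 0
        | g + 1 => S.omegaF F g (n + 2) (Fin.cons 0 (Fin.cons 1 spectator))
            (Fin.cons a (Fin.cons b e)) + if g = 0 ∧ n = 0 then S.bReg 0 1 a b else 0 := by
  have hcs : ∀ c ∈ S.spectatorForms e, IsForm 0 c := isForm_of_mem_ofFn hS spectator e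
  have hD : ∀ d, ∑ ε : Bool, ∑ δ : Bool, (-1) ^ (ε.toNat * δ.toNat)
      * (basisForm ε 0 * basisForm δ 1) * evalDer (S.spectatorForms e)
        (der (S.frm ε a) (der (S.frm δ b) (PowerSeries.coeff d (logZ F))))
      = evalDer (S.spectatorForms e)
        (der (S.argForm 0 a) (der (S.argForm 1 b) (PowerSeries.coeff d (logZ F)))) := fun d => by
    rw [der_argForm, map_sum]
    refine Finset.sum_congr rfl fun ε _ => ?_
    rw [der_argForm, der_sum, Finset.mul_sum, map_sum]
    refine Finset.sum_congr rfl fun δ _ => ?_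
    rw [der_cst_mul (isForm_frm hS ε a) (varFree_basisForm _ _) (isPar_basisForm δ 1)]
    have : (-1 : SuperPoly p q) ^ (δ.toNat * ε.toNat) = cst ((-1) ^ (ε.toNat * δ.toNat)) := by
      rw [mul_comm]
      rcases Nat.even_or_odd (ε.toNat * δ.toNat) with h | h <;>
        simp [h.neg_one_pow, cst_one, cst_neg]
    rw [this, evalDer_cst_mul hcs (varFree_basisForm _ _), evalDer_cst_mul hcs,
      evalDer_cst_mul hcs (varFree_basisForm _ _), ← mul_assoc (basisForm ε 0), neg_one_pow_comm]
    · simp only [mul_assoc]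
    · rcases Nat.even_or_odd (ε.toNat * δ.toNat) with h | h <;> rw [h.neg_one_pow]
      exacts [VarFree.one, VarFree.one.neg]
  by_cases hd : 2 * g + n < 2
  · have h1 : ∀ ε δ, S.connPart F g n e ε δ a b = 0 := fun ε δ => by
      rw [connPart, extract_eq, PowerSeries.coeff_X_pow_mul', if_neg (by omega), map_zero]
    simp only [h1, mul_zero, Finset.sum_const_zero]
    match g, hd with
    | 0, _ => rfl
    | g + 1, hd => omega
  · obtain ⟨d, hd⟩ : ∃ d, 2 * g + n = d + 2 := ⟨2 * g + n - 2, by omega⟩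
    have h1 : ∀ ε δ, S.connPart F g n e ε δ a b = (if d = 0 then evalDer (S.spectatorForms e)
        (cst (S.regPart ε δ a b)) else 0) + evalDer (S.spectatorForms e)
        (der (S.frm ε a) (der (S.frm δ b) (PowerSeries.coeff d (logZ F)))) := fun ε δ => by
      rw [connPart, extract_eq, hd, PowerSeries.coeff_X_pow_mul, map_add, map_add, coeff_mapH,
        coeff_mapH, PowerSeries.coeff_C]
      split_ifs
      · rfl
      · rw [map_zero]
    simp only [h1, mul_add, Finset.sum_add_distrib, hD]
    match g, hd with
    | 0, hd =>
      have hn : S.spectatorForms e ≠ [] := by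
        rw [← List.length_pos_iff, spectatorForms, List.length_ofFn]; omega
      simp only [evalDer_cst hn (S.varFree_regPart _ _ _ _), ite_self, mul_zero,
        Finset.sum_const_zero, zero_add]
      rw [show ∀ f, der (S.argForm 0 a) (der (S.argForm 1 b) f)
        = [S.argForm 0 a, S.argForm 1 b].foldr der f from fun _ => rfl, ← evalDer_append,
        evalDer_coeff_logZ_eq_zero hF.symm]
      · simp only [List.mem_append, List.mem_cons, List.not_mem_nil, or_false]
        rintro c (h | rfl | rfl)
        exacts [hcs c h, isForm_argForm hS _ _, isForm_argForm hS _ _]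
      · intro g h
        simp [spectatorForms] at h
        omega
    | g + 1, hd =>
      obtain rfl : d = 2 * g + n := by omega
      rw [spectatorForms, evalDer_argForm_argForm_logZ hS hF, add_comm]
      congr 1
      by_cases h0 : g = 0 ∧ n = 0
      · obtain ⟨rfl, rfl⟩ := h0
        simp only [and_self, if_true, Nat.mul_zero, Nat.add_zero, List.ofFn_zero, evalDer_apply,
          List.foldr_nil, augment_cst (S.varFree_regPart _ _ _ _)]
        exact S.sum_basisForm_regPart' a b
      · have h0' : ¬ 2 * g + n = 0 := by omega
        simp only [h0, h0', if_false, mul_zero, Finset.sum_const_zero]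

end CurveData

/-! ### The Casimir of the quadratic expression -/

namespace CurveData

theorem bounded_bRNum : Bounded (bRNum (p := p) (q := q)) :=
  ⟨0, fun a b h => by
    rw [bRNum, if_neg (by omega), if_neg (by omega), if_neg (by omega)]⟩

/-- The contributions of all parts of the two-point function. -/
def twoPart (S : CurveData p q) (F : FCoeffs p q) (g n : ℕ) (e : Fin n → ℤ) (ε δ : Bool)
    (a b : ℤ) : Grass p q := S.connPart F g n e ε δ a b + S.splitPart F g n e ε δ a b

theorem bounded_twoPart {S : CurveData p q} {s : ℤ} (hS : S.IsLocalSuperSpectralCurve s)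
    (F : FCoeffs p q) (g n : ℕ) (e : Fin n → ℤ) (ε δ : Bool) : Bounded (S.twoPart F g n e ε δ) :=
  (bounded_connPart hS F g n e ε δ).add (bounded_splitPart hS F g n e ε δ)

theorem twoPart_eq (S : CurveData p q) (F : FCoeffs p q) (g n : ℕ) (e : Fin n → ℤ) (ε δ : Bool)
    (a b : ℤ) : S.twoPart F g n e ε δ a b = S.extract g n e (S.twoZ F ε δ a b) := by
  rw [twoPart, connPart, splitPart, extract_eq, extract_eq, extract_eq, ← map_add, ← map_add, twoZ]

/-- The double series with the components `T`. -/
def components (T : Bool → Bool → ℤ → ℤ → Grass p q) (a b : ℤ) : Grass p q :=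
  ∑ ε : Bool, ∑ δ : Bool, (-1) ^ (ε.toNat * δ.toNat) * (basisForm ε 0 * basisForm δ 1) * T ε δ a b

theorem bounded_components {T : Bool → Bool → ℤ → ℤ → Grass p q} (hT : ∀ ε δ, Bounded (T ε δ)) :
    Bounded (components T) := by
  have h := fun ε δ => (hT ε δ).map (fun _ _ x => (-1) ^ (ε.toNat * δ.toNat)
    * (basisForm ε 0 * basisForm δ 1) * x) fun _ _ => mul_zero _
  have h' := ((h true true).add (h true false)).add ((h false true).add (h false false))
  obtain ⟨M, hM⟩ := h'
  refine ⟨M, fun a b hab => ?_⟩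
  rw [components, Fintype.sum_bool, Fintype.sum_bool, Fintype.sum_bool]
  exact hM a b hab

theorem casimir_zero (m : ℕ) (N : ℤ) : casimir (⟨m, fun _ _ => 0⟩ : Bidiff p q) N = 0 := by
  simp [casimir, dStarFrac, dStar, mulDiag, stripForms, restrictPos_eq, restrictNeg_eq]

/-- The connected part agrees with `ω_{g-1,n+2}` except for `B^R` in `ω_{0,2}`, whose Casimir is the
correction term. -/
theorem casimir_omegaTwoPred {S : CurveData p q} {s : ℤ} (hS : S.IsLocalSuperSpectralCurve s)
    {F : FCoeffs p q} (hF : S.IsPartitionFunction s F) (g n : ℕ) (e : Fin n → ℤ) (N : ℤ) :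
    casimir (S.omegaTwoPred F g n e) N = casimir ⟨0, components (S.connPart F g n e)⟩ N
      + if g = 1 ∧ n = 0 ∧ N = 0 then -((2⁻¹ : ℂ) • th 0) else 0 := by
  have hconn := bounded_components (bounded_connPart hS F g n e)
  cases g with
  | zero =>
    have hsum : components (S.connPart F 0 n e) = fun _ _ => 0 :=
      funext fun a => funext fun b => sum_connPart hS hF 0 n e a b
    rw [hsum, casimir_zero, if_neg (by omega), add_zero]
    exact casimir_zero 0 N
  | succ g =>
    have hsum : components (S.connPart F (g + 1) n e) = fun a b =>
        S.omegaF F g (n + 2) (Fin.cons 0 (Fin.cons 1 spectator)) (Fin.cons a (Fin.cons b e))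
          + if g = 0 ∧ n = 0 then S.bReg 0 1 a b else 0 :=
      funext fun a => funext fun b => sum_connPart hS hF (g + 1) n e a b
    have hB : Bounded fun a b => if g = 0 ∧ n = 0 then bRNum (p := p) (q := q) a b else 0 := by
      split_ifs
      exacts [bounded_bRNum, ⟨0, fun _ _ _ => rfl⟩]
    -- Both summands must be written over the same denominator `(z_0 - z_1)²` before additivity
    -- applies.
    rw [← casimir_mulDiag hconn 0 N, ← casimir_mulDiag hconn.mulDiag 1 N]
    have h : S.omegaTwoPred F (g + 1) n e = ⟨2, fun a b =>
        mulDiag (mulDiag (components (S.connPart F (g + 1) n e))) a b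
          + if g = 0 ∧ n = 0 then bRNum a b else 0⟩ := by
      rw [hsum]; rfl
    rw [h, casimir_add hconn.mulDiag.mulDiag hB]
    congr 1
    by_cases h0 : g = 0 ∧ n = 0
    · simp only [h0, and_self, if_true, true_and, zero_add]
      exact casimir_bRNum N
    · have h0' : ¬ (g + 1 = 1 ∧ n = 0 ∧ N = 0) := by omega
      simp only [h0, h0', if_false]
      exact casimir_zero 2 N

theorem casimir_sum {S : CurveData p q} {s : ℤ} (hS : S.IsLocalSuperSpectralCurve s)
    {F : FCoeffs p q} (hF : S.IsPartitionFunction s F) (g n : ℕ) (e : Fin n → ℤ) (N : ℤ) :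
    casimir (S.omegaTwoPred F g n e) N + casimir (S.omegaSplit F g n e) N
      = (if Even N then th 0 * ∑ᶠ a : ℤ, (-1 : ℂ) ^ a •
          (S.twoPart F g n e false false a (N - a) - a • S.twoPart F g n e true true a (N - a))
        else ∑ᶠ a : ℤ, (-1 : ℂ) ^ a • S.twoPart F g n e false true a (N - a))
      + if g = 1 ∧ n = 0 ∧ N = 0 then -((2⁻¹ : ℂ) • th 0) else 0 := by
  have h2 : S.omegaSplit F g n e = ⟨0, components (S.splitPart F g n e)⟩ :=
    congrArg (Bidiff.mk 0) (funext fun a => funext fun b => omegaSplit_eq hS hF g n e a b)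
  rw [casimir_omegaTwoPred hS hF, h2, add_right_comm,
    ← casimir_add (bounded_components (bounded_connPart hS F g n e))
      (bounded_components (bounded_splitPart hS F g n e)), casimir_components
    (T := S.twoPart F g n e) (bounded_twoPart hS F g n e)
    (fun ε δ a b => (S.argFree_connPart F g n e ε δ a b).add (argFree_splitPart hS F g n e ε δ a b))]
  intro a b
  simp only [components, twoPart, mul_add, Finset.sum_add_distrib]

/-! ### Super Virasoro operators and the quadratic loop equations -/

theorem extract_finsum (S : CurveData p q) (g n : ℕ) (e : Fin n → ℤ) (w : ℤ → ℂ)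
    (f : ℤ → HSeries p q) (hf : (Function.support fun j =>
      PowerSeries.coeff (2 * g + n) (f j)).Finite) :
    evalDer (S.spectatorForms e) (∑ᶠ j : ℤ, w j • PowerSeries.coeff (2 * g + n) (f j))
      = ∑ᶠ j : ℤ, w j • S.extract g n e (f j) := by
  rw [AddMonoidHom.map_finsum]
  · refine finsum_congr fun j => ?_
    rw [evalDer_smul, extract_eq]
  · exact hf.subset fun j hj h => hj (by simp only [h, smul_zero])

theorem finite_twoZ {S : CurveData p q} {s : ℤ} (hS : S.IsLocalSuperSpectralCurve s)
    (F : FCoeffs p q) (d : ℕ) (ε δ : Bool) (N : ℤ) :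
    (Function.support fun a => PowerSeries.coeff d (S.twoZ F ε δ a (N - a))).Finite := by
  obtain ⟨M, hM⟩ := exists_coeff_oneZ_mul_eq_zero hS F d
  obtain ⟨K, hK⟩ := exists_coeff_der_der_eq_zero hS F d
  refine (Set.finite_Icc (min M K) (N - min M K)).subset fun a ha => ?_
  by_contra h
  rw [Set.mem_Icc, not_and_or] at h
  refine ha ?_
  simp only [twoZ]
  rw [map_add, hM _ _ _ _ (by omega), hK _ _ _ _ (by omega), add_zero]

theorem coeff_virG {S : CurveData p q} {s : ℤ} (hS : S.IsLocalSuperSpectralCurve s)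
    {F : FCoeffs p q} (hF : S.IsPartitionFunction s F) {n N : ℤ} (hn : 2 * n + 1 = -N) (d : ℕ) :
    PowerSeries.coeff d (virG (S.tJ F) (S.tG F) n 1)
      = ∑ᶠ j : ℤ, (-1 : ℂ) ^ (j - 1) • PowerSeries.coeff d (S.twoZ F false true j (N - j)) := by
  rw [virG, PowerSeries.coeff_mk]
  refine finsum_congr fun j => ?_
  have h : S.tJ F (-j) (S.tG F (2 * n + 1 + j) 1)
      = conjZ F (S.field false j) (conjZ F (S.field true (N - j)) 1) := by
    rw [show 2 * n + 1 + j = -(N - j) by omega]; rfl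
  rw [h, conjZ_conjZ_field hS hF, show vev false true j (N - j) = (0 : Grass p q) by simp [vev],
    cst_zero, map_zero, mul_zero, zero_add]

/-- Conjugation preserves the vacuum part of the contractions, so the subtraction in the normal
ordering cancels it exactly, and the poles of what remains are bounded. -/
theorem coeff_virL {S : CurveData p q} {s : ℤ} (hS : S.IsLocalSuperSpectralCurve s)
    {F : FCoeffs p q} (hF : S.IsPartitionFunction s F) {n N : ℤ} (hn : 2 * n = -N) (d : ℕ) :
    PowerSeries.coeff d (virL (S.tJ F) (S.tG F) n 1)
      = (2⁻¹ : ℂ) • (∑ᶠ j : ℤ, (-1 : ℂ) ^ (j - 1) •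
          PowerSeries.coeff d (S.twoZ F false false j (N - j)))
        + (2⁻¹ : ℂ) • (∑ᶠ j : ℤ, ((-1 : ℂ) ^ j * ((j : ℂ) + n)) •
          PowerSeries.coeff d (S.twoZ F true true j (N - j)))
        + if N = 0 then (4⁻¹ : ℂ) • PowerSeries.coeff d (PowerSeries.X ^ 2) else 0 := by
  have hN : n = 0 ↔ N = 0 := by omega
  rw [virL, PowerSeries.coeff_mk]
  simp only [hN, mul_one]
  congr 4
  · funext j
    have h : S.tJ F (-j) (S.tJ F (2 * n + j) 1)
        = conjZ F (S.field false j) (conjZ F (S.field false (N - j)) 1) := by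
      rw [show 2 * n + j = -(N - j) by omega]; rfl
    have hv : (vevJ (-j) (2 * n + j) : HSeries p q)
        = PowerSeries.X ^ 2 * PowerSeries.C (cst (vev false false j (N - j))) := by
      have h1 : -j + (2 * n + j) = 0 ↔ j + (N - j) = 0 := by omega
      have h2 : j + (N - j) = 0 → (0 < -j ↔ 0 < N - j) := fun h => by omega
      simp only [vevJ, vev, h1]
      by_cases h : j + (N - j) = 0
      · rw [if_pos h]
        by_cases h' : 0 < N - j
        · rw [if_pos ⟨h, (h2 h).2 h'⟩, if_pos h', show -j = N - j by omega]
          have hc : (cst ((N - j : ℤ) : Grass p q) : SuperPoly p q) = ((N - j : ℤ) : SuperPoly p q) := by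
            rw [← zsmul_one, ← zsmul_one (R := SuperPoly p q), ← cst_one]
            exact map_zsmul (AddMonoidHom.mk' cst cst_add) _ _
          rw [hc, map_intCast, zsmul_eq_mul, Int.cast_comm]
        · rw [if_neg fun h'' => h' ((h2 h).1 h''.2), if_neg h', cst_zero, map_zero, mul_zero]
      · rw [if_neg fun h' => h h'.1, if_neg h, cst_zero, map_zero, mul_zero]
    rw [h, conjZ_conjZ_field hS hF, hv, add_sub_cancel_left]
  · funext j
    have h : S.tG F (-j) (S.tG F (2 * n + j) 1)
        = conjZ F (S.field true j) (conjZ F (S.field true (N - j)) 1) := by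
      rw [show 2 * n + j = -(N - j) by omega]; rfl
    have hv : (vevG (-j) (2 * n + j) : HSeries p q)
        = PowerSeries.X ^ 2 * PowerSeries.C (cst (vev true true j (N - j))) := by
      have h1 : -j + (2 * n + j) = 0 ↔ j + (N - j) = 0 := by omega
      simp only [vevG, vev, h1]
      by_cases h : j + (N - j) = 0
      · have h2 : 0 < -j ↔ 0 < N - j := by omega
        have h3 : -j = 0 ↔ N - j = 0 := by omega
        simp only [if_pos h, h2, h3]
        split_ifs
        · rw [cst_one, map_one, mul_one]
        · rw [Algebra.algebraMap_eq_smul_one, cst_smul, cst_one]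
          ext1 d
          simp [PowerSeries.coeff_mul_C]
        · rw [cst_zero, map_zero, mul_zero]
      · rw [if_neg h, if_neg h, cst_zero, map_zero, mul_zero]
    rw [h, conjZ_conjZ_field hS hF, hv, add_sub_cancel_left]

theorem twoPart_antisymm {S : CurveData p q} {s : ℤ} (hS : S.IsLocalSuperSpectralCurve s)
    {F : FCoeffs p q} (hF : S.IsPartitionFunction s F) (g n : ℕ) (e : Fin n → ℤ) (a b : ℤ) :
    S.twoPart F g n e true true a b = -S.twoPart F g n e true true b a := by
  rw [twoPart, twoPart, connPart_antisymm hS, splitPart_antisymm hS hF, neg_add]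

/-- The reflection `j ↦ N - j` preserves the alternating weights for even `N` and reverses the sign
of the components, so the sum equals its negative. -/
theorem finsum_twoPart_eq_zero {S : CurveData p q} {s : ℤ} (hS : S.IsLocalSuperSpectralCurve s)
    {F : FCoeffs p q} (hF : S.IsPartitionFunction s F) (g n : ℕ) (e : Fin n → ℤ) {N : ℤ}
    (hN : Even N) : ∑ᶠ j : ℤ, (-1 : ℂ) ^ j • S.twoPart F g n e true true j (N - j) = 0 := by
  have h : ∑ᶠ j : ℤ, (-1 : ℂ) ^ j • S.twoPart F g n e true true j (N - j)
      = -∑ᶠ j : ℤ, (-1 : ℂ) ^ j • S.twoPart F g n e true true j (N - j) := by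
    conv_lhs => rw [← finsum_comp_equiv (Equiv.subLeft N)]
    rw [← finsum_neg_distrib]
    refine finsum_congr fun j => ?_
    rw [Equiv.subLeft_apply, sub_sub_cancel, twoPart_antisymm hS hF, smul_neg,
      zpow_sub₀ (by norm_num), hN.neg_one_zpow, one_div, ← inv_zpow, inv_neg, inv_one]
  have h2 : (2 : ℂ) • ∑ᶠ j : ℤ, (-1 : ℂ) ^ j • S.twoPart F g n e true true j (N - j) = 0 := by
    rw [two_smul]
    nth_rewrite 1 [h]
    exact neg_add_cancel _
  exact (smul_eq_zero.1 h2).resolve_left two_ne_zero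

theorem extract_virG {S : CurveData p q} {s : ℤ} (hS : S.IsLocalSuperSpectralCurve s)
    {F : FCoeffs p q} (hF : S.IsPartitionFunction s F) (g n : ℕ) (e : Fin n → ℤ) {m N : ℤ}
    (hm : 2 * m + 1 = -N) : S.extract g n e (virG (S.tJ F) (S.tG F) m 1)
      = -∑ᶠ a : ℤ, (-1 : ℂ) ^ a • S.twoPart F g n e false true a (N - a) := by
  rw [extract_eq, coeff_virG hS hF hm, extract_finsum _ _ _ _ _ _ (finite_twoZ hS F _ _ _ N),
    ← finsum_neg_distrib]
  refine finsum_congr fun j => ?_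
  rw [twoPart_eq, zpow_sub_one₀ (by norm_num), inv_neg, inv_one, mul_neg_one, neg_smul]

/-- The weight `j + m` may be replaced by `j`, since the difference multiplies the vanishing
alternating sum. What is left is the expression produced by `D^*` in the Casimir. -/
theorem extract_virL {S : CurveData p q} {s : ℤ} (hS : S.IsLocalSuperSpectralCurve s)
    {F : FCoeffs p q} (hF : S.IsPartitionFunction s F) (g n : ℕ) (e : Fin n → ℤ) {m N : ℤ}
    (hm : 2 * m = -N) : S.extract g n e (virL (S.tJ F) (S.tG F) m 1)
      = -(2⁻¹ : ℂ) • (∑ᶠ a : ℤ, (-1 : ℂ) ^ a •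
          (S.twoPart F g n e false false a (N - a) - a • S.twoPart F g n e true true a (N - a)))
        + if g = 1 ∧ n = 0 ∧ N = 0 then algebraMap ℂ _ 4⁻¹ else 0 := by
  have hN : Even N := ⟨-m, by omega⟩
  have hfin : ∀ ε δ, (Function.support fun a => S.twoPart F g n e ε δ a (N - a)).Finite :=
    fun ε δ => (bounded_twoPart hS F g n e ε δ).finite N (fun _ x => x) fun _ => rfl
  -- The central term is a constant at order `ħ²`, so it is seen only without spectators and for `g
  -- = 1`.
  have hX : evalDer (S.spectatorForms e) (if N = 0 then (4⁻¹ : ℂ) •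
      PowerSeries.coeff (2 * g + n) (PowerSeries.X ^ 2 : HSeries p q) else 0)
      = if g = 1 ∧ n = 0 ∧ N = 0 then algebraMap ℂ _ 4⁻¹ else 0 := by
    by_cases h : N = 0
    · rw [if_pos h, evalDer_smul, PowerSeries.coeff_X_pow]
      by_cases hg : 2 * g + n = 2
      · rw [if_pos hg, ← cst_one]
        rcases Nat.eq_zero_or_pos n with rfl | hn
        · rw [if_pos ⟨by omega, rfl, h⟩, evalDer_apply, spectatorForms, List.ofFn_zero,
            List.foldr_nil, augment_cst VarFree.one, Algebra.algebraMap_eq_smul_one]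
        · rw [if_neg (by omega), evalDer_cst _ VarFree.one, smul_zero]
          rw [← List.length_pos_iff, spectatorForms, List.length_ofFn]
          exact hn
      · rw [if_neg hg, if_neg (by omega), map_zero, smul_zero]
    · rw [if_neg h, if_neg (fun h' => h h'.2.2), map_zero]
  rw [extract_eq, coeff_virL hS hF hm, map_add, map_add, hX, evalDer_smul, evalDer_smul,
    extract_finsum _ _ _ _ _ _ (finite_twoZ hS F _ _ _ N),
    extract_finsum _ _ _ _ _ _ (finite_twoZ hS F _ _ _ N)]
  congr 1
  simp only [← twoPart_eq]
  have h1 : ∑ᶠ j : ℤ, ((-1 : ℂ) ^ j * ((j : ℂ) + m)) • S.twoPart F g n e true true j (N - j)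
      = ∑ᶠ j : ℤ, (-1 : ℂ) ^ j • j • S.twoPart F g n e true true j (N - j) := by
    have h0 : ∑ᶠ j : ℤ, (m : ℂ) • (-1 : ℂ) ^ j • S.twoPart F g n e true true j (N - j) = 0 := by
      rw [← smul_finsum, finsum_twoPart_eq_zero hS hF g n e hN, smul_zero]
    rw [← add_zero (∑ᶠ j : ℤ, (-1 : ℂ) ^ j • j • S.twoPart F g n e true true j (N - j)), ← h0,
      ← finsum_add_distrib]
    · refine finsum_congr fun j => ?_
      rw [← Int.cast_smul_eq_zsmul ℂ, smul_smul, smul_smul, ← add_smul]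
      congr 1
      ring
    · exact (hfin true true).subset fun j hj h => hj (by simp only [h, smul_zero])
    · exact (hfin true true).subset fun j hj h => hj (by simp only [h, smul_zero])
  rw [h1, neg_smul, ← smul_neg, ← smul_add, ← finsum_add_distrib, ← finsum_neg_distrib]
  · congr 1
    refine finsum_congr fun j => ?_
    rw [zpow_sub_one₀ (by norm_num), inv_neg, inv_one, mul_neg_one]
    module
  · exact (hfin false false).subset fun j hj h => hj (by simp only [h, smul_zero])
  · exact (hfin true true).subset fun j hj h => hj (by simp only [h, smul_zero])

/-- For even `N` the prefactor is `(√2)⁴ · ½ = 2`, which cancels the `½` in `L`; the central term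
becomes `-(2 · ¼)θ = -θ/2`, the Casimir of `B^R`. For odd `N` the prefactor is `(√2)³/(2√2) = 1`. -/
theorem pullback_E2 {S : CurveData p q} {s : ℤ} (hS : S.IsLocalSuperSpectralCurve s)
    {F : FCoeffs p q} (hF : S.IsPartitionFunction s F) (g n : ℕ) (e : Fin n → ℤ) (N : ℤ) :
    (S.E2 F g n e).pullback 3 N
      = casimir (S.omegaTwoPred F g n e) N + casimir (S.omegaSplit F g n e) N := by
  have h2 : (Real.sqrt 2 : ℂ) ^ 2 = 2 := by
    rw [← Complex.ofReal_pow, Real.sq_sqrt (by norm_num)]; norm_num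
  have h3 : (Real.sqrt 2 : ℂ) ^ 3 * -(2 * Real.sqrt 2 : ℂ)⁻¹ = -1 := by
    have : (Real.sqrt 2 : ℂ) ≠ 0 := fun h => by rw [h] at h2; norm_num at h2
    rw [pow_succ, h2, mul_neg, mul_inv_cancel₀ (mul_ne_zero two_ne_zero this)]
  have h4 : (Real.sqrt 2 : ℂ) ^ 4 = 4 := by
    rw [show (4 : ℕ) = 2 * 2 from rfl, pow_mul, h2]; norm_num
  rw [casimir_sum hS hF, BaseForm.pullback]
  by_cases hN : Even N
  · have h : ¬ Even (N - (3 : ℕ)) := by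
      rw [Int.not_even_iff_odd]; exact hN.sub_odd (by decide)
    rw [if_neg h, if_pos hN]
    simp only [E2, G2]
    rw [extract_neg, extract_smul, extract_virL hS hF g n e (N := N)
      (by push_cast; obtain ⟨k, rfl⟩ := hN; omega), h4, smul_add, neg_add, mul_add, smul_add]
    congr 1
    · rw [neg_smul, smul_neg, neg_neg, smul_smul, mul_smul_comm, smul_smul]
      norm_num
    · split_ifs
      · rw [Algebra.algebraMap_eq_smul_one]
        simp only [smul_smul, mul_neg, mul_smul_comm, mul_one, smul_neg]
        norm_num
      · simp
  · have h : Even (N - (3 : ℕ)) := (Int.not_even_iff_odd.1 hN).sub_odd (by decide)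
    have h0 : ¬ (g = 1 ∧ n = 0 ∧ N = 0) := fun h => hN (h.2.2 ▸ Even.zero)
    rw [if_pos h, if_neg hN, if_neg h0, add_zero]
    simp only [E2, G2]
    rw [extract_neg, extract_smul, extract_virG hS hF g n e (N := N)
      (by push_cast at h ⊢; obtain ⟨k, hk⟩ := h; omega), ← neg_smul, smul_smul, h3, neg_smul,
      one_smul, neg_neg]

/-- With `s = 2k + 1`, the coefficient of `x^m` involves the generators with `j = k - 1 - m`, and `j
≥ 1` is the condition `m < (s - 3)/2`; oddness of `s` makes the integer division exact. -/
theorem isBigO_E2 {S : CurveData p q} {s : ℤ} (hS : S.IsLocalSuperSpectralCurve s)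
    {F : FCoeffs p q} (hF : S.IsPartitionFunction s F) (g n : ℕ) (e : Fin n → ℤ) :
    (S.E2 F g n e).IsBigO ((s - 3) / 2) := by
  intro m hm
  have hs : ∃ k, s = 2 * k + 1 := by
    rcases hS.s_mem with rfl | rfl
    exacts [⟨0, rfl⟩, ⟨1, rfl⟩]
  obtain ⟨k, rfl⟩ := hs
  simp only [E2, G2]
  rw [hF.ann_G (k - 1 - m) (-m - 2) (by omega) (by ring),
    hF.ann_L (k - 1 - m) (-m - 2) (by omega) (by ring), smul_zero, smul_zero, neg_zero,
    extract_zero]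
  exact ⟨rfl, rfl⟩

end CurveData

end SuperLoop

end

theorem mainTheorem5 (p q : ℕ) (S : SuperLoop.CurveData p q) (s : ℤ)
    (hS : S.IsLocalSuperSpectralCurve s) (F : SuperLoop.FCoeffs p q)
    (hF : S.IsPartitionFunction s F) (g n : ℕ) (e : Fin n → ℤ) :
    (∀ N : ℤ, SuperLoop.dth 0 * (S.E1 F g n e).pullback 1 N =
      S.omegaOne F g n e N + SuperLoop.sigmaPull (S.omegaOne F g n e) N) ∧
    (∀ N : ℤ, (S.E2 F g n e).pullback 3 N =
      SuperLoop.casimir (S.omegaTwoPred F g n e) N +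
        SuperLoop.casimir (S.omegaSplit F g n e) N) ∧
    (S.E1 F g n e).IsBigO 0 ∧
    (S.E2 F g n e).IsBigO ((s - 3) / 2) := by
  exact ⟨fun N => SuperLoop.CurveData.pullback_E1 hS hF g n e N,
    fun N => SuperLoop.CurveData.pullback_E2 hS hF g n e N,
    SuperLoop.CurveData.isBigO_E1 hS hF g n e, SuperLoop.CurveData.isBigO_E2 hS hF g n e⟩
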